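/- Let $\Omega_L,\Omega_R\subset\mathbb{R}$ be open, let $\phi$ be a smooth real-valued function on $\Omega_L\times\Omega_R$, and let $K\subset\Omega_L\times\Omega_R$ be a compact set such that $\phi_{xyy}\neq 0$ and $\phi_{xxy}\neq 0$ at every point of $K$. For a smooth function $\chi:\mathbb{R}^2\to\mathbb{C}$ with support in $K$ and for $\lambda>0$ put $$T_\lambda f(x)=\int_{\mathbb{R}} e^{i\lambda\phi(x,y)}\,\chi(x,y)\,f(y)\,dy,\qquad f\in L^2(\mathbb{R}).$$ Then there is $\delta_0>0$, depending only on $\phi$ and $K$, such that the following holds for every such $\chi$ whose support has diameter at most $\delta_0$. There is $\lambda_0>0$, depending only on $\phi,\chi$ and $\delta_0$, such that for every $\delta$ with $0<\delta<\delta_0$ there is a constant $C_\delta$ (depending on $\delta$, $\phi$, $\chi$, but not on $\lambda,f,g$) such that for all $\lambda\ge\lambda_0$ and all $f,g\in L^2(\mathbb{R})$ with $\operatorname{dist}(\operatorname{supp} f,\operatorname{supp} g)\ge\delta$: (i) $\|T_\lambda f\,T_\lambda g\|_{L^1(\mathbb{R})}\le C_\delta\,\lambda^{-5/6}\,\|f\|_2\,\|g\|_2$;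 (ii) $\|T_\lambda f\,T_\lambda g\|_{L^{6/5}(\mathbb{R})}\le C_\delta\,\lambda^{-5/6}\,\bigl(\|f\|_2\|g\|_3+\|f\|_3\|g\|_2\bigr)$, where the right-hand side may be infinite (with $0\cdot\infty=0$). -/

import Mathlib

open MeasureTheory
open scoped ENNReal ContDiff

noncomputable section

/-- The partial derivative `∂/∂x` of a function of `(x, y)`. -/
def partialX (φ : ℝ × ℝ → ℝ) (p : ℝ × ℝ) : ℝ := deriv (fun x : ℝ => φ (x, p.2)) p.1

/-- The partial derivative `∂/∂y` of a function of `(x, y)`. -/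
def partialY (φ : ℝ × ℝ → ℝ) (p : ℝ × ℝ) : ℝ := deriv (fun y : ℝ => φ (p.1, y)) p.2

/-- The mixed third derivative `φ_{xyy}`. -/
def phiXYY (φ : ℝ × ℝ → ℝ) : ℝ × ℝ → ℝ := partialY (partialY (partialX φ))

/-- The mixed third derivative `φ_{xxy}`. -/
def phiXXY (φ : ℝ × ℝ → ℝ) : ℝ × ℝ → ℝ := partialY (partialX (partialX φ))

/-- The oscillatory integral operator
`T_lam f (x) = ∫ e^{i lam φ(x,y)} χ(x,y) f(y) dy` with phase `φ` and amplitude `χ`. -/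
def oscOp (φ : ℝ × ℝ → ℝ) (χ : ℝ × ℝ → ℂ) (lam : ℝ) (f : ℝ → ℂ) (x : ℝ) : ℂ :=
  ∫ y : ℝ, Complex.exp (Complex.I * (lam : ℂ) * (φ (x, y) : ℂ)) * χ (x, y) * f y

end

/-! ### Bessel's inequality under almost orthogonality, and one integration by parts. -/

section AlmostOrthogonality

/-! The two hypotheses make u = φ_{xy} vanish to first order in x and in y wherever it vanishes, so
T_λ has a two-sided fold along u = 0. With the fold included, T_λ has norm O(λ^{-1/3}) on L² and on
L³ (`exists_oscOp_fold_le`); after a cutoff to |u| ≥ τ, its L² norm is O(λ^{-1/2}). For fixed x,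
u(x,·) is bi-Lipschitz, so the y with |u(x,y)| small lie within a distance less than δ of each
other, and the separated supports of f and g cannot both meet them. Hence at every x one of T f, T g
equals the corresponding value of the operator S with the fold cut out, |T f · T g| ≤ |S f · T g| +
|T f · S g|, and Hölder gives both bounds, since 1/2 + 1/3 = 5/6 (`exists_bilinear_le`).

For the fold bounds put σ = λ^{-1/3}. Where |u| ≲ σ the slices of the amplitude have length O(σ) and
Schur's test suffices (`exists_coreAmp_le`). The rest is cut into dyadic pieces T_k with ±u ~ s_k =
σ2^k. The L² norm of T_k is O((λ s_k)^{-1/2}), which sums geometrically. On L³ the exponent is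
critical: interpolating with the L^∞ bound O(s_k) gives λ^{-1/3} at every scale, so the triangle
inequality would lose a logarithm.

The logarithm is removed by orthogonality between scales. The kernels of T_k, sampled at one point
in each cell of length 1/(λ s_k²), satisfy a Bessel inequality jointly in k and the cell
(`exists_sampled_square_le`), because non-stationary phase controls their Gram matrix. Since the
sample points are arbitrary, this controls Σ_k Σ_cells s_k^{-1} sup |T_k f|². Truncating f turns
such square estimates into cubic ones (`sum_cube_le_of_truncation`). Finally |Σ T_k f|³ is expanded
into triples of scales. On a cell of the finest scale a, that factor is taken in supremum and the
other two, at scales a+d and a+e, in L²; this gains 2^{-(d+e)/3} and makes the sum converge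
(`exists_dyadic_sum_L3_le`). -/

/-- Bessel's inequality for an almost orthogonal weighted family: the constant is controlled by
the weighted row sums of the Gram matrix. -/
theorem bessel_of_gram_row_sum_le {E ι : Type*} [NormedAddCommGroup E] [InnerProductSpace ℂ E]
    (s : Finset ι) (v : ι → E) (w : ι → ℝ) (hw : ∀ i ∈ s, 0 ≤ w i) {C : ℝ} (hC0 : 0 ≤ C)
    (hC : ∀ i ∈ s, ∑ j ∈ s, w j * ‖inner ℂ (v i) (v j)‖ ≤ C) (f : E) :
    ∑ i ∈ s, w i * ‖inner ℂ (v i) f‖ ^ 2 ≤ C * ‖f‖ ^ 2 := by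
  set c : ι → ℂ := fun i => inner ℂ (v i) f with hc
  set S : ℝ := ∑ i ∈ s, w i * ‖c i‖ ^ 2 with hS
  have hS0 : 0 ≤ S := Finset.sum_nonneg fun i hi => mul_nonneg (hw i hi) (by positivity)
  -- Duality: the left side S equals ⟨g, f⟩, so S ≤ ‖g‖‖f‖, and ‖g‖² ≤ C S will follow from the row
  -- sums alone.
  set g : E := ∑ i ∈ s, ((w i : ℂ) * c i) • v i with hg
  have h1 : inner ℂ g f = (S : ℂ) := by
    rw [hg, sum_inner, hS, Complex.ofReal_sum]
    refine Finset.sum_congr rfl fun i _ => ?_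
    rw [inner_smul_left]
    change (starRingEnd ℂ) ((w i : ℂ) * c i) * c i = _
    rw [map_mul, Complex.conj_ofReal, mul_assoc, mul_comm ((starRingEnd ℂ) (c i)) (c i),
      Complex.mul_conj, Complex.normSq_eq_norm_sq]
    push_cast; ring
  have h2 : S ≤ ‖g‖ * ‖f‖ := by
    have := norm_inner_le_norm (𝕜 := ℂ) g f
    rw [h1, Complex.norm_real, Real.norm_eq_abs, abs_of_nonneg hS0] at this
    exact this
  have h3 : ‖g‖ ^ 2 ≤ C * S := by
    have e1 : ‖g‖ ^ 2 ≤ ∑ i ∈ s, ∑ j ∈ s, w i * w j * (‖c i‖ * ‖c j‖) * ‖inner ℂ (v i) (v j)‖ := by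
      have : ((‖g‖ ^ 2 : ℝ) : ℂ) = inner ℂ g g := by
        rw [inner_self_eq_norm_sq_to_K]; push_cast; rfl
      have h4 : ‖g‖ ^ 2 = ‖(inner ℂ g g : ℂ)‖ := by
        rw [← this, Complex.norm_real, Real.norm_eq_abs, abs_of_nonneg (by positivity)]
      rw [h4]
      conv_lhs => rw [hg]
      rw [sum_inner]
      refine (norm_sum_le _ _).trans (Finset.sum_le_sum fun i hi => ?_)
      rw [inner_sum]
      refine (norm_sum_le _ _).trans (Finset.sum_le_sum fun j hj => ?_)
      rw [inner_smul_left, inner_smul_right, norm_mul, norm_mul, RCLike.norm_conj, norm_mul,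
        norm_mul, Complex.norm_real, Complex.norm_real, Real.norm_eq_abs, Real.norm_eq_abs,
        abs_of_nonneg (hw i hi), abs_of_nonneg (hw j hj)]
      apply le_of_eq; ring
    -- Schur's test: by 2|c_i||c_j| ≤ |c_i|² + |c_j|² and the symmetry of the Gram moduli, row sums
    -- are all that is needed.
    have e2 : ∑ i ∈ s, ∑ j ∈ s, w i * w j * (‖c i‖ * ‖c j‖) * ‖inner ℂ (v i) (v j)‖ ≤
        ∑ i ∈ s, ∑ j ∈ s, (w i * ‖c i‖ ^ 2 * (w j * ‖inner ℂ (v i) (v j)‖) / 2 +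
          w j * ‖c j‖ ^ 2 * (w i * ‖inner ℂ (v j) (v i)‖) / 2) := by
      refine Finset.sum_le_sum fun i hi => Finset.sum_le_sum fun j hj => ?_
      rw [norm_inner_symm (v j) (v i)]
      have : 0 ≤ w i * w j * ‖inner ℂ (v i) (v j)‖ :=
        mul_nonneg (mul_nonneg (hw i hi) (hw j hj)) (norm_nonneg _)
      nlinarith [mul_nonneg this (sq_nonneg (‖c i‖ - ‖c j‖))]
    have e3 : ∑ i ∈ s, ∑ j ∈ s, w i * ‖c i‖ ^ 2 * (w j * ‖inner ℂ (v i) (v j)‖) / 2 ≤ C * S / 2 := by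
      rw [hS, Finset.mul_sum, Finset.sum_div]
      refine Finset.sum_le_sum fun i hi => ?_
      rw [← Finset.sum_div, ← Finset.mul_sum]
      have := mul_le_mul_of_nonneg_left (hC i hi) (mul_nonneg (hw i hi) (sq_nonneg ‖c i‖))
      linarith
    have e4 : ∑ i ∈ s, ∑ j ∈ s, w j * ‖c j‖ ^ 2 * (w i * ‖inner ℂ (v j) (v i)‖) / 2 ≤ C * S / 2 := by
      rw [Finset.sum_comm]; exact e3
    have e5 : ∑ i ∈ s, ∑ j ∈ s, (w i * ‖c i‖ ^ 2 * (w j * ‖inner ℂ (v i) (v j)‖) / 2 +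
          w j * ‖c j‖ ^ 2 * (w i * ‖inner ℂ (v j) (v i)‖) / 2) ≤ C * S := by
      simp only [Finset.sum_add_distrib]
      linarith
    linarith
  have h4 : S * S ≤ (C * ‖f‖ ^ 2) * S := by
    calc S * S ≤ (‖g‖ * ‖f‖) * (‖g‖ * ‖f‖) := mul_self_le_mul_self hS0 h2
      _ = ‖g‖ ^ 2 * ‖f‖ ^ 2 := by ring
      _ ≤ (C * S) * ‖f‖ ^ 2 := by gcongr
      _ = _ := by ring
  rcases hS0.eq_or_lt with h | h
  · rw [← h]; positivity
  · exact le_of_mul_le_mul_right h4 h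

/-- One integration by parts in an oscillatory integral. -/
theorem integral_oscillatory_by_parts {Φ : ℝ → ℝ} {a : ℝ → ℂ} {p : ℝ → ℝ} {lam : ℝ}
    (hlam : lam ≠ 0) (hΦ : ∀ y, HasDerivAt Φ (p y) y) {a' w : ℝ → ℂ}
    (hw : ∀ y, HasDerivAt w (a' y) y) (ha'c : Continuous a') (hwc : HasCompactSupport w)
    (hpw : ∀ y, (p y : ℂ) * w y = a y) (hac : Continuous a) :
    ∫ y, Complex.exp (Complex.I * lam * Φ y) * a y =
      (Complex.I / lam) * ∫ y, Complex.exp (Complex.I * lam * Φ y) * a' y := by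
  have hΦc : Continuous Φ := continuous_iff_continuousAt.2 fun y => (hΦ y).continuousAt
  have hwcont : Continuous w := continuous_iff_continuousAt.2 fun y => (hw y).continuousAt
  have hE : ∀ y, HasDerivAt (fun y => Complex.exp (Complex.I * lam * Φ y))
      (Complex.exp (Complex.I * lam * Φ y) * (Complex.I * lam * p y)) y := fun y =>
    ((hΦ y).ofReal_comp.const_mul (Complex.I * lam)).cexp
  have hEc : Continuous fun y => Complex.exp (Complex.I * lam * Φ y) := by fun_prop
  have hG : ∀ y, HasDerivAt (fun y => Complex.exp (Complex.I * lam * Φ y) * w y)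
      (Complex.I * lam * (Complex.exp (Complex.I * lam * Φ y) * a y) +
        Complex.exp (Complex.I * lam * Φ y) * a' y) y := fun y => by
    refine ((hE y).mul (hw y)).congr_deriv ?_
    rw [← hpw y]; ring
  have ha's : HasCompactSupport a' := by
    have : a' = deriv w := by ext y; exact (hw y).deriv.symm
    rw [this]; exact hwc.deriv
  have has : HasCompactSupport a := by
    have : a = fun y => (p y : ℂ) * w y := by ext y; exact (hpw y).symm
    rw [this]; exact hwc.mul_left
  have i1 : Integrable fun y => Complex.exp (Complex.I * lam * Φ y) * a y :=
    (hEc.mul hac).integrable_of_hasCompactSupport has.mul_left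
  have i2 : Integrable fun y => Complex.exp (Complex.I * lam * Φ y) * a' y :=
    (hEc.mul ha'c).integrable_of_hasCompactSupport ha's.mul_left
  have i3 : Integrable fun y => Complex.exp (Complex.I * lam * Φ y) * w y :=
    (hEc.mul hwcont).integrable_of_hasCompactSupport hwc.mul_left
  have h0 := integral_eq_zero_of_hasDerivAt_of_integrable hG ((i1.const_mul _).add i2) i3
  rw [integral_add (i1.const_mul _) i2, integral_const_mul] at h0
  have hl : (lam : ℂ) ≠ 0 := by exact_mod_cast hlam
  have hI : Complex.I * lam ≠ 0 := mul_ne_zero Complex.I_ne_zero hl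
  apply mul_left_cancel₀ hI
  rw [eq_neg_of_add_eq_zero_left h0]
  field_simp
  rw [Complex.I_sq]; ring

end AlmostOrthogonality

/-! ### Non-stationary phase with explicit constants. -/

section NonStationaryPhase

theorem continuousAt_of_eventually_zero {f : ℝ → ℂ} {y : ℝ} (h : f =ᶠ[nhds y] 0) :
    ContinuousAt f y :=
  (continuousAt_const (y := (0 : ℂ))).congr h.symm

theorem hasDerivAt_of_eventually_zero {f : ℝ → ℂ} {y : ℝ} {d : ℂ} (h : f =ᶠ[nhds y] 0)
    (hd : d = 0) : HasDerivAt f d y := by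
  rw [hd]
  exact (hasDerivAt_const y (0 : ℂ)).congr_of_eventuallyEq h

/-- Non-stationary phase with two integrations by parts: amplitude and phase derivative vary
at scale `1 / κ`. -/
theorem norm_integral_oscillatory_le {Φ p p1 p2 : ℝ → ℝ} {a : ℝ → ℂ} {lam μ κ A ℓ y0 : ℝ}
    (ha : ContDiff ℝ 2 a) (hcs : HasCompactSupport a)
    (hΦ : ∀ y, HasDerivAt Φ (p y) y) (hp : ∀ y, HasDerivAt p (p1 y) y)
    (hp1 : ∀ y, HasDerivAt p1 (p2 y) y) (hp2 : Continuous p2)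
    (hlam : 0 < lam) (hμ : 0 < μ) (hκ : 0 ≤ κ) (hA : 0 ≤ A) (hℓ : 0 ≤ ℓ)
    (hsupp : ∀ y, a y ≠ 0 → |y - y0| ≤ ℓ)
    (bp : ∀ y ∈ tsupport a, μ ≤ |p y|) (bp1 : ∀ y ∈ tsupport a, |p1 y| ≤ κ * |p y|)
    (bp2 : ∀ y ∈ tsupport a, |p2 y| ≤ κ ^ 2 * |p y|)
    (ba : ∀ y, ‖a y‖ ≤ A) (ba1 : ∀ y, ‖deriv a y‖ ≤ A * κ)
    (ba2 : ∀ y, ‖deriv (deriv a) y‖ ≤ A * κ ^ 2) :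
    ‖∫ y, Complex.exp (Complex.I * lam * Φ y) * a y‖ ≤ 16 * A * (κ / (lam * μ)) ^ 2 * ℓ := by
  have hd1 : ContDiff ℝ 1 (deriv a) := 
    (contDiff_succ_iff_deriv.1 (by rw [one_add_one_eq_two]; exact ha)).2.2
  have hd2 : ContDiff ℝ 0 (deriv (deriv a)) := 
    (contDiff_succ_iff_deriv.1 (by rw [zero_add]; exact hd1)).2.2
  have da : ∀ y, HasDerivAt a (deriv a y) y := fun y =>
    (ha.differentiable (by norm_num) y).hasDerivAt
  have da1 : ∀ y, HasDerivAt (deriv a) (deriv (deriv a) y) y := fun y =>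
    (hd1.differentiable (by norm_num) y).hasDerivAt
  have c0 : Continuous a := ha.continuous
  have c1 : Continuous (deriv a) := hd1.continuous
  have c2 : Continuous (deriv (deriv a)) := hd2.continuous
  have cp : Continuous p := continuous_iff_continuousAt.2 fun y => (hp y).continuousAt
  have cp1 : Continuous p1 := continuous_iff_continuousAt.2 fun y => (hp1 y).continuousAt
  have pne : ∀ y ∈ tsupport a, (p y : ℂ) ≠ 0 := fun y hy => by
    have := bp y hy
    have h : p y ≠ 0 := by
      intro h; rw [h, abs_zero] at this; linarith
    exact_mod_cast h
  have ev0 : ∀ y, y ∉ tsupport a → a =ᶠ[nhds y] 0 := fun y hy => notMem_tsupport_iff_eventuallyEq.1 hy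
  have ev1 : ∀ y, y ∉ tsupport a → deriv a =ᶠ[nhds y] 0 := fun y hy => by
    have := (ev0 y hy).deriv
    simpa using this
  have ev2 : ∀ y, y ∉ tsupport a → deriv (deriv a) =ᶠ[nhds y] 0 := fun y hy => by
    have := (ev1 y hy).deriv
    simpa using this
  -- The two integrations by parts produce w = a/p, w1 = w', v = w1/p, v1 = v'. The phase derivative
  -- p may vanish off `tsupport a`, but there all four functions are locally zero, so
  -- differentiability and continuity survive.
  set w : ℝ → ℂ := fun y => a y / p y with hw
  set w1 : ℝ → ℂ := fun y => deriv a y / p y - a y * p1 y / (p y) ^ 2 with hw1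
  set v : ℝ → ℂ := fun y => deriv a y / (p y) ^ 2 - a y * p1 y / (p y) ^ 3 with hv
  set v1 : ℝ → ℂ := fun y => deriv (deriv a) y / (p y) ^ 2 - 3 * (deriv a y * p1 y / (p y) ^ 3)
    - a y * p2 y / (p y) ^ 3 + 3 * (a y * p1 y ^ 2 / (p y) ^ 4) with hv1
  have ew : ∀ y, y ∉ tsupport a → w =ᶠ[nhds y] 0 := fun y hy => by
    filter_upwards [ev0 y hy] with z hz; simp [hw, hz]
  have ew1 : ∀ y, y ∉ tsupport a → w1 =ᶠ[nhds y] 0 := fun y hy => by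
    filter_upwards [ev0 y hy, ev1 y hy] with z hz hz1; simp [hw1, hz, hz1]
  have ev : ∀ y, y ∉ tsupport a → v =ᶠ[nhds y] 0 := fun y hy => by
    filter_upwards [ev0 y hy, ev1 y hy] with z hz hz1; simp [hv, hz, hz1]
  have evv : ∀ y, y ∉ tsupport a → v1 =ᶠ[nhds y] 0 := fun y hy => by
    filter_upwards [ev0 y hy, ev1 y hy, ev2 y hy] with z hz hz1 hz2; simp [hv1, hz, hz1, hz2]
  have dw : ∀ y, HasDerivAt w (w1 y) y := fun y => by
    by_cases hy : y ∈ tsupport a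
    · have := (da y).div (hp y).ofReal_comp (pne y hy)
      refine this.congr_deriv ?_
      have h0 := pne y hy
      simp only [hw1]; field_simp
    · exact hasDerivAt_of_eventually_zero (ew y hy) (ew1 y hy).self_of_nhds
  have dv : ∀ y, HasDerivAt v (v1 y) y := fun y => by
    by_cases hy : y ∈ tsupport a
    · have h0 := pne y hy
      have e1 := (da1 y).div ((hp y).ofReal_comp.pow 2) (pow_ne_zero 2 h0)
      have e2 := ((da y).mul (hp1 y).ofReal_comp).div ((hp y).ofReal_comp.pow 3) (pow_ne_zero 3 h0)
      refine (e1.sub e2).congr_deriv ?_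
      simp only [hv1, Pi.mul_apply, Pi.pow_apply]; field_simp; push_cast; ring
    · exact hasDerivAt_of_eventually_zero (ev y hy) (evv y hy).self_of_nhds
  have cw1 : Continuous w1 := continuous_iff_continuousAt.2 fun y => by
    by_cases hy : y ∈ tsupport a
    · have h0 := pne y hy
      have := c0.continuousAt (x := y); have := c1.continuousAt (x := y)
      have : ContinuousAt (fun y => (p y : ℂ)) y := by fun_prop
      have : ContinuousAt (fun y => (p1 y : ℂ)) y := by fun_prop
      exact ContinuousAt.sub (ContinuousAt.div₀ (by assumption) (by assumption) h0)
        (ContinuousAt.div₀ (by fun_prop) (by fun_prop) (pow_ne_zero 2 h0))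
    · exact continuousAt_of_eventually_zero (ew1 y hy)
  have cv1 : Continuous v1 := continuous_iff_continuousAt.2 fun y => by
    by_cases hy : y ∈ tsupport a
    · have h0 := pne y hy
      refine ((ContinuousAt.sub (ContinuousAt.sub ?_ ?_) ?_)).add ?_
      · exact ContinuousAt.div₀ (by fun_prop) (by fun_prop) (pow_ne_zero 2 h0)
      · exact continuousAt_const.mul (ContinuousAt.div₀ (by fun_prop) (by fun_prop) (pow_ne_zero 3 h0))
      · exact ContinuousAt.div₀ (by fun_prop) (by fun_prop) (pow_ne_zero 3 h0)
      · exact continuousAt_const.mul (ContinuousAt.div₀ (by fun_prop) (by fun_prop) (pow_ne_zero 4 h0))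
    · exact continuousAt_of_eventually_zero (evv y hy)
  have off0 : ∀ y, y ∉ tsupport a → a y = 0 := fun y hy => (ev0 y hy).self_of_nhds
  have off1 : ∀ y, y ∉ tsupport a → deriv a y = 0 := fun y hy => (ev1 y hy).self_of_nhds
  have csw : HasCompactSupport w := hcs.mono' fun y hy => by
    by_contra h; exact hy (ew y h).self_of_nhds
  have csv : HasCompactSupport v := hcs.mono' fun y hy => by
    by_contra h; exact hy (ev y h).self_of_nhds
  have pw : ∀ y, (p y : ℂ) * w y = a y := fun y => by
    by_cases hy : y ∈ tsupport a
    · have h0 := pne y hy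
      simp only [hw]; field_simp
    · simp [hw, off0 y hy]
  have pv : ∀ y, (p y : ℂ) * v y = w1 y := fun y => by
    by_cases hy : y ∈ tsupport a
    · have h0 := pne y hy
      simp only [hv, hw1]; field_simp
    · simp [hv, hw1, off0 y hy, off1 y hy]
  rw [integral_oscillatory_by_parts hlam.ne' hΦ dw cw1 csw pw c0,
    integral_oscillatory_by_parts hlam.ne' hΦ dv cv1 csv pv cw1]
  have hts : ∀ y ∈ tsupport a, |y - y0| ≤ ℓ := fun y hy => by
    have hcl : IsClosed {y : ℝ | |y - y0| ≤ ℓ} := isClosed_le (by fun_prop) continuous_const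
    exact closure_minimal (fun z hz => hsupp z hz) hcl hy
  -- The 8 is 1 + 3 + 1 + 3, the coefficients in v1; the interval of length 2ℓ doubles it to 16.
  have bv1 : ∀ y, ‖v1 y‖ ≤ 8 * A * (κ / μ) ^ 2 := fun y => by
    by_cases hy : y ∈ tsupport a
    · have h0 := pne y hy
      have hpos : 0 < |p y| := hμ.trans_le (bp y hy)
      have t1 : ‖deriv (deriv a) y / (p y : ℂ) ^ 2‖ ≤ A * (κ / |p y|) ^ 2 := by
        rw [norm_div, norm_pow, Complex.norm_real, Real.norm_eq_abs, div_pow, ← mul_div_assoc]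
        exact div_le_div_of_nonneg_right (ba2 y) (by positivity)
      have t2 : ‖deriv a y * p1 y / (p y : ℂ) ^ 3‖ ≤ A * (κ / |p y|) ^ 2 := by
        rw [norm_div, norm_mul, norm_pow, Complex.norm_real, Complex.norm_real, Real.norm_eq_abs,
          Real.norm_eq_abs, div_le_iff₀ (by positivity)]
        calc ‖deriv a y‖ * |p1 y| ≤ (A * κ) * (κ * |p y|) :=
              mul_le_mul (ba1 y) (bp1 y hy) (abs_nonneg _) (by positivity)
          _ = _ := by field_simp
      have t3 : ‖a y * p2 y / (p y : ℂ) ^ 3‖ ≤ A * (κ / |p y|) ^ 2 := by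
        rw [norm_div, norm_mul, norm_pow, Complex.norm_real, Complex.norm_real, Real.norm_eq_abs,
          Real.norm_eq_abs, div_le_iff₀ (by positivity)]
        calc ‖a y‖ * |p2 y| ≤ A * (κ ^ 2 * |p y|) :=
              mul_le_mul (ba y) (bp2 y hy) (abs_nonneg _) (by positivity)
          _ = _ := by field_simp
      have t4 : ‖a y * p1 y ^ 2 / (p y : ℂ) ^ 4‖ ≤ A * (κ / |p y|) ^ 2 := by
        rw [norm_div, norm_mul, norm_pow, norm_pow, Complex.norm_real, Complex.norm_real,
          Real.norm_eq_abs, Real.norm_eq_abs, div_le_iff₀ (by positivity)]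
        calc ‖a y‖ * |p1 y| ^ 2 ≤ A * (κ * |p y|) ^ 2 :=
              mul_le_mul (ba y) (pow_le_pow_left₀ (abs_nonneg _) (bp1 y hy) 2) (by positivity)
                (by positivity)
          _ = _ := by field_simp
      have n3 : ∀ z : ℂ, ‖3 * z‖ = 3 * ‖z‖ := fun z => by rw [norm_mul]; norm_num
      calc ‖v1 y‖ ≤ ‖deriv (deriv a) y / (p y : ℂ) ^ 2‖ + 3 * ‖deriv a y * p1 y / (p y : ℂ) ^ 3‖
            + ‖a y * p2 y / (p y : ℂ) ^ 3‖ + 3 * ‖a y * p1 y ^ 2 / (p y : ℂ) ^ 4‖ := by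
            rw [← n3, ← n3]
            exact (norm_add_le _ _).trans (add_le_add_left ((norm_sub_le _ _).trans
              (add_le_add_left (norm_sub_le _ _) _)) _)
        _ ≤ 8 * (A * (κ / |p y|) ^ 2) := by linarith
        _ ≤ 8 * (A * (κ / μ) ^ 2) := by
            have := bp y hy
            gcongr
        _ = _ := by ring
    · rw [(evv y hy).self_of_nhds]; simp; positivity
  have hint : ‖∫ y, Complex.exp (Complex.I * lam * Φ y) * v1 y‖ ≤
      8 * A * (κ / μ) ^ 2 * (2 * ℓ) := by
    have hset : ∫ y, Complex.exp (Complex.I * lam * Φ y) * v1 y =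
        ∫ y in Set.Icc (y0 - ℓ) (y0 + ℓ), Complex.exp (Complex.I * lam * Φ y) * v1 y := by
      rw [setIntegral_eq_integral_of_forall_compl_eq_zero]
      intro y hy
      have : y ∉ tsupport a := fun h => hy (by
        have := abs_le.1 (hts y h); constructor <;> linarith)
      rw [(evv y this).self_of_nhds]; simp
    rw [hset]
    have := norm_setIntegral_le_of_norm_le_const (μ := volume) (s := Set.Icc (y0 - ℓ) (y0 + ℓ))
      (f := fun y => Complex.exp (Complex.I * lam * Φ y) * v1 y) (C := 8 * A * (κ / μ) ^ 2)
      (by simp) (fun y _ => by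
        have he : ‖Complex.exp (Complex.I * lam * Φ y)‖ = 1 := by
          rw [mul_assoc, mul_comm, ← Complex.ofReal_mul, Complex.norm_exp_ofReal_mul_I]
        rw [norm_mul, he, one_mul]
        exact bv1 y)
    refine this.trans (le_of_eq ?_)
    simp only [measureReal_def, Real.volume_Icc]
    rw [ENNReal.toReal_ofReal (by linarith)]
    ring
  have hn : ‖Complex.I / (lam : ℂ)‖ = 1 / lam := by
    rw [norm_div, Complex.norm_I, Complex.norm_real, Real.norm_eq_abs, abs_of_pos hlam]
  rw [norm_mul, norm_mul, hn]
  calc 1 / lam * (1 / lam * ‖∫ y, Complex.exp (Complex.I * lam * Φ y) * v1 y‖)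
      ≤ 1 / lam * (1 / lam * (8 * A * (κ / μ) ^ 2 * (2 * ℓ))) := by gcongr
    _ = _ := by field_simp; ring

end NonStationaryPhase

/-! ### Interpolation by truncation, grid sums, and combinatorics of scales. -/

section Interpolation

/-- The part of `f` where `‖f‖ > s`. -/
noncomputable def highPart (f : ℝ → ℂ) (s : ℝ) : ℝ → ℂ := Set.indicator {y | s < ‖f y‖} f

/-- The part of `f` where `‖f‖ ≤ s`. -/
noncomputable def lowPart (f : ℝ → ℂ) (s : ℝ) : ℝ → ℂ := Set.indicator {y | ‖f y‖ ≤ s} f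

theorem lowPart_add_highPart (f : ℝ → ℂ) (s : ℝ) (y : ℝ) :
    lowPart f s y + highPart f s y = f y := by
  by_cases h : ‖f y‖ ≤ s
  · simp [lowPart, highPart, h]
  · simp [lowPart, highPart, h, not_le.1 h]

theorem norm_lowPart_le {f : ℝ → ℂ} {s : ℝ} (hs : 0 ≤ s) (y : ℝ) : ‖lowPart f s y‖ ≤ s := by
  by_cases h : ‖f y‖ ≤ s
  · simp [lowPart, h]
  · simp [lowPart, h, hs]

/-- Layer cake: for fixed y the levels s > 0 below |f(y)| have total length |f(y)|, which supplies
the third power after Tonelli. -/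
theorem lintegral_highPart_sq {f : ℝ → ℂ} (hf : Measurable f) :
    ∫⁻ s in Set.Ioi (0 : ℝ), ∫⁻ y, ‖highPart f s y‖ₑ ^ 2 = ∫⁻ y, ‖f y‖ₑ ^ 3 := by
  have hm : Measurable fun z : ℝ × ℝ => ‖highPart f z.1 z.2‖ₑ ^ 2 := by
    have : (fun z : ℝ × ℝ => ‖highPart f z.1 z.2‖ₑ ^ 2) =
        Set.indicator {z : ℝ × ℝ | z.1 < ‖f z.2‖} (fun z => ‖f z.2‖ₑ ^ 2) := by
      ext z
      by_cases h : z.1 < ‖f z.2‖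
      · simp [highPart, Set.indicator, h]
      · simp [highPart, Set.indicator, h]
    rw [this]
    refine Measurable.indicator (by fun_prop) ?_
    exact measurableSet_lt (by fun_prop) (by fun_prop)
  rw [lintegral_lintegral_swap (f := fun s y => ‖highPart f s y‖ₑ ^ 2) hm.aemeasurable]
  refine lintegral_congr fun y => ?_
  have : ∀ s, ‖highPart f s y‖ₑ ^ 2 = Set.indicator (Set.Iio ‖f y‖) (fun _ => ‖f y‖ₑ ^ 2) s := by
    intro s
    by_cases h : s < ‖f y‖
    · simp [highPart, Set.indicator, h]
    · simp [highPart, Set.indicator, h]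
  simp only [this]
  rw [lintegral_indicator measurableSet_Iio, Measure.restrict_restrict measurableSet_Iio,
    setLIntegral_const, Set.inter_comm, Set.Ioi_inter_Iio, Real.volume_Ioo, sub_zero,
    ofReal_norm]
  ring

/-- Superadditivity of the lower integral needs no measurability. It is applied to s ↦ N(`highPart f
s`)², where N may be a supremum over a cell and nothing is known about measurability in s. -/
theorem sum_lintegral_le_lintegral_sum {α ι : Type*} [MeasurableSpace α] {μ : Measure α}
    (S : Finset ι) (g : ι → α → ℝ≥0∞) :
    ∑ i ∈ S, ∫⁻ x, g i x ∂μ ≤ ∫⁻ x, ∑ i ∈ S, g i x ∂μ := by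
  classical
  induction S using Finset.induction_on with
  | empty => simp
  | insert a S ha ih =>
    simp only [Finset.sum_insert ha]
    exact (add_le_add_right ih _).trans (le_lintegral_add _ _)

/-- Real interpolation between square-function and uniform bounds, by truncation. -/
theorem sum_cube_le_of_truncation {ι : Type*} (S : Finset ι) (N : ι → (ℝ → ℂ) → ℝ≥0∞)
    (w : ι → ℝ≥0∞) (B : ι → ℝ) (hB : ∀ i ∈ S, 0 < B i) (D : ℝ≥0∞) {f : ℝ → ℂ}
    (hf : Measurable f) (hfin : ∀ i ∈ S, N i f ≠ ⊤)
    (hsub : ∀ i ∈ S, ∀ s, 0 < s → N i f ≤ ENNReal.ofReal (B i * s) + N i (highPart f s))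
    (hsq : ∀ s, 0 < s → ∑ i ∈ S, w i * ENNReal.ofReal (B i) * N i (highPart f s) ^ 2 ≤
      D * ∫⁻ y, ‖highPart f s y‖ₑ ^ 2) :
    ∑ i ∈ S, w i * N i f ^ 3 ≤ 8 * D * ∫⁻ y, ‖f y‖ₑ ^ 3 := by
  have key : ∀ i ∈ S, N i f ^ 3 ≤ 8 * (ENNReal.ofReal (B i) *
      ∫⁻ s in Set.Ioi (0 : ℝ), N i (highPart f s) ^ 2) := by
    intro i hi
    have hBi := hB i hi
    set t := (N i f).toReal with ht
    have hNt : N i f = ENNReal.ofReal t := (ENNReal.ofReal_toReal (hfin i hi)).symm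
    have ht0 : 0 ≤ t := ENNReal.toReal_nonneg
    -- For s < t/(2B) the bounded part accounts for at most half of t = N(f), so N of the high part
    -- is at least t/2. Integrating over these levels gives t³/(8B), the source of the factor 8.
    have h1 : ENNReal.ofReal ((t / 2) ^ 2 * (t / (2 * B i))) ≤
        ∫⁻ s in Set.Ioi (0 : ℝ), N i (highPart f s) ^ 2 := by
      calc ENNReal.ofReal ((t / 2) ^ 2 * (t / (2 * B i)))
          = ∫⁻ s in Set.Ioo (0 : ℝ) (t / (2 * B i)), ENNReal.ofReal (t / 2) ^ 2 := by
            rw [setLIntegral_const, Real.volume_Ioo, sub_zero,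
              ENNReal.ofReal_mul (by positivity), ENNReal.ofReal_pow (by positivity)]
        _ ≤ ∫⁻ s in Set.Ioo (0 : ℝ) (t / (2 * B i)), N i (highPart f s) ^ 2 := by
            refine setLIntegral_mono' measurableSet_Ioo fun s hs => ?_
            have h2 := hsub i hi s hs.1
            have h3 : B i * s ≤ t / 2 := by
              have := (lt_div_iff₀ (by positivity)).1 hs.2
              linarith
            have h4 : ENNReal.ofReal (t / 2) + ENNReal.ofReal (t / 2) ≤
                ENNReal.ofReal (t / 2) + N i (highPart f s) := by
              rw [← ENNReal.ofReal_add (by positivity) (by positivity), add_halves, ← hNt]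
              exact h2.trans (add_le_add_left (ENNReal.ofReal_le_ofReal h3) _)
            have h5 := (ENNReal.add_le_add_iff_left ENNReal.ofReal_ne_top).1 h4
            gcongr
        _ ≤ _ := lintegral_mono_set fun s hs => hs.1
    calc N i f ^ 3 = 8 * (ENNReal.ofReal (B i) * ENNReal.ofReal ((t / 2) ^ 2 * (t / (2 * B i)))) := by
          rw [hNt, ← ENNReal.ofReal_mul hBi.le, ← ENNReal.ofReal_pow ht0]
          have : (8 : ℝ≥0∞) = ENNReal.ofReal 8 := by simp
          rw [this, ← ENNReal.ofReal_mul (by norm_num)]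
          congr 1
          field_simp; ring
      _ ≤ _ := by gcongr
  calc ∑ i ∈ S, w i * N i f ^ 3
      ≤ ∑ i ∈ S, w i * (8 * (ENNReal.ofReal (B i) *
        ∫⁻ s in Set.Ioi (0 : ℝ), N i (highPart f s) ^ 2)) :=
        Finset.sum_le_sum fun i hi => mul_le_mul_right (key i hi) _
    _ = 8 * ∑ i ∈ S, (w i * ENNReal.ofReal (B i)) *
        ∫⁻ s in Set.Ioi (0 : ℝ), N i (highPart f s) ^ 2 := by
        rw [Finset.mul_sum]; refine Finset.sum_congr rfl fun i _ => ?_; ring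
    _ ≤ 8 * ∑ i ∈ S, ∫⁻ s in Set.Ioi (0 : ℝ),
        w i * ENNReal.ofReal (B i) * N i (highPart f s) ^ 2 := by
        gcongr; exact lintegral_const_mul_le _ _
    _ ≤ 8 * ∫⁻ s in Set.Ioi (0 : ℝ), ∑ i ∈ S,
        w i * ENNReal.ofReal (B i) * N i (highPart f s) ^ 2 := by
        gcongr; exact sum_lintegral_le_lintegral_sum _ _
    _ ≤ 8 * ∫⁻ s in Set.Ioi (0 : ℝ), D * ∫⁻ y, ‖highPart f s y‖ₑ ^ 2 := by
        gcongr 8 * ?_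
        exact setLIntegral_mono' measurableSet_Ioi fun s hs => hsq s hs
    _ = 8 * D * ∫⁻ y, ‖f y‖ₑ ^ 3 := by
        have hm : Measurable fun z : ℝ × ℝ => ‖highPart f z.1 z.2‖ₑ ^ 2 := by
          have : (fun z : ℝ × ℝ => ‖highPart f z.1 z.2‖ₑ ^ 2) =
              Set.indicator {z : ℝ × ℝ | z.1 < ‖f z.2‖} (fun z => ‖f z.2‖ₑ ^ 2) := by
            ext z
            by_cases h : z.1 < ‖f z.2‖
            · simp [highPart, Set.indicator, h]
            · simp [highPart, Set.indicator, h]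
          rw [this]
          refine Measurable.indicator (by fun_prop) ?_
          exact measurableSet_lt (by fun_prop) (by fun_prop)
        rw [lintegral_const_mul _ hm.lintegral_prod_right', lintegral_highPart_sq hf, mul_assoc]

/-- A quadratically decaying quantity sampled on a grid has bounded sum. -/
theorem exists_grid_sum_le : ∃ C₀ : ℝ, 0 < C₀ ∧ ∀ (r x D : ℝ) (S : Finset ℤ) (pt t : ℤ → ℝ),
    0 < r → 0 ≤ D → (∀ m ∈ S, m * r ≤ pt m ∧ pt m ≤ (m + 1) * r) → (∀ m ∈ S, t m ≤ 1) →
    (∀ m ∈ S, t m * ((x - pt m) / r) ^ 2 ≤ D) → ∑ m ∈ S, t m ≤ C₀ * (1 + D) := by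
  have hs : Summable fun m : ℤ => (1 : ℝ) / (1 + (m : ℝ) ^ 2) := by
    refine Summable.of_norm_bounded_eventually (g := fun m : ℤ => 1 / (m : ℝ) ^ 2)
      (Real.summable_one_div_int_pow.2 (by norm_num)) ?_
    rw [Filter.eventually_cofinite]
    refine (Set.finite_singleton (0 : ℤ)).subset fun m hm => ?_
    by_contra h0
    have h0' : (m : ℝ) ≠ 0 := by exact_mod_cast h0
    apply hm
    rw [Real.norm_eq_abs, abs_of_pos (by positivity)]
    have : 0 < (m : ℝ) ^ 2 := by positivity
    exact one_div_le_one_div_of_le this (by linarith)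
  refine ⟨8 * ((∑' m : ℤ, (1 : ℝ) / (1 + (m : ℝ) ^ 2)) + 1), ?_, ?_⟩
  · have : 0 ≤ ∑' m : ℤ, (1 : ℝ) / (1 + (m : ℝ) ^ 2) := tsum_nonneg fun m => by positivity
    positivity
  intro r x D S pt t hr hD hpt ht1 ht2
  set m0 : ℤ := ⌊x / r⌋ with hm0
  have hx1 : m0 * r ≤ x := (le_div_iff₀ hr).1 (Int.floor_le _)
  have hx2 : x < (m0 + 1) * r := (div_lt_iff₀ hr).1 (Int.lt_floor_add_one _)
  -- With j the index distance from the cell of x, indices |j| ≤ 1 use only t ≤ 1. For |j| ≥ 2 the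
  -- true distance is at least (|j| - 1)r ≥ |j|r/2, so the decay hypothesis applies.
  have hb : ∀ m ∈ S, t m ≤ 8 * (1 + D) * (1 / (1 + ((m - m0 : ℤ) : ℝ) ^ 2)) := by
    intro m hm
    obtain ⟨p1, p2⟩ := hpt m hm
    have q1 := ht1 m hm
    have q2 := ht2 m hm
    rw [mul_one_div, le_div_iff₀ (by positivity)]
    push_cast
    set j : ℝ := (m : ℝ) - m0 with hj
    rcases le_or_gt (t m) 0 with h0 | h0
    · have : t m * (1 + j ^ 2) ≤ 0 := mul_nonpos_of_nonpos_of_nonneg h0 (by positivity)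
      linarith
    by_cases hj1 : |j| ≤ 1
    · have : j ^ 2 ≤ 1 := by rw [← sq_abs]; nlinarith [abs_nonneg j]
      nlinarith
    · have hj2 : 2 ≤ |j| := by
        have hji : j = ((m - m0 : ℤ) : ℝ) := by push_cast; rfl
        rw [hji, ← Int.cast_abs] at hj1 ⊢
        have : 1 < |m - m0| := by
          by_contra h; push Not at h; exact hj1 (by exact_mod_cast h)
        exact_mod_cast this
      have hd : |j| - 1 ≤ |(x - pt m) / r| := by
        rw [abs_div, abs_of_pos hr, le_div_iff₀ hr]
        rcases le_total 0 j with hjj | hjj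
        · rw [abs_of_nonneg hjj]
          refine le_trans ?_ (neg_le_abs _)
          simp only [hj]; nlinarith
        · rw [abs_of_nonpos hjj]
          refine le_trans ?_ (le_abs_self _)
          simp only [hj]; nlinarith
      have hd2 : j ^ 2 / 4 ≤ ((x - pt m) / r) ^ 2 := by
        rw [← sq_abs ((x - pt m) / r), ← sq_abs j]
        nlinarith
      have : t m * (j ^ 2 / 4) ≤ D := (mul_le_mul_of_nonneg_left hd2 h0.le).trans q2
      linarith
  calc ∑ m ∈ S, t m ≤ ∑ m ∈ S, 8 * (1 + D) * (1 / (1 + ((m - m0 : ℤ) : ℝ) ^ 2)) :=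
        Finset.sum_le_sum hb
    _ = 8 * (1 + D) * ∑ m ∈ S, (1 / (1 + ((m - m0 : ℤ) : ℝ) ^ 2)) := by rw [Finset.mul_sum]
    _ ≤ 8 * (1 + D) * ∑' m : ℤ, (1 : ℝ) / (1 + (m : ℝ) ^ 2) := by
        gcongr
        have h1 : ∑ m ∈ S, (1 : ℝ) / (1 + ((m - m0 : ℤ) : ℝ) ^ 2) =
            ∑ m ∈ S.map (Equiv.subRight m0).toEmbedding, (1 : ℝ) / (1 + (m : ℝ) ^ 2) := by
          rw [Finset.sum_map]; rfl
        rw [h1]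
        exact hs.sum_le_tsum _ fun m _ => by positivity
    _ ≤ _ := by nlinarith

theorem card_grid_near_le {r x R : ℝ} (hr : 0 < r) (hR : 0 ≤ R) (S : Finset ℤ) (pt : ℤ → ℝ)
    (hpt : ∀ m ∈ S, m * r ≤ pt m ∧ pt m ≤ (m + 1) * r) (hnear : ∀ m ∈ S, |x - pt m| ≤ R) :
    (S.card : ℝ) ≤ 2 * (R / r) + 3 := by
  have hsub : S ⊆ Finset.Icc (⌈(x - R) / r - 1⌉) (⌊(x + R) / r⌋) := by
    intro m hm
    obtain ⟨p1, p2⟩ := hpt m hm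
    obtain ⟨q1, q2⟩ := abs_le.1 (hnear m hm)
    rw [Finset.mem_Icc]
    constructor
    · rw [Int.ceil_le, sub_le_iff_le_add, div_le_iff₀ hr]; linarith
    · rw [Int.le_floor, le_div_iff₀ hr]; linarith
  have h1 := Finset.card_le_card hsub
  rw [Int.card_Icc] at h1
  have h2 : (S.card : ℝ) ≤ ((⌊(x + R) / r⌋ + 1 - ⌈(x - R) / r - 1⌉).toNat : ℝ) := by exact_mod_cast h1
  refine h2.trans ?_
  have h3 : ((⌊(x + R) / r⌋ + 1 - ⌈(x - R) / r - 1⌉).toNat : ℝ) ≤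
      max ((⌊(x + R) / r⌋ + 1 - ⌈(x - R) / r - 1⌉ : ℤ) : ℝ) 0 := by
    rw [← Int.cast_natCast, Int.toNat_eq_max]; push_cast; rfl
  refine h3.trans (max_le ?_ (by positivity))
  push_cast
  have f1 := Int.floor_le ((x + R) / r)
  have f2 := Int.le_ceil ((x - R) / r - 1)
  have : (x + R) / r - (x - R) / r = 2 * (R / r) := by ring
  linarith

/-- The exponent is |k - l| written in ℕ; the two one-sided geometric series contribute at most 4/3
each. -/
theorem sum_quarter_pow_dist_le (n k : ℕ) :
    ∑ l ∈ Finset.range n, (1 / 4 : ℝ) ^ (max k l - min k l) ≤ 3 := by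
  have hg : ∀ N : ℕ, ∑ l ∈ Finset.range N, (1 / 4 : ℝ) ^ l ≤ 4 / 3 := fun N => by
    have := (summable_geometric_of_lt_one (by norm_num : (0 : ℝ) ≤ 1 / 4) (by norm_num)).sum_le_tsum
      (Finset.range N) (fun l _ => by positivity)
    rw [tsum_geometric_of_lt_one (by norm_num) (by norm_num)] at this
    linarith
  have h1 : ∑ l ∈ Finset.range n, (1 / 4 : ℝ) ^ (max k l - min k l) ≤
      ∑ l ∈ Finset.range (k + 1 + n), (1 / 4 : ℝ) ^ (max k l - min k l) :=
    Finset.sum_le_sum_of_subset_of_nonneg (Finset.range_mono (by omega)) fun _ _ _ => by positivity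
  refine h1.trans ?_
  rw [Finset.sum_range_add]
  have h2 : ∑ l ∈ Finset.range (k + 1), (1 / 4 : ℝ) ^ (max k l - min k l) ≤ 4 / 3 := by
    rw [← Finset.sum_range_reflect]
    refine le_trans (le_of_eq (Finset.sum_congr rfl fun l hl => ?_)) (hg (k + 1))
    have := Finset.mem_range.1 hl
    congr 1; omega
  have h3 : ∑ l ∈ Finset.range n, (1 / 4 : ℝ) ^ (max k (k + 1 + l) - min k (k + 1 + l)) ≤ 4 / 3 := by
    refine le_trans (Finset.sum_le_sum fun l hl => ?_) (hg n)
    exact pow_le_pow_of_le_one (by norm_num) (by norm_num) (by omega)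
  linarith

/-- Every triple of indices has a least member; assigning it to each of the three positions costs
the factor 3. This singles out the finest scale in the trilinear estimate. -/
theorem sum_pow_three_le (n : ℕ) (F : ℕ → ℝ≥0∞) :
    (∑ k ∈ Finset.range n, F k) ^ 3 ≤ 3 * ∑ a ∈ Finset.range n,
      (∑ b ∈ Finset.range n with a ≤ b, F b) * (∑ c ∈ Finset.range n with a ≤ c, F c) * F a := by
  set R := Finset.range n
  set W : ℕ → ℕ → ℕ → ℝ≥0∞ := fun a b c => if a ≤ b ∧ a ≤ c then F a * F b * F c else 0 with hW
  have e : ∑ a ∈ R, (∑ b ∈ R with a ≤ b, F b) * (∑ c ∈ R with a ≤ c, F c) * F a =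
      ∑ a ∈ R, ∑ b ∈ R, ∑ c ∈ R, W a b c := by
    refine Finset.sum_congr rfl fun a _ => ?_
    rw [Finset.sum_filter, Finset.sum_mul_sum, Finset.sum_mul]
    refine Finset.sum_congr rfl fun b _ => ?_
    rw [Finset.sum_mul]
    refine Finset.sum_congr rfl fun c _ => ?_
    simp only [hW]
    by_cases h1 : a ≤ b <;> by_cases h2 : a ≤ c <;> simp [h1, h2]
    ring
  have e2 : ∑ a ∈ R, ∑ b ∈ R, ∑ c ∈ R, W b a c = ∑ a ∈ R, ∑ b ∈ R, ∑ c ∈ R, W a b c :=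
    Finset.sum_comm
  have e3 : ∑ a ∈ R, ∑ b ∈ R, ∑ c ∈ R, W c a b = ∑ a ∈ R, ∑ b ∈ R, ∑ c ∈ R, W a b c := by
    rw [← e2, Finset.sum_congr rfl fun a _ => Finset.sum_comm]
  have e4 : (∑ k ∈ R, F k) ^ 3 = ∑ a ∈ R, ∑ b ∈ R, ∑ c ∈ R, F a * F b * F c := by
    rw [pow_succ, sq, Finset.sum_mul_sum, Finset.sum_mul]
    refine Finset.sum_congr rfl fun a _ => ?_
    rw [Finset.sum_mul]
    refine Finset.sum_congr rfl fun b _ => ?_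
    rw [Finset.mul_sum]
  have h : ∑ a ∈ R, ∑ b ∈ R, ∑ c ∈ R, F a * F b * F c ≤
      ∑ a ∈ R, ∑ b ∈ R, ∑ c ∈ R, (W a b c + W b a c + W c a b) := by
    refine Finset.sum_le_sum fun a _ => Finset.sum_le_sum fun b _ => Finset.sum_le_sum fun c _ => ?_
    have c1 : W b a c = if b ≤ a ∧ b ≤ c then F a * F b * F c else 0 := by
      simp only [hW]; congr 1; ring
    have c2 : W c a b = if c ≤ a ∧ c ≤ b then F a * F b * F c else 0 := by
      simp only [hW]; congr 1; ring
    rw [c1, c2]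
    by_cases h1 : a ≤ b ∧ a ≤ c
    · simp only [hW, h1, and_self, if_true]
      rw [add_assoc]; exact le_self_add
    · by_cases h2 : b ≤ a ∧ b ≤ c
      · simp only [h2, and_self, if_true]
        rw [add_right_comm]; exact le_add_self
      · have h3 : c ≤ a ∧ c ≤ b := by omega
        simp only [h3, and_self, if_true]
        exact le_add_self
  simp only [Finset.sum_add_distrib] at h
  rw [e2, e3] at h
  rw [e4, e]
  refine h.trans (le_of_eq ?_)
  ring

end Interpolation

/-! ### Two-sided folds and the Gram kernel of the dyadic pieces. -/

section FoldPhase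

theorem partialX_eq_fderiv {f : ℝ × ℝ → ℝ} (hf : ContDiff ℝ ∞ f) (p : ℝ × ℝ) :
    HasDerivAt (fun x => f (x, p.2)) (fderiv ℝ f p (1, 0)) p.1 := by
  have h1 : HasFDerivAt f (fderiv ℝ f p) (p.1, p.2) :=
    (hf.differentiable (by simp) p).hasFDerivAt
  have h2 : HasDerivAt (fun x : ℝ => (x, p.2)) ((1 : ℝ), (0 : ℝ)) p.1 :=
    (hasDerivAt_id p.1).prodMk (hasDerivAt_const _ _)
  exact h1.comp_hasDerivAt p.1 h2

theorem partialY_eq_fderiv {f : ℝ × ℝ → ℝ} (hf : ContDiff ℝ ∞ f) (p : ℝ × ℝ) :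
    HasDerivAt (fun y => f (p.1, y)) (fderiv ℝ f p (0, 1)) p.2 := by
  have h1 : HasFDerivAt f (fderiv ℝ f p) (p.1, p.2) :=
    (hf.differentiable (by simp) p).hasFDerivAt
  have h2 : HasDerivAt (fun y : ℝ => (p.1, y)) ((0 : ℝ), (1 : ℝ)) p.2 :=
    (hasDerivAt_const _ _).prodMk (hasDerivAt_id p.2)
  exact h1.comp_hasDerivAt p.2 h2

theorem partialX_smooth_eq {f : ℝ × ℝ → ℝ} (hf : ContDiff ℝ ∞ f) :
    partialX f = fun p => fderiv ℝ f p (1, 0) := by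
  ext p; exact (partialX_eq_fderiv hf p).deriv

theorem partialY_smooth_eq {f : ℝ × ℝ → ℝ} (hf : ContDiff ℝ ∞ f) :
    partialY f = fun p => fderiv ℝ f p (0, 1) := by
  ext p; exact (partialY_eq_fderiv hf p).deriv

theorem contDiff_partialX {f : ℝ × ℝ → ℝ} (hf : ContDiff ℝ ∞ f) : ContDiff ℝ ∞ (partialX f) := by
  rw [partialX_smooth_eq hf]
  exact (hf.fderiv_right (m := ∞) (by simp)).clm_apply contDiff_const

theorem contDiff_partialY {f : ℝ × ℝ → ℝ} (hf : ContDiff ℝ ∞ f) : ContDiff ℝ ∞ (partialY f) := by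
  rw [partialY_smooth_eq hf]
  exact (hf.fderiv_right (m := ∞) (by simp)).clm_apply contDiff_const

theorem hasDerivAt_partialX {f : ℝ × ℝ → ℝ} (hf : ContDiff ℝ ∞ f) (x y : ℝ) :
    HasDerivAt (fun x => f (x, y)) (partialX f (x, y)) x := by
  have := partialX_eq_fderiv hf (x, y)
  rw [partialX_smooth_eq hf]; exact this

theorem hasDerivAt_partialY {f : ℝ × ℝ → ℝ} (hf : ContDiff ℝ ∞ f) (x y : ℝ) :
    HasDerivAt (fun y => f (x, y)) (partialY f (x, y)) y := by
  have := partialY_eq_fderiv hf (x, y)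
  rw [partialY_smooth_eq hf]; exact this

/-- Symmetry of second derivatives. It identifies ∂_x of `mixed φ` with φ_{xxy}, and makes `mixed φ`
the x-derivative of φ_y. -/
theorem partialX_partialY_comm {f : ℝ × ℝ → ℝ} (hf : ContDiff ℝ ∞ f) :
    partialX (partialY f) = partialY (partialX f) := by
  have hd : ContDiff ℝ ∞ (fderiv ℝ f) := hf.fderiv_right (m := ∞) (by simp)
  have hdd : ∀ p, HasFDerivAt (fderiv ℝ f) (fderiv ℝ (fderiv ℝ f) p) p := fun p =>
    (hd.differentiable (by simp) p).hasFDerivAt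
  have key : ∀ (p v w : ℝ × ℝ), fderiv ℝ (fun q => fderiv ℝ f q v) p w =
      fderiv ℝ (fderiv ℝ f) p w v := fun p v w => by
    have h := ((hdd p).clm_apply (hasFDerivAt_const v p)).fderiv
    rw [h]; simp
  rw [partialX_smooth_eq (contDiff_partialY hf), partialY_smooth_eq (contDiff_partialX hf)]
  ext p
  rw [partialY_smooth_eq hf, partialX_smooth_eq hf, key, key]
  have hs : IsSymmSndFDerivAt ℝ f p :=
    hf.contDiffAt.isSymmSndFDerivAt (by
      simp only [minSmoothness_of_isRCLikeNormedField]
      exact WithTop.coe_le_coe.2 (le_top : (2 : ℕ∞) ≤ ⊤))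
  exact hs.eq _ _

/-- The mixed second derivative `φ_{xy}`. -/
noncomputable def mixed (φ : ℝ × ℝ → ℝ) : ℝ × ℝ → ℝ := partialY (partialX φ)

/-- Quantitative two-sided fold condition for the phase `φ` on `X × Y`: `φ_{xy}` is bi-Lipschitz
in each variable separately. -/
structure FoldPhase (φ : ℝ × ℝ → ℝ) (X Y : Set ℝ) (c C : ℝ) : Prop where
  smooth : ContDiff ℝ ∞ φ
  compactX : IsCompact X
  compactY : IsCompact Y
  c_pos : 0 < c
  c_le_one : c ≤ 1
  one_le_C : 1 ≤ C
  sep_x : ∀ x ∈ X, ∀ x' ∈ X, ∀ y ∈ Y, c * |x - x'| ≤ |mixed φ (x, y) - mixed φ (x', y)|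
  lip_x : ∀ x ∈ X, ∀ x' ∈ X, ∀ y ∈ Y, |mixed φ (x, y) - mixed φ (x', y)| ≤ C * |x - x'|
  sep_y : ∀ x ∈ X, ∀ y ∈ Y, ∀ y' ∈ Y, c * |y - y'| ≤ |mixed φ (x, y) - mixed φ (x, y')|
  phase_lower : ∀ x ∈ X, ∀ x' ∈ X, ∀ y ∈ Y, 0 < mixed φ (x, y) * mixed φ (x', y) →
    c * (|mixed φ (x, y)| + |mixed φ (x', y)|) * |x - x'| ≤
      |partialY φ (x, y) - partialY φ (x', y)|
  lip_yy : ∀ x ∈ X, ∀ x' ∈ X, ∀ y ∈ Y,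
    |partialY (partialY φ) (x, y) - partialY (partialY φ) (x', y)| ≤ C * |x - x'|
  lip_yyy : ∀ x ∈ X, ∀ x' ∈ X, ∀ y ∈ Y, |partialY (partialY (partialY φ)) (x, y) -
    partialY (partialY (partialY φ)) (x', y)| ≤ C * |x - x'|
  bdd : ∀ x ∈ X, ∀ y ∈ Y, |mixed φ (x, y)| ≤ C

/-- An amplitude localized to `ε φ_{xy} ∈ [s, 4 s]`, varying at scale `s` in `y`. -/
structure ScaleAmplitude (φ : ℝ × ℝ → ℝ) (X Y : Set ℝ) (A s ε : ℝ) (b : ℝ × ℝ → ℂ) : Prop where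
  cont : Continuous b
  smooth : ∀ x, ContDiff ℝ 2 (fun y => b (x, y))
  supp : ∀ x y, b (x, y) ≠ 0 → x ∈ X ∧ y ∈ Y ∧ s ≤ ε * mixed φ (x, y) ∧ ε * mixed φ (x, y) ≤ 4 * s
  bd0 : ∀ x y, ‖b (x, y)‖ ≤ A
  bd1 : ∀ x y, ‖deriv (fun y => b (x, y)) y‖ ≤ A / s
  bd2 : ∀ x y, ‖deriv (deriv (fun y => b (x, y))) y‖ ≤ A / s ^ 2

/-- The integral kernel of `oscOp`. -/
noncomputable def oscKernel (φ : ℝ × ℝ → ℝ) (b : ℝ × ℝ → ℂ) (lam x y : ℝ) : ℂ :=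
  Complex.exp (Complex.I * (lam : ℂ) * (φ (x, y) : ℂ)) * b (x, y)

theorem oscOp_eq (φ : ℝ × ℝ → ℝ) (b : ℝ × ℝ → ℂ) (lam : ℝ) (f : ℝ → ℂ) (x : ℝ) :
    oscOp φ b lam f x = ∫ y, oscKernel φ b lam x y * f y := rfl

theorem norm_oscKernel (φ : ℝ × ℝ → ℝ) (b : ℝ × ℝ → ℂ) (lam x y : ℝ) :
    ‖oscKernel φ b lam x y‖ = ‖b (x, y)‖ := by
  have he : ‖Complex.exp (Complex.I * lam * φ (x, y))‖ = 1 := by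
    rw [mul_assoc, mul_comm, ← Complex.ofReal_mul, Complex.norm_exp_ofReal_mul_I]
  rw [oscKernel, norm_mul, he, one_mul]

variable {φ : ℝ × ℝ → ℝ} {X Y : Set ℝ} {c C A s s' ε lam : ℝ} {b b' : ℝ × ℝ → ℂ}

theorem abs_mixed_of_sign (hε : ε = 1 ∨ ε = -1) {u : ℝ} (h : 0 ≤ ε * u) : |u| = ε * u := by
  rcases hε with rfl | rfl
  · rw [one_mul] at h ⊢; exact abs_of_nonneg h
  · rw [abs_of_nonpos (by linarith)]; ring

theorem abs_sub_sign (hε : ε = 1 ∨ ε = -1) (u v : ℝ) : |ε * u - ε * v| = |u - v| := by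
  rcases hε with rfl | rfl
  · simp
  · rw [← abs_neg]; congr 1; ring

theorem continuous_mixed (h : FoldPhase φ X Y c C) : Continuous (mixed φ) :=
  (contDiff_partialY (contDiff_partialX h.smooth)).continuous

theorem ScaleAmplitude.slice_tsupport (hφ : FoldPhase φ X Y c C)
    (hb : ScaleAmplitude φ X Y A s ε b) (x y : ℝ) (hy : y ∈ tsupport fun y => b (x, y)) :
    x ∈ X ∧ y ∈ Y ∧ s ≤ ε * mixed φ (x, y) ∧ ε * mixed φ (x, y) ≤ 4 * s := by
  have hc : Continuous fun y => mixed φ (x, y) :=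
    (continuous_mixed hφ).comp (by fun_prop)
  have hcl : IsClosed {y | x ∈ X ∧ y ∈ Y ∧ s ≤ ε * mixed φ (x, y) ∧ ε * mixed φ (x, y) ≤ 4 * s} := by
    refine isClosed_const.inter (hφ.compactY.isClosed.inter ?_)
    have hc' : Continuous fun y => ε * mixed φ (x, y) := continuous_const.mul hc
    exact (isClosed_le continuous_const hc').inter (isClosed_le hc' continuous_const)
  exact closure_minimal (fun z hz => hb.supp x z hz) hcl hy

/-- On a slice ε φ_{xy} ranges over [s, 4s], an interval of length 3s, and `sep_y` converts this
into a distance in y. -/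
theorem ScaleAmplitude.slice_length (hφ : FoldPhase φ X Y c C) (hε : ε = 1 ∨ ε = -1)
    (hb : ScaleAmplitude φ X Y A s ε b) {x y z : ℝ} (hy : b (x, y) ≠ 0) (hz : b (x, z) ≠ 0) :
    |y - z| ≤ 3 * s / c := by
  obtain ⟨hx, hyY, y1, y2⟩ := hb.supp x y hy
  obtain ⟨-, hzY, z1, z2⟩ := hb.supp x z hz
  have h1 := hφ.sep_y x hx y hyY z hzY
  rw [← abs_sub_sign hε (mixed φ (x, y))] at h1
  rw [le_div_iff₀ hφ.c_pos]
  have : |ε * mixed φ (x, y) - ε * mixed φ (x, z)| ≤ 3 * s := by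
    rw [abs_le]; constructor <;> linarith
  linarith

theorem ScaleAmplitude.hasCompactSupport (hφ : FoldPhase φ X Y c C)
    (hb : ScaleAmplitude φ X Y A s ε b) (x : ℝ) : HasCompactSupport fun y => b (x, y) :=
  HasCompactSupport.of_support_subset_isCompact hφ.compactY fun y hy => (hb.supp x y hy).2.1

theorem oscKernel_mul_conj (φ : ℝ × ℝ → ℝ) (b b' : ℝ × ℝ → ℂ) (lam x x' y : ℝ) :
    oscKernel φ b lam x y * (starRingEnd ℂ) (oscKernel φ b' lam x' y) =
      Complex.exp (Complex.I * lam * ((φ (x, y) - φ (x', y) : ℝ) : ℂ)) *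
        (b (x, y) * (starRingEnd ℂ) (b' (x', y))) := by
  rw [oscKernel, oscKernel, map_mul, ← Complex.exp_conj]
  simp only [map_mul, Complex.conj_I, Complex.conj_ofReal]
  have : Complex.exp (Complex.I * lam * ((φ (x, y) - φ (x', y) : ℝ) : ℂ)) =
      Complex.exp (Complex.I * lam * φ (x, y)) * Complex.exp (-Complex.I * lam * φ (x', y)) := by
    rw [← Complex.exp_add]; congr 1; push_cast; ring
  rw [this]; ring

/-- No oscillation is used: the integrand is at most A² on an interval of length 6s/c fixed by the
first amplitude. -/
theorem norm_gram_le_size (hφ : FoldPhase φ X Y c C) (hε : ε = 1 ∨ ε = -1)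
    (hs : 0 < s) (hA : 0 ≤ A) (hb : ScaleAmplitude φ X Y A s ε b)
    (hb' : ScaleAmplitude φ X Y A s' ε b') (x x' : ℝ) :
    ‖∫ y, oscKernel φ b lam x y * (starRingEnd ℂ) (oscKernel φ b' lam x' y)‖ ≤ 6 / c * A ^ 2 * s := by
  have hc := hφ.c_pos
  by_cases hne : ∃ y0, b (x, y0) ≠ 0
  swap
  · push Not at hne
    simp [oscKernel, hne]; positivity
  obtain ⟨y0, hy0⟩ := hne
  rw [← setIntegral_eq_integral_of_forall_compl_eq_zero
    (s := Set.Icc (y0 - 3 * s / c) (y0 + 3 * s / c))]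
  · have := norm_setIntegral_le_of_norm_le_const (μ := volume)
      (s := Set.Icc (y0 - 3 * s / c) (y0 + 3 * s / c))
      (f := fun y => oscKernel φ b lam x y * (starRingEnd ℂ) (oscKernel φ b' lam x' y))
      (C := A ^ 2) (by simp) (fun y _ => by
        rw [norm_mul, RCLike.norm_conj, norm_oscKernel, norm_oscKernel, sq]
        exact mul_le_mul (hb.bd0 _ _) (hb'.bd0 _ _) (norm_nonneg _) hA)
    refine this.trans (le_of_eq ?_)
    simp only [measureReal_def, Real.volume_Icc]
    rw [ENNReal.toReal_ofReal (by ring_nf; positivity)]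
    field_simp; ring
  · intro y hy
    have : b (x, y) = 0 := by
      by_contra h
      have := abs_le.1 (hb.slice_length hφ hε h hy0)
      exact hy ⟨by linarith, by linarith⟩
    simp [oscKernel, this]

/-- A nonzero entry forces a common y at which φ_{xy} has size about s at x and s' at x';
bi-Lipschitz dependence on x then bounds |x - x'| from above by a multiple of s'. The lower bound
has content when s' > 4s, so entries between well separated scales live only where |x - x'| ~ s'. -/
theorem gram_support (hφ : FoldPhase φ X Y c C) (hε : ε = 1 ∨ ε = -1) (hs : 0 < s) (hss : s ≤ s')
    (hb : ScaleAmplitude φ X Y A s ε b)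
    (hb' : ScaleAmplitude φ X Y A s' ε b') (x x' : ℝ)
    (hne : ∫ y, oscKernel φ b lam x y * (starRingEnd ℂ) (oscKernel φ b' lam x' y) ≠ 0) :
    |x - x'| ≤ 4 / c * s' ∧ s' - 4 * s ≤ C * |x - x'| := by
  obtain ⟨y, hy⟩ : ∃ y, b (x, y) ≠ 0 ∧ b' (x', y) ≠ 0 := by
    by_contra h
    push Not at h
    apply hne
    refine integral_eq_zero_of_ae (Filter.Eventually.of_forall fun y => ?_)
    by_cases h1 : b (x, y) = 0
    · simp [oscKernel, h1]
    · simp [oscKernel, h y h1]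
  obtain ⟨hx, hyY, y1, y2⟩ := hb.supp x y hy.1
  obtain ⟨hx', -, z1, z2⟩ := hb'.supp x' y hy.2
  have h1 := hφ.sep_x x hx x' hx' y hyY
  have h2 := hφ.lip_x x hx x' hx' y hyY
  rw [← abs_sub_sign hε (mixed φ (x, y))] at h1 h2
  have hc := hφ.c_pos
  constructor
  · have : |ε * mixed φ (x, y) - ε * mixed φ (x', y)| ≤ 4 * s' := by
      rw [abs_le]; constructor <;> linarith
    rw [div_mul_eq_mul_div, le_div_iff₀ hc]; linarith
  · have := neg_abs_le (ε * mixed φ (x, y) - ε * mixed φ (x', y))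
    linarith

/-- By `phase_lower` the y-derivative of φ(x,y) - φ(x',y) is at least c s'|x - x'|, governed by the
larger scale, while the amplitude varies at the smaller scale s. Each of two integrations by parts
therefore gains 1/(λ s s'|x - x'|) over the trivial bound of order s. -/
theorem norm_gram_le_decay (hφ : FoldPhase φ X Y c C) (hε : ε = 1 ∨ ε = -1) (hlam : 0 < lam)
    (hs : 0 < s) (hss : s ≤ s') (hA : 0 ≤ A) (hb : ScaleAmplitude φ X Y A s ε b)
    (hb' : ScaleAmplitude φ X Y A s' ε b') (x x' : ℝ) :
    ‖∫ y, oscKernel φ b lam x y * (starRingEnd ℂ) (oscKernel φ b' lam x' y)‖ *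
      (lam * s * s' * |x - x'|) ^ 2 ≤ 192 * C ^ 2 / c ^ 5 * A ^ 2 * s := by
  have hc := hφ.c_pos
  have hC := hφ.one_le_C
  have hs' : 0 < s' := hs.trans_le hss
  have hc1 := hφ.c_le_one
  rcases eq_or_ne x x' with rfl | hxx
  · simp; positivity
  have hh : 0 < |x - x'| := abs_pos.2 (sub_ne_zero.2 hxx)
  by_cases hne : ∃ y0, b (x, y0) ≠ 0
  swap
  · push Not at hne
    simp [oscKernel, hne]; positivity
  obtain ⟨y0, hy0⟩ := hne
  -- A nonempty slice forces s ≤ C, which makes κ ≥ 1 below and lets κ² control the third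
  -- y-derivative of the phase.
  have hsC : s ≤ C := by
    obtain ⟨hx, hyY, y1, y2⟩ := hb.supp x y0 hy0
    have h1 := hφ.bdd x hx y0 hyY
    rw [abs_mixed_of_sign hε (hs.le.trans y1)] at h1
    linarith
  set a : ℝ → ℂ := fun y => b (x, y) * (starRingEnd ℂ) (b' (x', y)) with ha
  have hconj : ContDiff ℝ 2 fun y => (starRingEnd ℂ) (b' (x', y)) :=
    Complex.conjCLE.contDiff.comp (hb'.smooth x')
  have haS : ContDiff ℝ 2 a := (hb.smooth x).mul hconj
  have hcs : HasCompactSupport a := (hb.hasCompactSupport hφ x).mul_right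
  have hcd1 : ∀ {g : ℝ → ℂ}, ContDiff ℝ 2 g → ContDiff ℝ 1 (deriv g) := fun {g} hg =>
    (contDiff_succ_iff_deriv.1 (by rw [one_add_one_eq_two]; exact hg)).2.2
  have hd : ∀ {g : ℝ → ℂ}, ContDiff ℝ 2 g → ∀ y, HasDerivAt g (deriv g y) y := fun {g} hg y =>
    (hg.differentiable (by norm_num) y).hasDerivAt
  have hdd : ∀ {g : ℝ → ℂ}, ContDiff ℝ 2 g → ∀ y, HasDerivAt (deriv g) (deriv (deriv g) y) y :=
    fun {g} hg y => ((hcd1 hg).differentiable (by norm_num) y).hasDerivAt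
  set B : ℝ → ℂ := fun y => b (x, y)
  set B' : ℝ → ℂ := fun y => b' (x', y)
  have d1 : ∀ y, HasDerivAt a (deriv B y * star (B' y) + B y * star (deriv B' y)) y := fun y =>
    (hd (hb.smooth x) y).mul (hd (hb'.smooth x') y).star
  have e1 : deriv a = fun y => deriv B y * star (B' y) + B y * star (deriv B' y) :=
    funext fun y => (d1 y).deriv
  have d2 : ∀ y, HasDerivAt (deriv a) (deriv (deriv B) y * star (B' y) +
      deriv B y * star (deriv B' y) + (deriv B y * star (deriv B' y) +
      B y * star (deriv (deriv B') y))) y := fun y => by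
    rw [e1]
    exact ((hdd (hb.smooth x) y).mul (hd (hb'.smooth x') y).star).add
      ((hd (hb.smooth x) y).mul (hdd (hb'.smooth x') y).star)
  have b0 : ∀ y, ‖B y‖ ≤ A := hb.bd0 x
  have b0' : ∀ y, ‖B' y‖ ≤ A := hb'.bd0 x'
  have b1 : ∀ y, ‖deriv B y‖ ≤ A / s := hb.bd1 x
  have b1' : ∀ y, ‖deriv B' y‖ ≤ A / s := fun y => (hb'.bd1 x' y).trans (by gcongr)
  have b2 : ∀ y, ‖deriv (deriv B) y‖ ≤ A / s ^ 2 := hb.bd2 x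
  have b2' : ∀ y, ‖deriv (deriv B') y‖ ≤ A / s ^ 2 := fun y => (hb'.bd2 x' y).trans (by gcongr)
  have mulb : ∀ {z w : ℂ} {p q : ℝ}, ‖z‖ ≤ p → ‖w‖ ≤ q → ‖z * star w‖ ≤ p * q := by
    intro z w p q h1 h2
    rw [norm_mul, norm_star]
    exact mul_le_mul h1 h2 (norm_nonneg _) ((norm_nonneg _).trans h1)
  -- Chosen to dominate both the amplitude product, whose two derivatives cost at most 2/s and 4/s²,
  -- and the ratio C/(c s') of phase derivatives.
  set κ : ℝ := 2 * C / (c * s) with hκ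
  have hκ0 : 0 ≤ κ := by positivity
  have hκs : 2 / s ≤ κ := by
    rw [hκ, div_le_div_iff₀ hs (by positivity)]
    nlinarith
  have hκ2 : 4 / s ^ 2 ≤ κ ^ 2 := by
    have : (2 / s) ^ 2 ≤ κ ^ 2 := by gcongr
    calc 4 / s ^ 2 = (2 / s) ^ 2 := by ring
      _ ≤ _ := this
  have sm1 := contDiff_partialY hφ.smooth
  have sm2 := contDiff_partialY sm1
  have sm3 := contDiff_partialY sm2
  have hts : ∀ y ∈ tsupport a, (x ∈ X ∧ y ∈ Y ∧ s ≤ ε * mixed φ (x, y) ∧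
      ε * mixed φ (x, y) ≤ 4 * s) ∧ (x' ∈ X ∧ y ∈ Y ∧ s' ≤ ε * mixed φ (x', y) ∧
      ε * mixed φ (x', y) ≤ 4 * s') := fun y hy =>
    ⟨hb.slice_tsupport hφ x y (tsupport_mul_subset_left hy),
      hb'.slice_tsupport hφ x' y (by
        refine closure_mono (fun z hz => ?_) hy
        intro h0
        apply hz
        simp only [ha]
        simp [show b' (x', z) = 0 from h0])⟩
  have hlow : ∀ y ∈ tsupport a, c * s' * |x - x'| ≤ |partialY φ (x, y) - partialY φ (x', y)| := by
    intro y hy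
    obtain ⟨⟨hx, hyY, y1, y2⟩, hx', -, z1, z2⟩ := hts y hy
    have hpos : 0 < mixed φ (x, y) * mixed φ (x', y) := by
      have : 0 < (ε * mixed φ (x, y)) * (ε * mixed φ (x', y)) :=
        mul_pos (hs.trans_le y1) (hs'.trans_le z1)
      rcases hε with rfl | rfl <;> linarith
    refine le_trans ?_ (hφ.phase_lower x hx x' hx' y hyY hpos)
    rw [abs_mixed_of_sign hε (hs'.le.trans z1)]
    have := abs_nonneg (mixed φ (x, y))
    gcongr
    linarith
  have hCκ : C * |x - x'| ≤ κ * (c * s' * |x - x'|) := by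
    have : C ≤ κ * (c * s') := by
      rw [hκ]
      calc C ≤ 2 * C * 1 := by linarith
        _ ≤ 2 * C * (s' / s) := by gcongr; rw [le_div_iff₀ hs]; linarith
        _ = _ := by field_simp
    calc C * |x - x'| ≤ κ * (c * s') * |x - x'| := by gcongr
      _ = _ := by ring
  have hCκ2 : C * |x - x'| ≤ κ ^ 2 * (c * s' * |x - x'|) := by
    have : C ≤ κ ^ 2 * (c * s') := by
      have h1 : 1 ≤ κ := by
        rw [hκ, le_div_iff₀ (by positivity)]; nlinarith
      have h2 : C ≤ κ * (c * s') := by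
        have := le_of_mul_le_mul_right (hCκ.trans (le_of_eq (by ring :
          κ * (c * s' * |x - x'|) = κ * (c * s') * |x - x'|))) hh
        exact this
      refine h2.trans ?_
      have h3 : 0 ≤ κ * (c * s') := by positivity
      nlinarith
    calc C * |x - x'| ≤ κ ^ 2 * (c * s') * |x - x'| := by gcongr
      _ = _ := by ring
  have main := norm_integral_oscillatory_le (Φ := fun y => φ (x, y) - φ (x', y))
    (p := fun y => partialY φ (x, y) - partialY φ (x', y))
    (p1 := fun y => partialY (partialY φ) (x, y) - partialY (partialY φ) (x', y))
    (p2 := fun y => partialY (partialY (partialY φ)) (x, y) -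
      partialY (partialY (partialY φ)) (x', y)) (a := a) (lam := lam) (μ := c * s' * |x - x'|)
    (κ := κ) (A := A ^ 2) (ℓ := 3 * s / c) (y0 := y0) haS hcs
    (fun y => (hasDerivAt_partialY hφ.smooth x y).sub (hasDerivAt_partialY hφ.smooth x' y))
    (fun y => (hasDerivAt_partialY sm1 x y).sub (hasDerivAt_partialY sm1 x' y))
    (fun y => (hasDerivAt_partialY sm2 x y).sub (hasDerivAt_partialY sm2 x' y))
    (by have := sm3.continuous; fun_prop) hlam (by positivity) hκ0 (by positivity) (by positivity)
    (fun y hy => hb.slice_length hφ hε (by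
      intro h; apply hy; simp only [ha]; simp [h]) hy0)
    hlow
    (fun y hy => by
      obtain ⟨⟨hx, hyY, -, -⟩, hx', -⟩ := hts y hy
      exact (hφ.lip_yy x hx x' hx' y hyY).trans (hCκ.trans (by gcongr; exact hlow y hy)))
    (fun y hy => by
      obtain ⟨⟨hx, hyY, -, -⟩, hx', -⟩ := hts y hy
      exact (hφ.lip_yyy x hx x' hx' y hyY).trans (hCκ2.trans (by gcongr; exact hlow y hy)))
    (fun y => by rw [sq]; exact mulb (b0 y) (b0' y))
    (fun y => by
      rw [(d1 y).deriv]
      refine (norm_add_le _ _).trans ((add_le_add (mulb (b1 y) (b0' y)) (mulb (b0 y) (b1' y))).trans ?_)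
      calc A / s * A + A * (A / s) = A ^ 2 * (2 / s) := by ring
        _ ≤ _ := by gcongr)
    (fun y => by
      rw [(d2 y).deriv]
      refine (norm_add_le _ _).trans ((add_le_add ((norm_add_le _ _).trans
        (add_le_add (mulb (b2 y) (b0' y)) (mulb (b1 y) (b1' y)))) ((norm_add_le _ _).trans
        (add_le_add (mulb (b1 y) (b1' y)) (mulb (b0 y) (b2' y))))).trans ?_)
      calc A / s ^ 2 * A + A / s * (A / s) + (A / s * (A / s) + A * (A / s ^ 2))
          = A ^ 2 * (4 / s ^ 2) := by ring
        _ ≤ _ := by gcongr)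
  simp only [oscKernel_mul_conj]
  calc ‖∫ y, Complex.exp (Complex.I * lam * ((φ (x, y) - φ (x', y) : ℝ) : ℂ)) * a y‖ *
        (lam * s * s' * |x - x'|) ^ 2
      ≤ (16 * A ^ 2 * (κ / (lam * (c * s' * |x - x'|))) ^ 2 * (3 * s / c)) *
        (lam * s * s' * |x - x'|) ^ 2 := by gcongr
    _ = 192 * C ^ 2 / c ^ 5 * A ^ 2 * s := by
        rw [hκ]; field_simp; ring

end FoldPhase

/-! ### Square function estimate for sampled dyadic pieces. -/

section SquareFunction

variable {φ : ℝ × ℝ → ℝ} {X Y : Set ℝ} {c C A s s' ε lam : ℝ} {b b' : ℝ × ℝ → ℂ}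

/-- Row sums of one block of the Gram matrix decay in the ratio of the two scales. -/
theorem exists_gram_block_le (hc : 0 < c) (hC : 1 ≤ C) : ∃ K₁ : ℝ, 0 < K₁ ∧
    ∀ (lam s s' sl x K₀ : ℝ) (M : Finset ℤ) (pt g : ℤ → ℝ), 0 < lam → 0 < s → s ≤ sl → sl ≤ s' →
      1 ≤ lam * s ^ 3 → 0 < K₀ →
      (∀ m ∈ M, m * (1 / (lam * sl ^ 2)) ≤ pt m ∧ pt m ≤ (m + 1) * (1 / (lam * sl ^ 2))) →
      (∀ m ∈ M, 0 ≤ g m) → (∀ m ∈ M, g m ≤ K₀ * s) →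
      (∀ m ∈ M, g m * (lam * s * s' * |x - pt m|) ^ 2 ≤ K₀ * s) →
      (∀ m ∈ M, g m ≠ 0 → |x - pt m| ≤ 4 / c * s' ∧ s' - 4 * s ≤ C * |x - pt m|) →
      ∑ m ∈ M, 1 / sl * g m ≤ K₁ * K₀ * (s / s') ^ 2 := by
  obtain ⟨C₀, hC₀, hgrid⟩ := exists_grid_sum_le
  -- One summand per regime: comparable scales, where the grid sum converges by quadratic decay, and
  -- separated scales, where points are counted and every entry is small.
  refine ⟨65 * 64 * C₀ + (8 / c + 3) * (4 * C ^ 2), by positivity, ?_⟩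
  intro lam s s' sl x K₀ M pt g hlam hs hsl hsl' h1 hK hpt hg0 hg1 hg2 hg3
  have hsl0 : 0 < sl := hs.trans_le hsl
  have hs'0 : 0 < s' := hsl0.trans_le hsl'
  have hC0 : 0 < C := by linarith
  -- For s' > 8s the support condition s' - 4s ≤ C|x - x'| forces |x - x'| ≥ s'/(2C), so the decay
  -- bound applies to all nonzero entries at once.
  by_cases hnear : s' ≤ 8 * s
  · have hsum := hgrid (1 / (lam * sl ^ 2)) x 64 M pt (fun m => g m / (K₀ * s)) (by positivity)
      (by norm_num) hpt (fun m hm => (div_le_one (by positivity)).2 (hg1 m hm)) (fun m hm => by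
        have h2 := hg2 m hm
        have h3 : sl ^ 4 ≤ 64 * (s * s') ^ 2 := by
          calc sl ^ 4 ≤ s' ^ 4 := by gcongr
            _ = s' ^ 2 * s' ^ 2 := by ring
            _ ≤ (8 * s) ^ 2 * s' ^ 2 := by gcongr
            _ = _ := by ring
        calc g m / (K₀ * s) * ((x - pt m) / (1 / (lam * sl ^ 2))) ^ 2
            = g m / (K₀ * s) * (lam ^ 2 * |x - pt m| ^ 2) * sl ^ 4 := by
              rw [sq_abs]; field_simp
          _ ≤ g m / (K₀ * s) * (lam ^ 2 * |x - pt m| ^ 2) * (64 * (s * s') ^ 2) := by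
              have := hg0 m hm
              gcongr
          _ = 64 * (g m * (lam * s * s' * |x - pt m|) ^ 2 / (K₀ * s)) := by ring
          _ ≤ 64 * 1 := by
              gcongr; exact (div_le_one (by positivity)).2 h2
          _ = 64 := by ring)
    have hρ : 1 ≤ 64 * (s / s') ^ 2 := by
      have : 1 / 8 ≤ s / s' := by rw [div_le_div_iff₀ (by norm_num) hs'0]; linarith
      calc (1 : ℝ) = 64 * (1 / 8) ^ 2 := by norm_num
        _ ≤ _ := by gcongr
    calc ∑ m ∈ M, 1 / sl * g m = K₀ * (s / sl) * ∑ m ∈ M, g m / (K₀ * s) := by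
          rw [Finset.mul_sum]; refine Finset.sum_congr rfl fun m _ => ?_; field_simp
      _ ≤ K₀ * 1 * (C₀ * (1 + 64)) := by
          gcongr
          · exact Finset.sum_nonneg fun m hm => div_nonneg (hg0 m hm) (by positivity)
          · exact (div_le_one hsl0).2 hsl
      _ = (K₀ * C₀ * 65) * 1 := by ring
      _ ≤ (K₀ * C₀ * 65) * (64 * (s / s') ^ 2) := by gcongr
      _ = (65 * 64 * C₀) * K₀ * (s / s') ^ 2 := by ring
      _ ≤ _ := by
          gcongr
          have : 0 ≤ (8 / c + 3) * (4 * C ^ 2) := by positivity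
          linarith
  · push Not at hnear
    classical
    have hM : ∑ m ∈ M, 1 / sl * g m = ∑ m ∈ M with g m ≠ 0, 1 / sl * g m := by
      rw [Finset.sum_filter]
      refine Finset.sum_congr rfl fun m _ => ?_
      by_cases h : g m = 0 <;> simp [h]
    have hterm : ∀ m ∈ M.filter (fun m => g m ≠ 0), 1 / sl * g m ≤
        1 / sl * (K₀ * s * (4 * C ^ 2) / (lam * s * s' ^ 2) ^ 2) := by
      intro m hm
      obtain ⟨hm1, hm2⟩ := Finset.mem_filter.1 hm
      obtain ⟨-, h3⟩ := hg3 m hm1 hm2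
      have h4 : s' / (2 * C) ≤ |x - pt m| := by
        rw [div_le_iff₀ (by positivity)]; nlinarith
      have h5 := hg2 m hm1
      have h6 : g m * (lam * s * s' * (s' / (2 * C))) ^ 2 ≤ K₀ * s := by
        refine le_trans ?_ h5
        have := hg0 m hm1
        gcongr
      gcongr
      rw [le_div_iff₀ (by positivity)]
      calc g m * (lam * s * s' ^ 2) ^ 2
          = g m * (lam * s * s' * (s' / (2 * C))) ^ 2 * (4 * C ^ 2) := by field_simp; ring
        _ ≤ _ := by gcongr
    have hcard := card_grid_near_le (r := 1 / (lam * sl ^ 2)) (x := x) (R := 4 / c * s')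
      (by positivity) (by positivity) (M.filter fun m => g m ≠ 0) pt
      (fun m hm => hpt m (Finset.mem_filter.1 hm).1)
      (fun m hm => (hg3 m (Finset.mem_filter.1 hm).1 (Finset.mem_filter.1 hm).2).1)
    -- This is where the restriction λ s³ ≥ 1 enters: it absorbs the additive 3 of the point count,
    -- and it bounds the leftover factor 1/(λ s³) at the end.
    have hone : 1 ≤ s' * lam * sl ^ 2 := by
      calc 1 ≤ lam * s ^ 3 := h1
        _ = s * lam * s ^ 2 := by ring
        _ ≤ _ := by gcongr; linarith
    have hcard2 : ((M.filter fun m => g m ≠ 0).card : ℝ) ≤ (8 / c + 3) * (s' * lam * sl ^ 2) := by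
      refine hcard.trans ?_
      have : 2 * (4 / c * s' / (1 / (lam * sl ^ 2))) = 8 / c * (s' * lam * sl ^ 2) := by
        field_simp; ring
      rw [this]; linarith
    rw [hM]
    refine (Finset.sum_le_card_nsmul _ _ _ hterm).trans ?_
    rw [nsmul_eq_mul]
    calc ((M.filter fun m => g m ≠ 0).card : ℝ) *
          (1 / sl * (K₀ * s * (4 * C ^ 2) / (lam * s * s' ^ 2) ^ 2))
        ≤ ((8 / c + 3) * (s' * lam * sl ^ 2)) *
          (1 / sl * (K₀ * s * (4 * C ^ 2) / (lam * s * s' ^ 2) ^ 2)) := by gcongr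
      _ = (8 / c + 3) * (4 * C ^ 2) * K₀ * (s / s') ^ 2 * ((sl / s') * (1 / (lam * s ^ 3))) := by
          field_simp
      _ ≤ (8 / c + 3) * (4 * C ^ 2) * K₀ * (s / s') ^ 2 * (1 * 1) := by
          gcongr
          · exact (div_le_one hs'0).2 hsl'
          · exact (div_le_one (by positivity)).2 h1
      _ = (8 / c + 3) * (4 * C ^ 2) * K₀ * (s / s') ^ 2 := by ring
      _ ≤ _ := by
          gcongr
          have : 0 ≤ 65 * 64 * C₀ := by positivity
          linarith

theorem continuous_oscKernel (hφ : ContDiff ℝ ∞ φ) (hb : Continuous b) (x : ℝ) :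
    Continuous fun y => oscKernel φ b lam x y := by
  have := hφ.continuous
  unfold oscKernel
  fun_prop

theorem memLp_conj_oscKernel (hφ : FoldPhase φ X Y c C) (hb : ScaleAmplitude φ X Y A s ε b)
    (lam x : ℝ) : MemLp (fun y => (starRingEnd ℂ) (oscKernel φ b lam x y)) 2 volume := by
  refine Continuous.memLp_of_hasCompactSupport
    (Complex.continuous_conj.comp (continuous_oscKernel hφ.smooth hb.cont x)) ?_
  refine (hb.hasCompactSupport hφ x).mono fun y hy h => hy ?_
  have : b (x, y) = 0 := h
  simp [oscKernel, this]

/-- The scales `σ 2^k`. -/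
noncomputable def scale (σ : ℝ) (k : ℕ) : ℝ := σ * 2 ^ k

theorem scale_pos {σ : ℝ} (hσ : 0 < σ) (k : ℕ) : 0 < scale σ k := by unfold scale; positivity

theorem scale_mono {σ : ℝ} (hσ : 0 < σ) {k l : ℕ} (h : k ≤ l) : scale σ k ≤ scale σ l := by
  unfold scale; gcongr; norm_num

theorem le_scale {σ : ℝ} (hσ : 0 < σ) (k : ℕ) : σ ≤ scale σ k := by
  simpa [scale] using scale_mono hσ (Nat.zero_le k)

theorem scale_div_sq {σ : ℝ} (hσ : 0 < σ) {k l : ℕ} (h : k ≤ l) :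
    (scale σ k / scale σ l) ^ 2 = (1 / 4 : ℝ) ^ (l - k) := by
  obtain ⟨d, rfl⟩ := Nat.exists_eq_add_of_le h
  have : scale σ k / scale σ (k + d) = (1 / 2) ^ d := by
    unfold scale; rw [pow_add, one_div, inv_pow]; field_simp
  rw [this, ← pow_mul, mul_comm, pow_mul]; norm_num

theorem one_le_lam_scale {σ : ℝ} (hlam : 0 < lam) (hσ : 0 < σ) (h : 1 ≤ lam * σ ^ 3) (k : ℕ) :
    1 ≤ lam * scale σ k ^ 3 := by
  have := le_scale hσ k
  calc 1 ≤ lam * σ ^ 3 := h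
    _ ≤ _ := by gcongr

/-- Grid spacing at a given scale. -/
noncomputable def spacing (lam σ : ℝ) (k : ℕ) : ℝ := 1 / (lam * scale σ k ^ 2)

theorem spacing_pos {σ : ℝ} (hlam : 0 < lam) (hσ : 0 < σ) (k : ℕ) : 0 < spacing lam σ k := by
  have := scale_pos hσ k
  unfold spacing; positivity

/-- Grid cells at a given scale. -/
def cell (lam σ : ℝ) (k : ℕ) (m : ℤ) : Set ℝ :=
  Set.Ico (m * spacing lam σ k) ((m + 1) * spacing lam σ k)

theorem eLpNorm_two_sq (f : ℝ → ℂ) : eLpNorm f 2 volume ^ 2 = ∫⁻ y, ‖f y‖ₑ ^ 2 := by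
  have := eLpNorm_nnreal_pow_eq_lintegral (f := f) (μ := volume) (p := 2) (by norm_num)
  simpa using this

theorem eLpNorm_three_cube (f : ℝ → ℂ) : eLpNorm f 3 volume ^ 3 = ∫⁻ y, ‖f y‖ₑ ^ 3 := by
  have := eLpNorm_nnreal_pow_eq_lintegral (f := f) (μ := volume) (p := 3) (by norm_num)
  simpa using this

/-- Square function estimate for the dyadic pieces, sampled on the grids. -/
theorem exists_sampled_square_le (hφ : FoldPhase φ X Y c C) : ∃ K : ℝ, 0 < K ∧
    ∀ (A ε σ lam : ℝ) (n : ℕ) (b : ℕ → ℝ × ℝ → ℂ) (M : Finset ℤ) (pt : ℕ → ℤ → ℝ) (f : ℝ → ℂ),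
      0 < A → (ε = 1 ∨ ε = -1) → 0 < σ → 0 < lam → 1 ≤ lam * σ ^ 3 →
      (∀ k < n, ScaleAmplitude φ X Y A (scale σ k) ε (b k)) →
      (∀ k < n, ∀ m ∈ M, pt k m ∈ cell lam σ k m) → MemLp f 2 volume →
      ∑ k ∈ Finset.range n, ∑ m ∈ M, ENNReal.ofReal (1 / scale σ k) *
        ‖oscOp φ (b k) lam f (pt k m)‖ₑ ^ 2 ≤ ENNReal.ofReal (K * A ^ 2) * ∫⁻ y, ‖f y‖ₑ ^ 2 := by
  have hc := hφ.c_pos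
  have hc1 := hφ.c_le_one
  have hC := hφ.one_le_C
  obtain ⟨K₁, hK₁, hblock⟩ := exists_gram_block_le hc hC
  set K₀ : ℝ := 192 * C ^ 2 / c ^ 5 with hK₀
  have hK₀6 : 6 / c ≤ K₀ := by
    rw [hK₀, div_le_div_iff₀ hc (by positivity)]
    have h1 : c ^ 5 ≤ c := by
      calc c ^ 5 = c ^ 4 * c := by ring
        _ ≤ 1 * c := by gcongr; exact pow_le_one₀ hc.le hc1
        _ = c := one_mul c
    have h2 : 1 ≤ C ^ 2 := one_le_pow₀ hC
    nlinarith
  have hK₀0 : 0 < K₀ := by positivity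
  refine ⟨3 * (K₁ * K₀), by positivity, ?_⟩
  intro A ε σ lam n b M pt f hA hε hσ hlam h1 hb hpt hf
  classical
  -- The inner product is conjugate-linear in its first slot, so conjugated kernels make ⟨v, f⟩
  -- equal to the value of the operator at the sample point.
  set v : ℕ × ℤ → Lp ℂ 2 (volume : Measure ℝ) := fun i =>
    if h : i.1 < n then (memLp_conj_oscKernel hφ (hb i.1 h) lam (pt i.1 i.2)).toLp _ else 0 with hv
  have hinner : ∀ k < n, ∀ l < n, ∀ m p, inner ℂ (v (k, m)) (v (l, p)) =
      ∫ y, oscKernel φ (b k) lam (pt k m) y *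
        (starRingEnd ℂ) (oscKernel φ (b l) lam (pt l p) y) := by
    intro k hk l hl m p
    simp only [hv, hk, hl, dif_pos]
    rw [L2.inner_def]
    refine integral_congr_ae ?_
    filter_upwards [(memLp_conj_oscKernel hφ (hb k hk) lam (pt k m)).coeFn_toLp,
      (memLp_conj_oscKernel hφ (hb l hl) lam (pt l p)).coeFn_toLp] with y e1 e2
    rw [e1, e2, RCLike.inner_apply, Complex.conj_conj, mul_comm]
  have hinnerf : ∀ k < n, ∀ m, inner ℂ (v (k, m)) (hf.toLp f) =
      oscOp φ (b k) lam f (pt k m) := by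
    intro k hk m
    simp only [hv, hk, dif_pos]
    rw [L2.inner_def, oscOp_eq]
    refine integral_congr_ae ?_
    filter_upwards [(memLp_conj_oscKernel hφ (hb k hk) lam (pt k m)).coeFn_toLp,
      hf.coeFn_toLp] with y e1 e2
    rw [e1, e2, RCLike.inner_apply, Complex.conj_conj, mul_comm]
  have hrow : ∀ i ∈ Finset.range n ×ˢ M, ∑ j ∈ Finset.range n ×ˢ M,
      1 / scale σ j.1 * ‖inner ℂ (v i) (v j)‖ ≤ 3 * (K₁ * K₀) * A ^ 2 := by
    rintro ⟨k, m⟩ hi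
    obtain ⟨hk', hm⟩ := Finset.mem_product.1 hi
    have hk : k < n := Finset.mem_range.1 hk'
    rw [Finset.sum_product]
    -- The kernel bounds want the smaller scale first, so for l ≤ k the inner product is flipped.
    -- The grid spacing and weight belong to l in both cases, which is why the block estimate has a
    -- third scale `sl`.
    have hbl : ∀ l ∈ Finset.range n, ∑ p ∈ M, 1 / scale σ l * ‖inner ℂ (v (k, m)) (v (l, p))‖ ≤
        K₁ * (K₀ * A ^ 2) * (1 / 4 : ℝ) ^ (max k l - min k l) := by
      intro l hl'
      have hl : l < n := Finset.mem_range.1 hl'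
      have hcell : ∀ p ∈ M, p * (1 / (lam * scale σ l ^ 2)) ≤ pt l p ∧
          pt l p ≤ (p + 1) * (1 / (lam * scale σ l ^ 2)) := fun p hp =>
        ⟨(hpt l hl p hp).1, (hpt l hl p hp).2.le⟩
      rcases le_total k l with hkl | hkl
      · rw [max_eq_right hkl, min_eq_left hkl, ← scale_div_sq hσ hkl]
        refine hblock lam (scale σ k) (scale σ l) (scale σ l) (pt k m) (K₀ * A ^ 2) M (pt l) _ hlam
          (scale_pos hσ k) (scale_mono hσ hkl) le_rfl (one_le_lam_scale hlam hσ h1 k)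
          (by positivity) hcell (fun p _ => norm_nonneg _) ?_ ?_ ?_
        · intro p hp
          rw [hinner k hk l hl]
          refine (norm_gram_le_size hφ hε (scale_pos hσ k) hA.le (hb k hk) (hb l hl) _ _).trans ?_
          have := scale_pos hσ k
          gcongr
        · intro p hp
          rw [hinner k hk l hl]
          exact norm_gram_le_decay hφ hε hlam (scale_pos hσ k) (scale_mono hσ hkl) hA.le
            (hb k hk) (hb l hl) _ _
        · intro p hp hne
          rw [hinner k hk l hl, ne_eq, norm_eq_zero] at hne
          exact gram_support hφ hε (scale_pos hσ k) (scale_mono hσ hkl) (hb k hk) (hb l hl) _ _ hne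
      · rw [max_eq_left hkl, min_eq_right hkl, ← scale_div_sq hσ hkl]
        refine hblock lam (scale σ l) (scale σ k) (scale σ l) (pt k m) (K₀ * A ^ 2) M (pt l) _ hlam
          (scale_pos hσ l) le_rfl (scale_mono hσ hkl) (one_le_lam_scale hlam hσ h1 l)
          (by positivity) hcell (fun p _ => norm_nonneg _) ?_ ?_ ?_
        · intro p hp
          rw [norm_inner_symm, hinner l hl k hk]
          refine (norm_gram_le_size hφ hε (scale_pos hσ l) hA.le (hb l hl) (hb k hk) _ _).trans ?_
          have := scale_pos hσ l
          gcongr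
        · intro p hp
          rw [norm_inner_symm, hinner l hl k hk, abs_sub_comm]
          exact norm_gram_le_decay hφ hε hlam (scale_pos hσ l) (scale_mono hσ hkl) hA.le
            (hb l hl) (hb k hk) _ _
        · intro p hp hne
          rw [norm_inner_symm, hinner l hl k hk, ne_eq, norm_eq_zero] at hne
          rw [abs_sub_comm]
          exact gram_support hφ hε (scale_pos hσ l) (scale_mono hσ hkl) (hb l hl) (hb k hk) _ _ hne
    calc _ ≤ ∑ l ∈ Finset.range n, K₁ * (K₀ * A ^ 2) * (1 / 4 : ℝ) ^ (max k l - min k l) :=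
          Finset.sum_le_sum hbl
      _ = K₁ * (K₀ * A ^ 2) * ∑ l ∈ Finset.range n, (1 / 4 : ℝ) ^ (max k l - min k l) := by
          rw [Finset.mul_sum]
      _ ≤ K₁ * (K₀ * A ^ 2) * 3 := by
          gcongr; exact sum_quarter_pow_dist_le n k
      _ = _ := by ring
  have hbes := bessel_of_gram_row_sum_le (Finset.range n ×ˢ M) v (fun i => 1 / scale σ i.1)
    (fun i _ => by have := scale_pos hσ i.1; positivity) (by positivity) hrow (hf.toLp f)
  rw [Finset.sum_product] at hbes
  have hfn : ENNReal.ofReal (‖hf.toLp f‖ ^ 2) = ∫⁻ y, ‖f y‖ₑ ^ 2 := by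
    rw [Lp.norm_toLp, ENNReal.ofReal_pow ENNReal.toReal_nonneg,
      ENNReal.ofReal_toReal hf.eLpNorm_ne_top, eLpNorm_two_sq]
  rw [← hfn, ← ENNReal.ofReal_mul (by positivity)]
  refine le_trans (le_of_eq ?_) (ENNReal.ofReal_le_ofReal hbes)
  rw [ENNReal.ofReal_sum_of_nonneg]
  · refine Finset.sum_congr rfl fun k hk => ?_
    have hs := scale_pos hσ k
    rw [ENNReal.ofReal_sum_of_nonneg (fun m _ => by positivity)]
    refine Finset.sum_congr rfl fun m _ => ?_
    rw [hinnerf k (Finset.mem_range.1 hk), ENNReal.ofReal_mul (by positivity),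
      ENNReal.ofReal_pow (norm_nonneg _), ofReal_norm]
  · intro k hk
    have hs := scale_pos hσ k
    exact Finset.sum_nonneg fun m _ => by positivity

end SquareFunction

/-! ### Suprema over grid cells and the L² bounds. -/

section CellSup

variable {φ : ℝ × ℝ → ℝ} {X Y : Set ℝ} {c C A s s' ε lam σ : ℝ} {b b' : ℝ × ℝ → ℂ}

theorem integrable_oscKernel_mul (hφ : ContDiff ℝ ∞ φ) (hb : Continuous b)
    (hbc : ∀ x, HasCompactSupport fun y => b (x, y)) {f : ℝ → ℂ}
    (hf : MemLp f 2 volume) (lam x : ℝ) : Integrable fun y => oscKernel φ b lam x y * f y := by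
  have h : MemLp (fun y => oscKernel φ b lam x y) 2 volume := by
    refine Continuous.memLp_of_hasCompactSupport (continuous_oscKernel hφ hb x) ?_
    refine (hbc x).mono fun y hy h => hy ?_
    have : b (x, y) = 0 := h
    simp [oscKernel, this]
  exact h.integrable_mul hf

theorem oscOp_add (hφ : ContDiff ℝ ∞ φ) (hb : Continuous b)
    (hbc : ∀ x, HasCompactSupport fun y => b (x, y)) {f g : ℝ → ℂ}
    (hf : MemLp f 2 volume) (hg : MemLp g 2 volume) (lam x : ℝ) :
    oscOp φ b lam (f + g) x = oscOp φ b lam f x + oscOp φ b lam g x := by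
  simp only [oscOp_eq]
  rw [← integral_add (integrable_oscKernel_mul hφ hb hbc hf lam x)
    (integrable_oscKernel_mul hφ hb hbc hg lam x)]
  refine integral_congr_ae (Filter.Eventually.of_forall fun y => ?_)
  simp [mul_add]

theorem measurable_oscOp (hφ : Continuous φ) (hb : Continuous b) {f : ℝ → ℂ}
    (hf : AEStronglyMeasurable f volume) (lam : ℝ) : Measurable (oscOp φ b lam f) := by
  have h1 : oscOp φ b lam f = oscOp φ b lam (hf.mk f) := by
    ext x
    simp only [oscOp_eq]
    refine integral_congr_ae ?_
    filter_upwards [hf.ae_eq_mk] with y hy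
    rw [hy]
  rw [h1]
  have h2 : StronglyMeasurable fun z : ℝ × ℝ => oscKernel φ b lam z.1 z.2 * hf.mk f z.2 := by
    refine StronglyMeasurable.mul ?_ (hf.stronglyMeasurable_mk.comp_measurable measurable_snd)
    have : Continuous fun z : ℝ × ℝ => oscKernel φ b lam z.1 z.2 := by
      unfold oscKernel; fun_prop
    exact this.stronglyMeasurable
  exact h2.integral_prod_right'.measurable

theorem enorm_oscOp_le_lintegral (φ : ℝ × ℝ → ℝ) (b : ℝ × ℝ → ℂ) (lam : ℝ) (f : ℝ → ℂ) (x : ℝ) :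
    ‖oscOp φ b lam f x‖ₑ ≤ ∫⁻ y, ‖b (x, y)‖ₑ * ‖f y‖ₑ := by
  rw [oscOp_eq]
  refine (enorm_integral_le_lintegral_enorm _).trans (le_of_eq ?_)
  refine lintegral_congr fun y => ?_
  rw [enorm_mul, ← ofReal_norm, norm_oscKernel, ofReal_norm]

theorem enorm_oscOp_le_of_norm_le (hφ : FoldPhase φ X Y c C)
    (hb0 : ∀ x y, ‖b (x, y)‖ ≤ A) (hb : ∀ x y, b (x, y) ≠ 0 → y ∈ Y) (f : ℝ → ℂ) (x : ℝ) :
    ‖oscOp φ b lam f x‖ₑ ≤ ENNReal.ofReal A * ∫⁻ y in Y, ‖f y‖ₑ := by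
  refine (enorm_oscOp_le_lintegral _ _ _ _ _).trans ?_
  rw [← lintegral_const_mul' _ _ ENNReal.ofReal_ne_top,
    ← lintegral_indicator hφ.compactY.measurableSet]
  refine lintegral_mono fun y => ?_
  by_cases h : b (x, y) = 0
  · simp [h]
  · rw [Set.indicator_of_mem (hb x y h)]
    gcongr
    rw [← ofReal_norm]
    exact ENNReal.ofReal_le_ofReal (hb0 x y)

theorem lintegral_compact_lt_top (hY : IsCompact Y) {f : ℝ → ℂ} (hf : MemLp f 2 volume) :
    ∫⁻ y in Y, ‖f y‖ₑ < ⊤ := by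
  have : IsFiniteMeasure (volume.restrict Y) := ⟨by simpa using hY.measure_lt_top⟩
  exact ((hf.restrict Y).integrable one_le_two).hasFiniteIntegral

/-- The supremum of `|T f|` over a grid cell. -/
noncomputable def cellSup (φ : ℝ × ℝ → ℝ) (b : ℝ × ℝ → ℂ) (lam : ℝ) (I : Set ℝ) (f : ℝ → ℂ) :
    ℝ≥0∞ := ⨆ x ∈ I, ‖oscOp φ b lam f x‖ₑ

theorem cellSup_le_iff {I : Set ℝ} {f : ℝ → ℂ} {B : ℝ≥0∞} :
    cellSup φ b lam I f ≤ B ↔ ∀ x ∈ I, ‖oscOp φ b lam f x‖ₑ ≤ B := by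
  simp [cellSup]

theorem ScaleAmplitude.cellSup_ne_top (hφ : FoldPhase φ X Y c C)
    (hb : ScaleAmplitude φ X Y A s ε b) (lam : ℝ) (I : Set ℝ) {f : ℝ → ℂ}
    (hf : MemLp f 2 volume) : cellSup φ b lam I f ≠ ⊤ := by
  refine ne_top_of_le_ne_top (b := ENNReal.ofReal A * ∫⁻ y in Y, ‖f y‖ₑ)
    (ENNReal.mul_lt_top ENNReal.ofReal_lt_top (lintegral_compact_lt_top hφ.compactY hf)).ne ?_
  exact cellSup_le_iff.2 fun x _ =>
    enorm_oscOp_le_of_norm_le hφ hb.bd0 (fun x y h => (hb.supp x y h).2.1) f x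

/-- The supremum need not be attained; a near-maximiser in each cell suffices, because the sampled
estimate is uniform in the sample points. -/
theorem exists_half_cellSup (φ : ℝ × ℝ → ℝ) (b : ℝ × ℝ → ℂ) (lam : ℝ) {I : Set ℝ}
    (hI : I.Nonempty) (f : ℝ → ℂ) (hfin : cellSup φ b lam I f ≠ ⊤) :
    ∃ x ∈ I, cellSup φ b lam I f ≤ 2 * ‖oscOp φ b lam f x‖ₑ := by
  by_cases h0 : cellSup φ b lam I f = 0
  · obtain ⟨x, hx⟩ := hI
    exact ⟨x, hx, by rw [h0]; exact zero_le⟩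
  · have h1 : cellSup φ b lam I f / 2 < cellSup φ b lam I f := ENNReal.half_lt_self h0 hfin
    conv_rhs at h1 => rw [cellSup]
    obtain ⟨x, hx⟩ := lt_iSup_iff.1 h1
    obtain ⟨hxI, hx2⟩ := lt_iSup_iff.1 hx
    refine ⟨x, hxI, ?_⟩
    rw [mul_comm]
    exact ENNReal.div_le_iff (by norm_num) (by norm_num) |>.1 hx2.le

theorem cell_nonempty (hlam : 0 < lam) (hσ : 0 < σ) (k : ℕ) (m : ℤ) :
    (cell lam σ k m).Nonempty := by
  have := spacing_pos hlam hσ k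
  exact ⟨m * spacing lam σ k, le_rfl, by linarith⟩

/-- Square function estimate with suprema over grid cells. -/
theorem exists_sup_square_le (hφ : FoldPhase φ X Y c C) (hA : 0 < A) : ∃ K : ℝ, 0 < K ∧
    ∀ (ε σ lam : ℝ) (n : ℕ) (b : ℕ → ℝ × ℝ → ℂ) (M : Finset ℤ) (f : ℝ → ℂ),
      (ε = 1 ∨ ε = -1) → 0 < σ → 0 < lam → 1 ≤ lam * σ ^ 3 →
      (∀ k, ScaleAmplitude φ X Y A (scale σ k) ε (b k)) → MemLp f 2 volume →
      ∑ k ∈ Finset.range n, ∑ m ∈ M, ENNReal.ofReal (1 / scale σ k) *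
        cellSup φ (b k) lam (cell lam σ k m) f ^ 2 ≤ ENNReal.ofReal K * ∫⁻ y, ‖f y‖ₑ ^ 2 := by
  obtain ⟨K, hK, hmain⟩ := exists_sampled_square_le hφ
  refine ⟨4 * (K * A ^ 2), by positivity, ?_⟩
  intro ε σ lam n b M f hε hσ hlam h1 hb hf
  have hpt : ∀ k m, ∃ x ∈ cell lam σ k m, cellSup φ (b k) lam (cell lam σ k m) f ≤
      2 * ‖oscOp φ (b k) lam f x‖ₑ := fun k m =>
    exists_half_cellSup φ (b k) lam (cell_nonempty hlam hσ k m) f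
      ((hb k).cellSup_ne_top hφ lam _ hf)
  choose pt hpt1 hpt2 using hpt
  have h := hmain A ε σ lam n b M pt f hA hε hσ hlam h1 (fun k _ => hb k)
    (fun k _ m _ => hpt1 k m) hf
  calc _ ≤ ∑ k ∈ Finset.range n, ∑ m ∈ M, ENNReal.ofReal (1 / scale σ k) *
        (2 * ‖oscOp φ (b k) lam f (pt k m)‖ₑ) ^ 2 := by
        gcongr with k _ m _; exact hpt2 k m
    _ = 4 * ∑ k ∈ Finset.range n, ∑ m ∈ M, ENNReal.ofReal (1 / scale σ k) *
        ‖oscOp φ (b k) lam f (pt k m)‖ₑ ^ 2 := by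
        simp only [Finset.mul_sum]
        refine Finset.sum_congr rfl fun k _ => Finset.sum_congr rfl fun m _ => ?_
        ring
    _ ≤ 4 * (ENNReal.ofReal (K * A ^ 2) * ∫⁻ y, ‖f y‖ₑ ^ 2) := by gcongr
    _ = _ := by
        rw [ENNReal.ofReal_mul (by norm_num : (0 : ℝ) ≤ 4), mul_assoc]; norm_num

theorem pairwise_disjoint_cell (hlam : 0 < lam) (hσ : 0 < σ) (k : ℕ) (M : Finset ℤ) :
    Set.PairwiseDisjoint (M : Set ℤ) (cell lam σ k) := by
  intro m _ p _ hmp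
  have hr := spacing_pos hlam hσ k
  refine Set.disjoint_left.2 fun x hx hy => hmp ?_
  obtain ⟨x1, x2⟩ := hx
  obtain ⟨y1, y2⟩ := hy
  have h1 : (m : ℝ) < p + 1 := lt_of_mul_lt_mul_right (x1.trans_lt y2) hr.le
  have h2 : (p : ℝ) < m + 1 := lt_of_mul_lt_mul_right (y1.trans_lt x2) hr.le
  have h1' : m < p + 1 := by exact_mod_cast h1
  have h2' : p < m + 1 := by exact_mod_cast h2
  omega

theorem exists_cell_cover (hX : IsCompact X) (hlam : 0 < lam) (hσ : 0 < σ) (n : ℕ) :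
    ∃ M : Finset ℤ, ∀ k < n, X ⊆ ⋃ m ∈ M, cell lam σ k m := by
  obtain ⟨R, hR⟩ := hX.isBounded.subset_closedBall (0 : ℝ)
  refine ⟨(Finset.range n).biUnion fun k => Finset.Icc ⌊-R / spacing lam σ k⌋ ⌊R / spacing lam σ k⌋, ?_⟩
  intro k hk x hx
  have hr := spacing_pos hlam hσ k
  have hxR := hR hx
  rw [Metric.mem_closedBall, Real.dist_eq, sub_zero, abs_le] at hxR
  simp only [Set.mem_iUnion, exists_prop]
  refine ⟨⌊x / spacing lam σ k⌋, ?_, ?_, ?_⟩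
  · rw [Finset.mem_biUnion]
    refine ⟨k, Finset.mem_range.2 hk, Finset.mem_Icc.2 ⟨?_, ?_⟩⟩
    · exact Int.floor_le_floor (by gcongr; exact hxR.1)
    · exact Int.floor_le_floor (by gcongr; exact hxR.2)
  · exact (le_div_iff₀ hr).1 (Int.floor_le _)
  · exact (div_lt_iff₀ hr).1 (Int.lt_floor_add_one _)

theorem oscOp_eq_zero (hb : ∀ x y, b (x, y) ≠ 0 → x ∈ X) {x : ℝ} (hx : x ∉ X) (f : ℝ → ℂ) :
    oscOp φ b lam f x = 0 := by
  rw [oscOp_eq]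
  refine integral_eq_zero_of_ae (Filter.Eventually.of_forall fun y => ?_)
  have : b (x, y) = 0 := by
    by_contra h; exact hx (hb x y h)
  simp [oscKernel, this]

theorem lintegral_eq_sum_cell (hlam : 0 < lam) (hσ : 0 < σ) (k : ℕ) {M : Finset ℤ}
    (hM : X ⊆ ⋃ m ∈ M, cell lam σ k m) {g : ℝ → ℝ≥0∞} (hg : ∀ x ∉ X, g x = 0) :
    ∫⁻ x, g x = ∑ m ∈ M, ∫⁻ x in cell lam σ k m, g x := by
  rw [← lintegral_biUnion_finset (pairwise_disjoint_cell hlam hσ k M)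
    (fun m _ => measurableSet_Ico)]
  rw [setLIntegral_eq_of_support_subset]
  intro x hx
  by_contra h
  exact hx (hg x fun h' => h (hM h'))

theorem volume_cell (k : ℕ) (m : ℤ) :
    volume (cell lam σ k m) = ENNReal.ofReal (spacing lam σ k) := by
  rw [cell, Real.volume_Ico]; congr 1; ring

/-- Square function estimate for the dyadic pieces in `L²`. -/
theorem exists_integral_square_le (hφ : FoldPhase φ X Y c C) (hA : 0 < A) : ∃ K : ℝ, 0 < K ∧
    ∀ (ε σ lam : ℝ) (n : ℕ) (b : ℕ → ℝ × ℝ → ℂ) (f : ℝ → ℂ),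
      (ε = 1 ∨ ε = -1) → 0 < σ → 0 < lam → 1 ≤ lam * σ ^ 3 →
      (∀ k, ScaleAmplitude φ X Y A (scale σ k) ε (b k)) → MemLp f 2 volume →
      ∑ k ∈ Finset.range n, ENNReal.ofReal (lam * scale σ k) *
        ∫⁻ x, ‖oscOp φ (b k) lam f x‖ₑ ^ 2 ≤ ENNReal.ofReal K * ∫⁻ y, ‖f y‖ₑ ^ 2 := by
  obtain ⟨K, hK, hmain⟩ := exists_sup_square_le hφ hA
  refine ⟨K, hK, ?_⟩
  intro ε σ lam n b f hε hσ hlam h1 hb hf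
  obtain ⟨M, hM⟩ := exists_cell_cover hφ.compactX hlam hσ n
  refine le_trans (Finset.sum_le_sum fun k hk => ?_) (hmain ε σ lam n b M f hε hσ hlam h1 hb hf)
  have hs := scale_pos hσ k
  rw [lintegral_eq_sum_cell hlam hσ k (hM k (Finset.mem_range.1 hk)) (fun x hx => by
    rw [oscOp_eq_zero (fun x y h => ((hb k).supp x y h).1) hx]; simp), Finset.mul_sum]
  refine Finset.sum_le_sum fun m _ => ?_
  -- The cell length 1/(λ s²) times the weight λ s is exactly the weight 1/s of the supremum
  -- estimate.
  calc ENNReal.ofReal (lam * scale σ k) * ∫⁻ x in cell lam σ k m, ‖oscOp φ (b k) lam f x‖ₑ ^ 2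
      ≤ ENNReal.ofReal (lam * scale σ k) * ∫⁻ x in cell lam σ k m,
        cellSup φ (b k) lam (cell lam σ k m) f ^ 2 := by
        gcongr ENNReal.ofReal (lam * scale σ k) * ?_
        refine setLIntegral_mono' measurableSet_Ico fun x hx => ?_
        gcongr
        exact cellSup_le_iff.1 le_rfl x hx
    _ = ENNReal.ofReal (lam * scale σ k * spacing lam σ k) *
        cellSup φ (b k) lam (cell lam σ k m) f ^ 2 := by
        rw [setLIntegral_const, volume_cell,
          ENNReal.ofReal_mul (p := lam * scale σ k) (by positivity)]; ring
    _ = _ := by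
        congr 2
        unfold spacing; field_simp

theorem sum_inv_scale_le (hlam : 0 < lam) (hσ : 0 < σ) (n : ℕ) :
    ∑ k ∈ Finset.range n, 1 / (lam * scale σ k) ≤ 2 / (lam * σ) := by
  have h := (summable_geometric_of_lt_one (by norm_num : (0 : ℝ) ≤ 1 / 2) (by norm_num)).sum_le_tsum
    (Finset.range n) (fun l _ => by positivity)
  rw [tsum_geometric_of_lt_one (by norm_num) (by norm_num)] at h
  calc ∑ k ∈ Finset.range n, 1 / (lam * scale σ k)
      = 1 / (lam * σ) * ∑ k ∈ Finset.range n, (1 / 2 : ℝ) ^ k := by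
        rw [Finset.mul_sum]
        refine Finset.sum_congr rfl fun k _ => ?_
        unfold scale; rw [one_div (2 : ℝ), inv_pow]; field_simp
    _ ≤ 1 / (lam * σ) * (1 - 1 / 2)⁻¹ := by gcongr
    _ = _ := by norm_num; ring

/-- `L²` bound for a sum of dyadic pieces at scales at least `σ`. -/
theorem exists_dyadic_sum_L2_le (hφ : FoldPhase φ X Y c C) (hA : 0 < A) : ∃ K : ℝ, 0 < K ∧
    ∀ (ε σ lam : ℝ) (n : ℕ) (b : ℕ → ℝ × ℝ → ℂ) (f : ℝ → ℂ),
      (ε = 1 ∨ ε = -1) → 0 < σ → 0 < lam → 1 ≤ lam * σ ^ 3 →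
      (∀ k, ScaleAmplitude φ X Y A (scale σ k) ε (b k)) → MemLp f 2 volume →
      ∫⁻ x, ‖∑ k ∈ Finset.range n, oscOp φ (b k) lam f x‖ₑ ^ 2 ≤
        ENNReal.ofReal (K / (lam * σ)) * ∫⁻ y, ‖f y‖ₑ ^ 2 := by
  obtain ⟨K, hK, hmain⟩ := exists_integral_square_le hφ hA
  refine ⟨2 * K, by positivity, ?_⟩
  intro ε σ lam n b f hε hσ hlam h1 hb hf
  have h := hmain ε σ lam n b f hε hσ hlam h1 hb hf
  -- Cauchy–Schwarz with weights λ s_k; the reciprocals form a geometric series dominated by the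
  -- finest scale σ.
  have hpt : ∀ x, ‖∑ k ∈ Finset.range n, oscOp φ (b k) lam f x‖ₑ ^ 2 ≤
      ENNReal.ofReal (2 / (lam * σ)) * ∑ k ∈ Finset.range n,
        ENNReal.ofReal (lam * scale σ k) * ‖oscOp φ (b k) lam f x‖ₑ ^ 2 := by
    intro x
    have h2 : ‖∑ k ∈ Finset.range n, oscOp φ (b k) lam f x‖ ^ 2 ≤ 2 / (lam * σ) *
        ∑ k ∈ Finset.range n, lam * scale σ k * ‖oscOp φ (b k) lam f x‖ ^ 2 := by
      have e1 : ‖∑ k ∈ Finset.range n, oscOp φ (b k) lam f x‖ ^ 2 ≤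
          (∑ k ∈ Finset.range n, ‖oscOp φ (b k) lam f x‖) ^ 2 := by
        gcongr; exact norm_sum_le _ _
      have e2 := Finset.sum_sq_le_sum_mul_sum_of_sq_le_mul (Finset.range n)
        (f := fun k => 1 / (lam * scale σ k))
        (g := fun k => lam * scale σ k * ‖oscOp φ (b k) lam f x‖ ^ 2)
        (r := fun k => ‖oscOp φ (b k) lam f x‖)
        (fun k _ => by have := scale_pos hσ k; positivity)
        (fun k _ => by have := scale_pos hσ k; positivity)
        (fun k _ => by have := scale_pos hσ k; field_simp; exact le_rfl)
      refine e1.trans (e2.trans ?_)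
      have := sum_inv_scale_le hlam hσ n
      gcongr
      exact Finset.sum_nonneg fun k _ => by have := scale_pos hσ k; positivity
    have h3 := ENNReal.ofReal_le_ofReal h2
    rw [ENNReal.ofReal_pow (norm_nonneg _), ofReal_norm, ENNReal.ofReal_mul (by positivity),
      ENNReal.ofReal_sum_of_nonneg (fun k _ => by have := scale_pos hσ k; positivity)] at h3
    refine h3.trans (le_of_eq ?_)
    congr 1
    refine Finset.sum_congr rfl fun k _ => ?_
    have := scale_pos hσ k
    rw [ENNReal.ofReal_mul (by positivity), ENNReal.ofReal_pow (norm_nonneg _), ofReal_norm]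
  have hmeas : ∀ k, Measurable fun x => ‖oscOp φ (b k) lam f x‖ₑ ^ 2 := fun k =>
    (measurable_oscOp hφ.smooth.continuous (hb k).cont hf.1 lam).enorm.pow_const 2
  calc _ ≤ ∫⁻ x, ENNReal.ofReal (2 / (lam * σ)) * ∑ k ∈ Finset.range n,
        ENNReal.ofReal (lam * scale σ k) * ‖oscOp φ (b k) lam f x‖ₑ ^ 2 := lintegral_mono hpt
    _ = ENNReal.ofReal (2 / (lam * σ)) * ∑ k ∈ Finset.range n, ENNReal.ofReal (lam * scale σ k) *
        ∫⁻ x, ‖oscOp φ (b k) lam f x‖ₑ ^ 2 := by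
        rw [lintegral_const_mul' _ _ ENNReal.ofReal_ne_top,
          lintegral_finsetSum _ fun k _ => (hmeas k).const_mul _]
        congr 1
        refine Finset.sum_congr rfl fun k _ => ?_
        rw [lintegral_const_mul' _ _ ENNReal.ofReal_ne_top]
    _ ≤ ENNReal.ofReal (2 / (lam * σ)) * (ENNReal.ofReal K * ∫⁻ y, ‖f y‖ₑ ^ 2) := by gcongr
    _ = _ := by
        rw [← mul_assoc, ← ENNReal.ofReal_mul (by positivity)]
        congr 2; ring

end CellSup

/-! ### Cubic estimates and the endpoint L³ bound. -/

section Cubic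

variable {φ : ℝ × ℝ → ℝ} {X Y : Set ℝ} {c C A s s' ε lam σ : ℝ} {b b' : ℝ × ℝ → ℂ}

theorem memLp_highPart {f : ℝ → ℂ} (hfm : Measurable f) (hf : MemLp f 2 volume) (t : ℝ) :
    MemLp (highPart f t) 2 volume :=
  hf.indicator (measurableSet_lt measurable_const hfm.norm)

theorem memLp_lowPart {f : ℝ → ℂ} (hfm : Measurable f) (hf : MemLp f 2 volume) (t : ℝ) :
    MemLp (lowPart f t) 2 volume :=
  hf.indicator (measurableSet_le hfm.norm measurable_const)

theorem ScaleAmplitude.oscOp_split (hφ : FoldPhase φ X Y c C) (hb : ScaleAmplitude φ X Y A s ε b)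
    {f : ℝ → ℂ} (hfm : Measurable f) (hf : MemLp f 2 volume) (lam t x : ℝ) :
    oscOp φ b lam f x = oscOp φ b lam (lowPart f t) x + oscOp φ b lam (highPart f t) x := by
  rw [← oscOp_add hφ.smooth hb.cont (hb.hasCompactSupport hφ) (memLp_lowPart hfm hf t)
    (memLp_highPart hfm hf t)]
  congr 1
  ext y
  exact (lowPart_add_highPart f t y).symm

theorem ScaleAmplitude.enorm_oscOp_le_of_bounded (hφ : FoldPhase φ X Y c C) (hε : ε = 1 ∨ ε = -1)
    (hA : 0 ≤ A) (hb : ScaleAmplitude φ X Y A s ε b) {f : ℝ → ℂ} {t : ℝ}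
    (ht : 0 ≤ t) (hf : ∀ y, ‖f y‖ ≤ t) (lam x : ℝ) :
    ‖oscOp φ b lam f x‖ₑ ≤ ENNReal.ofReal (6 * A / c * s * t) := by
  have hc := hφ.c_pos
  refine (enorm_oscOp_le_lintegral _ _ _ _ _).trans ?_
  by_cases hne : ∃ y0, b (x, y0) ≠ 0
  swap
  · push Not at hne
    simp [hne]
  obtain ⟨y0, hy0⟩ := hne
  calc ∫⁻ y, ‖b (x, y)‖ₑ * ‖f y‖ₑ
      ≤ ∫⁻ y, Set.indicator (Set.Icc (y0 - 3 * s / c) (y0 + 3 * s / c))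
        (fun _ => ENNReal.ofReal (A * t)) y := by
        refine lintegral_mono fun y => ?_
        by_cases h : b (x, y) = 0
        · simp [h]
        · have := abs_le.1 (hb.slice_length hφ hε h hy0)
          rw [Set.indicator_of_mem (by constructor <;> linarith), ENNReal.ofReal_mul hA,
            ← ofReal_norm, ← ofReal_norm]
          gcongr
          · exact hb.bd0 x y
          · exact hf y
    _ = ENNReal.ofReal (6 * A / c * s * t) := by
        rw [lintegral_indicator measurableSet_Icc, setLIntegral_const, Real.volume_Icc,
          ← ENNReal.ofReal_mul (by positivity)]
        congr 1; ring

/-- `L³` estimate for the cell suprema of the dyadic pieces. -/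
theorem exists_sup_cube_le (hφ : FoldPhase φ X Y c C) (hA : 0 < A) : ∃ K : ℝ, 0 < K ∧
    ∀ (ε σ lam : ℝ) (n : ℕ) (b : ℕ → ℝ × ℝ → ℂ) (M : Finset ℤ) (f : ℝ → ℂ),
      (ε = 1 ∨ ε = -1) → 0 < σ → 0 < lam → 1 ≤ lam * σ ^ 3 →
      (∀ k, ScaleAmplitude φ X Y A (scale σ k) ε (b k)) → Measurable f → MemLp f 2 volume →
      ∑ k ∈ Finset.range n, ∑ m ∈ M, ENNReal.ofReal (1 / scale σ k ^ 2) *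
        cellSup φ (b k) lam (cell lam σ k m) f ^ 3 ≤ ENNReal.ofReal K * ∫⁻ y, ‖f y‖ₑ ^ 3 := by
  obtain ⟨K, hK, hmain⟩ := exists_sup_square_le hφ hA
  have hc := hφ.c_pos
  refine ⟨8 * (6 * A / c * K), by positivity, ?_⟩
  intro ε σ lam n b M f hε hσ hlam h1 hb hfm hf
  -- The trivial bound for |f| ≤ t is a multiple of s t, so the weight s^{-2} times s matches the
  -- weight s^{-1} of the square estimate.
  have h := sum_cube_le_of_truncation (Finset.range n ×ˢ M)
    (fun i f => cellSup φ (b i.1) lam (cell lam σ i.1 i.2) f)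
    (fun i => ENNReal.ofReal (1 / scale σ i.1 ^ 2)) (fun i => 6 * A / c * scale σ i.1)
    (fun i _ => by have := scale_pos hσ i.1; positivity) (ENNReal.ofReal (6 * A / c * K)) hfm
    (fun i _ => (hb i.1).cellSup_ne_top hφ lam _ hf)
    (fun i _ t ht => by
      refine cellSup_le_iff.2 fun x hx => ?_
      rw [(hb i.1).oscOp_split hφ hfm hf lam t x]
      refine (enorm_add_le _ _).trans (add_le_add ?_ (cellSup_le_iff.1 le_rfl x hx))
      exact (hb i.1).enorm_oscOp_le_of_bounded hφ hε hA.le ht.le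
        (norm_lowPart_le ht.le) lam x)
    (fun t ht => by
      rw [Finset.sum_product]
      have h2 := hmain ε σ lam n b M (highPart f t) hε hσ hlam h1 hb (memLp_highPart hfm hf t)
      calc _ = ENNReal.ofReal (6 * A / c) * ∑ k ∈ Finset.range n, ∑ m ∈ M,
            ENNReal.ofReal (1 / scale σ k) *
              cellSup φ (b k) lam (cell lam σ k m) (highPart f t) ^ 2 := by
            simp only [Finset.mul_sum]
            refine Finset.sum_congr rfl fun k _ => Finset.sum_congr rfl fun m _ => ?_
            have := scale_pos hσ k
            rw [← ENNReal.ofReal_mul (by positivity), ← mul_assoc (ENNReal.ofReal (6 * A / c)),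
              ← ENNReal.ofReal_mul (by positivity)]
            congr 2; field_simp
        _ ≤ ENNReal.ofReal (6 * A / c) * (ENNReal.ofReal K * ∫⁻ y, ‖highPart f t y‖ₑ ^ 2) := by
            gcongr
        _ = _ := by rw [← mul_assoc, ← ENNReal.ofReal_mul (by positivity)])
  rw [Finset.sum_product] at h
  refine h.trans (le_of_eq ?_)
  rw [ENNReal.ofReal_mul (by norm_num : (0 : ℝ) ≤ 8)]; norm_num

theorem exists_piece_L2_le (hφ : FoldPhase φ X Y c C) (hA : 0 < A) : ∃ K : ℝ, 0 < K ∧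
    ∀ (ε σ lam : ℝ) (b : ℕ → ℝ × ℝ → ℂ) (f : ℝ → ℂ),
      (ε = 1 ∨ ε = -1) → 0 < σ → 0 < lam → 1 ≤ lam * σ ^ 3 →
      (∀ k, ScaleAmplitude φ X Y A (scale σ k) ε (b k)) → MemLp f 2 volume → ∀ k,
      ∫⁻ x, ‖oscOp φ (b k) lam f x‖ₑ ^ 2 ≤
        ENNReal.ofReal (K / (lam * scale σ k)) * ∫⁻ y, ‖f y‖ₑ ^ 2 := by
  obtain ⟨K, hK, hmain⟩ := exists_integral_square_le hφ hA
  refine ⟨K, hK, fun ε σ lam b f hε hσ hlam h1 hb hf k => ?_⟩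
  have h := hmain ε σ lam (k + 1) b f hε hσ hlam h1 hb hf
  have hs := scale_pos hσ k
  have h2 := (Finset.single_le_sum (f := fun k => ENNReal.ofReal (lam * scale σ k) *
        ∫⁻ x, ‖oscOp φ (b k) lam f x‖ₑ ^ 2) (fun _ _ => zero_le) (Finset.self_mem_range_succ k)).trans h
  have h0 : ENNReal.ofReal (lam * scale σ k) ≠ 0 := by
    rw [ne_eq, ENNReal.ofReal_eq_zero, not_le]; positivity
  rw [ENNReal.ofReal_div_of_pos (by positivity), ← ENNReal.mul_div_right_comm,
    ENNReal.le_div_iff_mul_le (Or.inl h0) (Or.inl ENNReal.ofReal_ne_top), mul_comm]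
  exact h2

theorem spacing_le_scale (hlam : 0 < lam) (hσ : 0 < σ) (h1 : 1 ≤ lam * σ ^ 3) {a k : ℕ}
    (hak : a ≤ k) : spacing lam σ a ≤ scale σ k := by
  have hs := scale_pos hσ a
  refine le_trans ?_ (scale_mono hσ hak)
  unfold spacing
  rw [div_le_iff₀ (by positivity)]
  have := one_le_lam_scale hlam hσ h1 a
  linarith

/-- Over a cell of length at most `s`, only an interval of length `O(s)` contributes. -/
theorem ScaleAmplitude.oscOp_eq_localized (hφ : FoldPhase φ X Y c C) (hε : ε = 1 ∨ ε = -1)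
    (hb : ScaleAmplitude φ X Y A s ε b) {I : Set ℝ}
    (hI : ∀ x ∈ I, ∀ x' ∈ I, |x - x'| ≤ s) : ∃ y0 : ℝ, ∀ (f : ℝ → ℂ) (lam : ℝ), ∀ x ∈ I,
      oscOp φ b lam f x =
        oscOp φ b lam (Set.indicator (Set.Icc (y0 - (3 + C) / c * s) (y0 + (3 + C) / c * s)) f) x := by
  have hc := hφ.c_pos
  have hC := hφ.one_le_C
  by_cases hne : ∃ x0 ∈ I, ∃ y0, b (x0, y0) ≠ 0
  · obtain ⟨x0, hx0, y0, hy0⟩ := hne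
    refine ⟨y0, fun f lam x hx => ?_⟩
    simp only [oscOp_eq]
    congr 1
    ext y
    by_cases h : b (x, y) = 0
    · simp [oscKernel, h]
    · rw [Set.indicator_of_mem]
      obtain ⟨hxX, hyY, y1, y2⟩ := hb.supp x y h
      obtain ⟨hx0X, hy0Y, z1, z2⟩ := hb.supp x0 y0 hy0
      have e1 := hφ.sep_y x hxX y hyY y0 hy0Y
      have e2 := hφ.lip_x x hxX x0 hx0X y0 hy0Y
      have e3 : |mixed φ (x, y) - mixed φ (x0, y0)| ≤ 3 * s := by
        rw [← abs_sub_sign hε, abs_le]; constructor <;> linarith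
      have e4 : |mixed φ (x, y) - mixed φ (x, y0)| ≤ 3 * s + C * s := by
        have t := abs_sub_le (mixed φ (x, y)) (mixed φ (x0, y0)) (mixed φ (x, y0))
        rw [abs_sub_comm (mixed φ (x0, y0))] at t
        have : C * |x - x0| ≤ C * s := by gcongr; exact hI x hx x0 hx0
        linarith
      have e5 : |y - y0| ≤ (3 + C) / c * s := by
        rw [div_mul_eq_mul_div, le_div_iff₀ hc]; linarith
      have := abs_le.1 e5
      constructor <;> linarith
  · push Not at hne
    refine ⟨0, fun f lam x hx => ?_⟩
    simp [oscOp_eq, oscKernel, hne x hx]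

theorem setLIntegral_sq_eq_eLpNorm (I : Set ℝ) (f : ℝ → ℂ) :
    eLpNorm f 2 (volume.restrict I) ^ 2 = ∫⁻ y in I, ‖f y‖ₑ ^ 2 := by
  have := eLpNorm_nnreal_pow_eq_lintegral (f := f) (μ := volume.restrict I) (p := 2) (by norm_num)
  simpa using this

theorem sum_setLIntegral_cell_le (hlam : 0 < lam) (hσ : 0 < σ) (k : ℕ) (M : Finset ℤ)
    (g : ℝ → ℝ≥0∞) : ∑ m ∈ M, ∫⁻ x in cell lam σ k m, g x ≤ ∫⁻ x, g x := by
  rw [← lintegral_biUnion_finset (pairwise_disjoint_cell hlam hσ k M)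
    (fun m _ => measurableSet_Ico)]
  exact setLIntegral_le_lintegral _ _

/-- `L³` estimate, with a gain in the number `d` of dyadic steps, for the local `L²` norms of the
piece at scale `a + d` over the cells at the smaller scale `a`. -/
theorem exists_local_cube_le (hφ : FoldPhase φ X Y c C) (hA : 0 < A) : ∃ K : ℝ, 0 < K ∧
    ∀ (ε σ lam : ℝ) (n d : ℕ) (b : ℕ → ℝ × ℝ → ℂ) (M : Finset ℤ) (f : ℝ → ℂ),
      (ε = 1 ∨ ε = -1) → 0 < σ → 0 < lam → 1 ≤ lam * σ ^ 3 →
      (∀ k, ScaleAmplitude φ X Y A (scale σ k) ε (b k)) → Measurable f → MemLp f 2 volume →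
      ∑ a ∈ Finset.range n, ∑ m ∈ M, ENNReal.ofReal (√lam ^ 3 * scale σ (a + d)) *
        eLpNorm (oscOp φ (b (a + d)) lam f) 2 (volume.restrict (cell lam σ a m)) ^ 3 ≤
        ENNReal.ofReal K * ∫⁻ y, ‖f y‖ₑ ^ 3 := by
  obtain ⟨K, hK, hmain⟩ := exists_integral_square_le hφ hA
  obtain ⟨K', hK', hpiece⟩ := exists_piece_L2_le hφ hA
  have hc := hφ.c_pos
  have hC := hφ.one_le_C
  set B₀ : ℝ := √(K' * (2 * ((3 + C) / c))) with hB₀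
  have hB₀0 : 0 < B₀ := Real.sqrt_pos.2 (by positivity)
  refine ⟨8 * (B₀ * K), by positivity, ?_⟩
  intro ε σ lam n d b M f hε hσ hlam h1 hb hfm hf
  have hsl : 0 < √lam := Real.sqrt_pos.2 hlam
  have hsl2 : √lam ^ 2 = lam := Real.sq_sqrt hlam.le
  have hmeas : ∀ k (g : ℝ → ℂ), MemLp g 2 volume → Measurable (oscOp φ (b k) lam g) := fun k g hg =>
    measurable_oscOp hφ.smooth.continuous (hb k).cont hg.1 lam
  -- The uniform constant B₀/√λ does not depend on the scale, and its product with the weight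
  -- λ^{3/2}s is B₀ λ s, the weight of the integrated square estimate.
  have h := sum_cube_le_of_truncation (Finset.range n ×ˢ M)
    (fun i f => eLpNorm (oscOp φ (b (i.1 + d)) lam f) 2 (volume.restrict (cell lam σ i.1 i.2)))
    (fun i => ENNReal.ofReal (√lam ^ 3 * scale σ (i.1 + d))) (fun _ => B₀ / √lam)
    (fun i _ => by positivity) (ENNReal.ofReal (B₀ * K)) hfm
    (fun i _ => by
      refine ne_top_of_le_ne_top ?_ (eLpNorm_mono_measure _ Measure.restrict_le_self)
      intro htop
      have h2 := hpiece ε σ lam b f hε hσ hlam h1 hb hf (i.1 + d)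
      rw [← eLpNorm_two_sq, ← eLpNorm_two_sq, htop] at h2
      have h3 : ENNReal.ofReal (K' / (lam * scale σ (i.1 + d))) * eLpNorm f 2 volume ^ 2 < ⊤ :=
        ENNReal.mul_lt_top ENNReal.ofReal_lt_top (ENNReal.pow_lt_top hf.2)
      simp only [ne_eq, OfNat.ofNat_ne_zero, not_false_eq_true, ENNReal.top_pow, top_le_iff] at h2
      exact h3.ne h2)
    (fun i _ t ht => by
      have hs := scale_pos hσ (i.1 + d)
      have hsplit : oscOp φ (b (i.1 + d)) lam f = oscOp φ (b (i.1 + d)) lam (lowPart f t) +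
          oscOp φ (b (i.1 + d)) lam (highPart f t) :=
        funext fun x => (hb (i.1 + d)).oscOp_split hφ hfm hf lam t x
      conv_lhs => rw [hsplit]
      refine (eLpNorm_add_le (hmeas _ _ (memLp_lowPart hfm hf t)).aestronglyMeasurable
        (hmeas _ _ (memLp_highPart hfm hf t)).aestronglyMeasurable one_le_two).trans
        (add_le_add_left ?_ _)
      -- The cell is no longer than s, so only an interval J of length O(s) in y is seen. Then ‖1_J
      -- f‖₂² ≲ s t², and the L² bound contributes 1/(λ s), so s cancels.
      have hpow : eLpNorm (oscOp φ (b (i.1 + d)) lam (lowPart f t)) 2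
          (volume.restrict (cell lam σ i.1 i.2)) ^ 2 ≤ ENNReal.ofReal (B₀ / √lam * t) ^ 2 := by
        rw [setLIntegral_sq_eq_eLpNorm]
        obtain ⟨y0, hy0⟩ := (hb (i.1 + d)).oscOp_eq_localized hφ hε (I := cell lam σ i.1 i.2)
          (fun x hx x' hx' => by
            obtain ⟨x1, x2⟩ := hx
            obtain ⟨z1, z2⟩ := hx'
            have := spacing_le_scale hlam hσ h1 (Nat.le_add_right i.1 d)
            rw [abs_le]; constructor <;> linarith)
        set J := Set.Icc (y0 - (3 + C) / c * scale σ (i.1 + d)) (y0 + (3 + C) / c * scale σ (i.1 + d))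
        have hJ : MemLp (Set.indicator J (lowPart f t)) 2 volume :=
          (memLp_lowPart hfm hf t).indicator measurableSet_Icc
        calc ∫⁻ x in cell lam σ i.1 i.2, ‖oscOp φ (b (i.1 + d)) lam (lowPart f t) x‖ₑ ^ 2
            = ∫⁻ x in cell lam σ i.1 i.2,
              ‖oscOp φ (b (i.1 + d)) lam (Set.indicator J (lowPart f t)) x‖ₑ ^ 2 :=
              setLIntegral_congr_fun measurableSet_Ico fun x hx => by
                rw [hy0 _ _ x hx]
          _ ≤ ∫⁻ x, ‖oscOp φ (b (i.1 + d)) lam (Set.indicator J (lowPart f t)) x‖ₑ ^ 2 :=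
              setLIntegral_le_lintegral _ _
          _ ≤ ENNReal.ofReal (K' / (lam * scale σ (i.1 + d))) *
              ∫⁻ y, ‖Set.indicator J (lowPart f t) y‖ₑ ^ 2 :=
              hpiece ε σ lam b _ hε hσ hlam h1 hb hJ _
          _ ≤ ENNReal.ofReal (K' / (lam * scale σ (i.1 + d))) *
              ∫⁻ y, Set.indicator J (fun _ => ENNReal.ofReal (t ^ 2)) y := by
              gcongr with y
              by_cases hy : y ∈ J
              · rw [Set.indicator_of_mem hy, Set.indicator_of_mem hy, ENNReal.ofReal_pow ht.le,
                  ← ofReal_norm]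
                gcongr
                exact norm_lowPart_le ht.le y
              · simp [hy]
          _ = ENNReal.ofReal (B₀ / √lam * t) ^ 2 := by
              rw [lintegral_indicator measurableSet_Icc, setLIntegral_const, Real.volume_Icc,
                ← ENNReal.ofReal_mul (by positivity), ← ENNReal.ofReal_mul (by positivity),
                ← ENNReal.ofReal_pow (by positivity)]
              congr 1
              rw [mul_pow, div_pow, hsl2, hB₀, Real.sq_sqrt (by positivity)]
              field_simp; ring
      exact (ENNReal.pow_le_pow_left_iff two_ne_zero).1 hpow)
    (fun t ht => by
      rw [Finset.sum_product]
      have hg := memLp_highPart hfm hf t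
      -- The scales a + d with a < n form a subfamily of the first d + n scales, and for each one
      -- the cells are disjoint; hence the constant is independent of d.
      have h2 := hmain ε σ lam (d + n) b (highPart f t) hε hσ hlam h1 hb hg
      calc _ = ENNReal.ofReal B₀ * ∑ a ∈ Finset.range n, ENNReal.ofReal (lam * scale σ (d + a)) *
            ∑ m ∈ M, ∫⁻ x in cell lam σ a m, ‖oscOp φ (b (d + a)) lam (highPart f t) x‖ₑ ^ 2 := by
            simp only [Finset.mul_sum]
            refine Finset.sum_congr rfl fun k _ => Finset.sum_congr rfl fun m _ => ?_
            have := scale_pos hσ (d + k)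
            rw [add_comm k d, setLIntegral_sq_eq_eLpNorm, ← ENNReal.ofReal_mul (by positivity),
              ← mul_assoc, ← ENNReal.ofReal_mul (by positivity)]
            congr 2
            rw [← hsl2]; field_simp
            rw [Real.sqrt_sq hsl.le]
        _ ≤ ENNReal.ofReal B₀ * ∑ a ∈ Finset.range n, ENNReal.ofReal (lam * scale σ (d + a)) *
            ∫⁻ x, ‖oscOp φ (b (d + a)) lam (highPart f t) x‖ₑ ^ 2 := by
            gcongr with a _
            exact sum_setLIntegral_cell_le hlam hσ a M _
        _ ≤ ENNReal.ofReal B₀ * ∑ k ∈ Finset.range (d + n), ENNReal.ofReal (lam * scale σ k) *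
            ∫⁻ x, ‖oscOp φ (b k) lam (highPart f t) x‖ₑ ^ 2 := by
            rw [Finset.sum_range_add]
            gcongr
            exact le_add_self
        _ ≤ ENNReal.ofReal B₀ * (ENNReal.ofReal K * ∫⁻ y, ‖highPart f t y‖ₑ ^ 2) := by gcongr
        _ = _ := by rw [← mul_assoc, ← ENNReal.ofReal_mul (by positivity)])
  rw [Finset.sum_product] at h
  refine h.trans (le_of_eq ?_)
  rw [ENNReal.ofReal_mul (by norm_num : (0 : ℝ) ≤ 8)]; norm_num

/-- A crude weighted arithmetic–geometric inequality: a product of three terms is at most the cube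
of their sum, so cubing both sides avoids fractional powers. -/
theorem mul_three_le_weighted_cubes {p q r : ℝ} (hp : 0 ≤ p) (hq : 0 ≤ q)
    (h : 1 ≤ p * q * r) (x y z : ℝ≥0∞) :
    x * y * z ≤ ENNReal.ofReal p * x ^ 3 + ENNReal.ofReal q * y ^ 3 + ENNReal.ofReal r * z ^ 3 := by
  set P := ENNReal.ofReal p * x ^ 3
  set Q := ENNReal.ofReal q * y ^ 3
  set R := ENNReal.ofReal r * z ^ 3
  have h1 : (x * y * z) ^ 3 ≤ P * Q * R := by
    have e : P * Q * R = ENNReal.ofReal (p * q * r) * (x * y * z) ^ 3 := by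
      rw [ENNReal.ofReal_mul (by positivity), ENNReal.ofReal_mul hp]
      ring
    rw [e]
    calc (x * y * z) ^ 3 = 1 * (x * y * z) ^ 3 := (one_mul _).symm
      _ ≤ _ := by gcongr; exact ENNReal.one_le_ofReal.2 h
  have h2 : P * Q * R ≤ (P + Q + R) ^ 3 := by
    calc P * Q * R ≤ (P + Q + R) * (P + Q + R) * (P + Q + R) := by
          gcongr
          · rw [add_assoc]; exact le_self_add
          · rw [add_right_comm]; exact le_add_self
          · exact le_add_self
      _ = _ := by ring
  exact (ENNReal.pow_le_pow_left_iff three_ne_zero).1 (h1.trans h2)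

theorem sum_range_filter_le_shift (n a : ℕ) (G : ℕ → ℝ≥0∞) :
    ∑ b ∈ Finset.range n with a ≤ b, G b ≤ ∑ d ∈ Finset.range n, G (a + d) := by
  have h : (Finset.range n).filter (fun b => a ≤ b) ⊆ (Finset.range n).image (fun d => a + d) := by
    intro k hk
    obtain ⟨h1, h2⟩ := Finset.mem_filter.1 hk
    exact Finset.mem_image.2 ⟨k - a, Finset.mem_range.2 (by have := Finset.mem_range.1 h1; omega),
      by omega⟩
  refine (Finset.sum_le_sum_of_subset h).trans (le_of_eq ?_)
  exact Finset.sum_image fun x _ y _ hxy => by simpa using hxy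

theorem sum_sum_geometric_le (n : ℕ) :
    ∑ d ∈ Finset.range n, ∑ e ∈ Finset.range n, (4 / 5 : ℝ) ^ (d + e) ≤ 25 := by
  have h := (summable_geometric_of_lt_one (by norm_num : (0 : ℝ) ≤ 4 / 5) (by norm_num)).sum_le_tsum
    (Finset.range n) (fun l _ => by positivity)
  rw [tsum_geometric_of_lt_one (by norm_num) (by norm_num)] at h
  have h0 : 0 ≤ ∑ d ∈ Finset.range n, (4 / 5 : ℝ) ^ d := Finset.sum_nonneg fun _ _ => by positivity
  calc ∑ d ∈ Finset.range n, ∑ e ∈ Finset.range n, (4 / 5 : ℝ) ^ (d + e)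
      = (∑ d ∈ Finset.range n, (4 / 5 : ℝ) ^ d) * ∑ d ∈ Finset.range n, (4 / 5 : ℝ) ^ d := by
        rw [Finset.sum_mul_sum]
        simp only [pow_add]
    _ ≤ 5 * 5 := by gcongr <;> (refine h.trans ?_; norm_num)
    _ = 25 := by norm_num

theorem setLIntegral_mul_le_eLpNorm (I : Set ℝ) {f g : ℝ → ℂ} (hf : Measurable f)
    (hg : Measurable g) : ∫⁻ x in I, ‖f x‖ₑ * ‖g x‖ₑ ≤
      eLpNorm f 2 (volume.restrict I) * eLpNorm g 2 (volume.restrict I) := by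
  have := eLpNorm_smul_le_mul_eLpNorm (p := 2) (q := 2) (r := 1) (μ := volume.restrict I)
    hg.aestronglyMeasurable hf.aestronglyMeasurable
  rw [eLpNorm_one_eq_lintegral_enorm] at this
  simpa [enorm_mul] using this

/-- Endpoint `L³` bound for a sum of dyadic pieces at scales at least `σ ≥ lam^{-1/3}`. -/
theorem exists_dyadic_sum_L3_le (hφ : FoldPhase φ X Y c C) (hA : 0 < A) : ∃ K : ℝ, 0 < K ∧
    ∀ (ε σ lam : ℝ) (n : ℕ) (b : ℕ → ℝ × ℝ → ℂ) (f : ℝ → ℂ),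
      (ε = 1 ∨ ε = -1) → 0 < σ → 0 < lam → 1 ≤ lam * σ ^ 3 →
      (∀ k, ScaleAmplitude φ X Y A (scale σ k) ε (b k)) → Measurable f → MemLp f 2 volume →
      ∫⁻ x, ‖∑ k ∈ Finset.range n, oscOp φ (b k) lam f x‖ₑ ^ 3 ≤
        ENNReal.ofReal (K / lam) * ∫⁻ y, ‖f y‖ₑ ^ 3 := by
  obtain ⟨K₁, hK₁, hsup⟩ := exists_sup_cube_le hφ hA
  obtain ⟨K₂, hK₂, hloc⟩ := exists_local_cube_le hφ hA
  refine ⟨75 * (K₁ + 2 * K₂), by positivity, ?_⟩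
  intro ε σ lam n b f hε hσ hlam h1 hb hfm hf
  have hsl : 0 < √lam := Real.sqrt_pos.2 hlam
  have hsl2 : √lam ^ 2 = lam := Real.sq_sqrt hlam.le
  obtain ⟨M, hM⟩ := exists_cell_cover hφ.compactX hlam hσ n
  have hT : ∀ k, Measurable (oscOp φ (b k) lam f) := fun k =>
    measurable_oscOp hφ.smooth.continuous (hb k).cont hf.1 lam
  set F : ℕ → ℝ → ℝ≥0∞ := fun k x => ‖oscOp φ (b k) lam f x‖ₑ with hF
  have hFm : ∀ k, Measurable (F k) := fun k => (hT k).enorm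
  set Z := ∫⁻ y, ‖f y‖ₑ ^ 3 with hZ
  have htri : ∀ d e : ℕ, ∑ a ∈ Finset.range n, ∫⁻ x, F (a + d) x * F (a + e) x * F a x ≤
      ENNReal.ofReal ((4 / 5 : ℝ) ^ (d + e)) * (ENNReal.ofReal ((K₁ + 2 * K₂) / lam) * Z) := by
    intro d e
    -- The product of the three cubic weights is λ³2^{d+e}, so any ratio at least 2^{-1/3} is
    -- admissible; 4/5 works because (4/5)³·2 = 1.024, and its geometric series converges.
    set τ : ℝ := (4 / 5 : ℝ) ^ (d + e) / lam with hτ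
    have hτ0 : 0 < τ := by positivity
    set V : ℕ → ℕ → ℤ → ℝ≥0∞ := fun d a m =>
      eLpNorm (oscOp φ (b (a + d)) lam f) 2 (volume.restrict (cell lam σ a m)) with hV
    set U : ℕ → ℤ → ℝ≥0∞ := fun a m => cellSup φ (b a) lam (cell lam σ a m) f with hU
    -- On each cell at the finest scale a: the supremum for the piece a, Cauchy–Schwarz for the
    -- other two, then the weighted product inequality.
    have hstep : ∀ a ∈ Finset.range n, ∫⁻ x, F (a + d) x * F (a + e) x * F a x ≤
        ∑ m ∈ M, (ENNReal.ofReal τ * (ENNReal.ofReal (1 / scale σ a ^ 2) * U a m ^ 3) +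
          ENNReal.ofReal τ * (ENNReal.ofReal (√lam ^ 3 * scale σ (a + d)) * V d a m ^ 3) +
          ENNReal.ofReal τ * (ENNReal.ofReal (√lam ^ 3 * scale σ (a + e)) * V e a m ^ 3)) := by
      intro a ha
      rw [lintegral_eq_sum_cell hlam hσ a (hM a (Finset.mem_range.1 ha)) (fun x hx => by
        simp only [hF]
        rw [oscOp_eq_zero (fun x y h => ((hb a).supp x y h).1) hx]; simp)]
      refine Finset.sum_le_sum fun m _ => ?_
      have hsa := scale_pos hσ a
      have hsd := scale_pos hσ (a + d)
      have hse := scale_pos hσ (a + e)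
      calc ∫⁻ x in cell lam σ a m, F (a + d) x * F (a + e) x * F a x
          ≤ ∫⁻ x in cell lam σ a m, F (a + d) x * F (a + e) x * U a m := by
            refine setLIntegral_mono' measurableSet_Ico fun x hx => ?_
            gcongr
            exact cellSup_le_iff.1 le_rfl x hx
        _ = (∫⁻ x in cell lam σ a m, F (a + d) x * F (a + e) x) * U a m := by
            rw [lintegral_mul_const' _ _ ((hb a).cellSup_ne_top hφ lam _ hf)]
        _ ≤ (V d a m * V e a m) * U a m := by
            gcongr
            exact setLIntegral_mul_le_eLpNorm _ (hT _) (hT _)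
        _ = U a m * V d a m * V e a m := by ring
        _ ≤ _ := by
            refine (mul_three_le_weighted_cubes (p := τ * (1 / scale σ a ^ 2))
              (q := τ * (√lam ^ 3 * scale σ (a + d))) (r := τ * (√lam ^ 3 * scale σ (a + e)))
              (by positivity) (by positivity) ?_ _ _ _).trans (le_of_eq ?_)
            · have e1 : τ * (1 / scale σ a ^ 2) * (τ * (√lam ^ 3 * scale σ (a + d))) *
                  (τ * (√lam ^ 3 * scale σ (a + e))) = ((4 / 5) ^ 3 * 2 : ℝ) ^ (d + e) := by
                have e2 : √lam ^ 3 * √lam ^ 3 = lam ^ 3 := by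
                  calc √lam ^ 3 * √lam ^ 3 = (√lam ^ 2) ^ 3 := by ring
                    _ = _ := by rw [hsl2]
                have e3 : scale σ (a + d) = scale σ a * 2 ^ d := by unfold scale; rw [pow_add]; ring
                have e4 : scale σ (a + e) = scale σ a * 2 ^ e := by unfold scale; rw [pow_add]; ring
                calc _ = τ ^ 3 * (√lam ^ 3 * √lam ^ 3) *
                      (scale σ (a + d) * scale σ (a + e) / scale σ a ^ 2) := by ring
                  _ = τ ^ 3 * lam ^ 3 * 2 ^ (d + e) := by
                      rw [e2, e3, e4, pow_add]; field_simp
                  _ = _ := by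
                      rw [hτ, mul_pow, ← pow_mul, mul_comm 3, pow_mul]; field_simp
              rw [e1]
              exact one_le_pow₀ (by norm_num)
            · simp only [ENNReal.ofReal_mul hτ0.le, mul_assoc]
    refine (Finset.sum_le_sum hstep).trans ?_
    simp only [Finset.sum_add_distrib, ← Finset.mul_sum]
    have s1 := hsup ε σ lam n b M f hε hσ hlam h1 hb hfm hf
    have s2 := hloc ε σ lam n d b M f hε hσ hlam h1 hb hfm hf
    have s3 := hloc ε σ lam n e b M f hε hσ hlam h1 hb hfm hf
    simp only [← Finset.mul_sum] at s1 s2 s3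
    calc _ ≤ ENNReal.ofReal τ * (ENNReal.ofReal K₁ * Z) + ENNReal.ofReal τ * (ENNReal.ofReal K₂ * Z) +
          ENNReal.ofReal τ * (ENNReal.ofReal K₂ * Z) := by gcongr
      _ = _ := by
          have e1 : ENNReal.ofReal ((K₁ + 2 * K₂) / lam) =
              ENNReal.ofReal (1 / lam) * (ENNReal.ofReal K₁ + 2 * ENNReal.ofReal K₂) := by
            have : (2 : ℝ≥0∞) = ENNReal.ofReal 2 := by simp
            rw [this, ← ENNReal.ofReal_mul (by norm_num), ← ENNReal.ofReal_add (by positivity)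
              (by positivity), ← ENNReal.ofReal_mul (by positivity)]
            congr 1; ring
          have e2 : ENNReal.ofReal τ = ENNReal.ofReal ((4 / 5 : ℝ) ^ (d + e)) *
              ENNReal.ofReal (1 / lam) := by
            rw [← ENNReal.ofReal_mul (by positivity)]; congr 1; rw [hτ]; ring
          rw [e1, e2]; ring
  calc ∫⁻ x, ‖∑ k ∈ Finset.range n, oscOp φ (b k) lam f x‖ₑ ^ 3
      ≤ ∫⁻ x, 3 * ∑ d ∈ Finset.range n, ∑ e ∈ Finset.range n, ∑ a ∈ Finset.range n,
        F (a + d) x * F (a + e) x * F a x := by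
        refine lintegral_mono fun x => ?_
        calc ‖∑ k ∈ Finset.range n, oscOp φ (b k) lam f x‖ₑ ^ 3
            ≤ (∑ k ∈ Finset.range n, F k x) ^ 3 := by
              gcongr; exact enorm_sum_le _ _
          _ ≤ 3 * ∑ a ∈ Finset.range n, (∑ b ∈ Finset.range n with a ≤ b, F b x) *
              (∑ c ∈ Finset.range n with a ≤ c, F c x) * F a x := sum_pow_three_le n fun k => F k x
          _ ≤ 3 * ∑ a ∈ Finset.range n, (∑ d ∈ Finset.range n, F (a + d) x) *
              (∑ e ∈ Finset.range n, F (a + e) x) * F a x := by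
              gcongr with a _
              · exact sum_range_filter_le_shift n a fun k => F k x
              · exact sum_range_filter_le_shift n a fun k => F k x
          _ = _ := by
              congr 1
              simp only [Finset.sum_mul]
              rw [Finset.sum_comm]
              refine Finset.sum_congr rfl fun d _ => ?_
              rw [Finset.sum_comm]
              refine Finset.sum_congr rfl fun a _ => ?_
              rw [Finset.mul_sum, Finset.sum_mul]
    _ = 3 * ∑ d ∈ Finset.range n, ∑ e ∈ Finset.range n, ∑ a ∈ Finset.range n,
        ∫⁻ x, F (a + d) x * F (a + e) x * F a x := by
        have hm3 : ∀ a d e, Measurable fun x => F (a + d) x * F (a + e) x * F a x := fun a d e =>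
          ((hFm _).mul (hFm _)).mul (hFm _)
        rw [lintegral_const_mul' _ _ (by norm_num)]
        congr 1
        rw [lintegral_finsetSum _ fun d _ => Finset.measurable_sum _ fun e _ =>
          Finset.measurable_sum _ fun a _ => hm3 a d e]
        refine Finset.sum_congr rfl fun d _ => ?_
        rw [lintegral_finsetSum _ fun e _ => Finset.measurable_sum _ fun a _ => hm3 a d e]
        refine Finset.sum_congr rfl fun e _ => ?_
        rw [lintegral_finsetSum _ fun a _ => hm3 a d e]
    _ ≤ 3 * ∑ d ∈ Finset.range n, ∑ e ∈ Finset.range n,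
        ENNReal.ofReal ((4 / 5 : ℝ) ^ (d + e)) * (ENNReal.ofReal ((K₁ + 2 * K₂) / lam) * Z) := by
        gcongr with d _ e _; exact htri d e
    _ = 3 * (ENNReal.ofReal (∑ d ∈ Finset.range n, ∑ e ∈ Finset.range n, (4 / 5 : ℝ) ^ (d + e)) *
        (ENNReal.ofReal ((K₁ + 2 * K₂) / lam) * Z)) := by
        rw [ENNReal.ofReal_sum_of_nonneg (fun d _ => Finset.sum_nonneg fun e _ => by positivity),
          Finset.sum_mul]
        congr 1
        refine Finset.sum_congr rfl fun d _ => ?_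
        rw [ENNReal.ofReal_sum_of_nonneg (fun e _ => by positivity), Finset.sum_mul]
    _ ≤ 3 * (ENNReal.ofReal 25 * (ENNReal.ofReal ((K₁ + 2 * K₂) / lam) * Z)) := by
        gcongr; exact sum_sum_geometric_le n
    _ = _ := by
        have h3 : (3 : ℝ≥0∞) = ENNReal.ofReal 3 := by simp
        rw [h3, ← mul_assoc, ← mul_assoc, ← ENNReal.ofReal_mul (by norm_num),
          ← ENNReal.ofReal_mul (by norm_num)]
        congr 2; ring

end Cubic

/-! ### Fold condition from non-vanishing derivatives, and dyadic amplitudes. -/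

section Cutoffs

theorem exists_mean_value {g g' : ℝ → ℝ} (hg : ∀ t, HasDerivAt g (g' t) t) (a b : ℝ) :
    ∃ ξ ∈ Set.uIcc a b, g b - g a = g' ξ * (b - a) := by
  have key : ∀ a b : ℝ, a < b → ∃ ξ ∈ Set.Icc a b, g b - g a = g' ξ * (b - a) := by
    intro a b hab
    obtain ⟨ξ, hξ, h⟩ := exists_hasDerivAt_eq_slope g g' hab
      (fun t _ => (hg t).continuousAt.continuousWithinAt) (fun t _ => hg t)
    refine ⟨ξ, Set.Ioo_subset_Icc_self hξ, ?_⟩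
    rw [h, div_mul_cancel₀]
    linarith
  rcases lt_trichotomy a b with h | h | h
  · rw [Set.uIcc_of_le h.le]; exact key a b h
  · subst h; exact ⟨a, Set.left_mem_uIcc, by simp⟩
  · obtain ⟨ξ, hξ, e⟩ := key b a h
    rw [Set.uIcc_of_ge h.le]
    exact ⟨ξ, hξ, by linarith⟩

theorem IsCompact.exists_abs_bound {S : Set (ℝ × ℝ)} (hS : IsCompact S) {g : ℝ × ℝ → ℝ}
    (hg : Continuous g) : ∃ B : ℝ, 1 ≤ B ∧ ∀ p ∈ S, |g p| ≤ B := by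
  obtain ⟨B, hB⟩ := hS.exists_bound_of_continuousOn hg.continuousOn
  exact ⟨max B 1, le_max_right _ _, fun p hp => (hB p hp).trans (le_max_left _ _)⟩

theorem IsCompact.exists_abs_lower_bound {S : Set (ℝ × ℝ)} (hS : IsCompact S) {g : ℝ × ℝ → ℝ}
    (hg : Continuous g) (h0 : ∀ p ∈ S, g p ≠ 0) : ∃ B : ℝ, 0 < B ∧ ∀ p ∈ S, B ≤ |g p| := by
  obtain ⟨B, hB⟩ := hS.exists_bound_of_continuousOn (f := fun p => (g p)⁻¹)
    (hg.continuousOn.inv₀ h0)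
  refine ⟨(max B 1)⁻¹, by positivity, fun p hp => ?_⟩
  have h1 := (hB p hp).trans (le_max_left B 1)
  rw [norm_inv, Real.norm_eq_abs] at h1
  exact inv_le_of_inv_le₀ (abs_pos.2 (h0 p hp)) h1

/-- Bi-Lipschitz bounds follow from the mean value theorem, X and Y being intervals. For
`phase_lower`, φ_y(x) - φ_y(x') is the integral of u = φ_{xy}, which is strictly monotone and keeps
its sign between the endpoints; comparing φ_y with u², whose derivative is 2u u_x, bounds it below
by the endpoint values. -/
theorem exists_foldPhase {φ : ℝ × ℝ → ℝ} (hφ : ContDiff ℝ ∞ φ) {X Y : Set ℝ} (hX : IsCompact X)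
    (hY : IsCompact Y) (hXo : X.OrdConnected) (hYo : Y.OrdConnected)
    (hx : ∀ p ∈ X ×ˢ Y, partialX (mixed φ) p ≠ 0) (hy : ∀ p ∈ X ×ˢ Y, partialY (mixed φ) p ≠ 0) :
    ∃ c C, FoldPhase φ X Y c C := by
  have hS := hX.prod hY
  have sP := contDiff_partialY hφ
  have sPy := contDiff_partialY sP
  have sPyy := contDiff_partialY sPy
  have su : ContDiff ℝ ∞ (mixed φ) := contDiff_partialY (contDiff_partialX hφ)
  obtain ⟨c₁, hc₁, hlow₁⟩ := hS.exists_abs_lower_bound (contDiff_partialX su).continuous hx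
  obtain ⟨c₂, hc₂, hlow₂⟩ := hS.exists_abs_lower_bound (contDiff_partialY su).continuous hy
  obtain ⟨B₁, hB₁, hup₁⟩ := hS.exists_abs_bound su.continuous
  obtain ⟨B₂, hB₂, hup₂⟩ := hS.exists_abs_bound (contDiff_partialX su).continuous
  obtain ⟨B₃, hB₃, hup₃⟩ := hS.exists_abs_bound (contDiff_partialX sPy).continuous
  obtain ⟨B₄, hB₄, hup₄⟩ := hS.exists_abs_bound (contDiff_partialX sPyy).continuous
  have hB₂0 : 0 < B₂ := by linarith
  set c := min (min (c₁ / (2 * B₂)) c₂) (min c₁ 1) with hcdef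
  set C := max (max B₁ B₂) (max B₃ B₄) with hCdef
  have hc0 : 0 < c := by
    simp only [hcdef, lt_min_iff]
    exact ⟨⟨by positivity, hc₂⟩, hc₁, one_pos⟩
  have hcA : c ≤ c₁ / (2 * B₂) := (min_le_left _ _).trans (min_le_left _ _)
  have hcB : c ≤ c₂ := (min_le_left _ _).trans (min_le_right _ _)
  have hcC : c ≤ c₁ := (min_le_right _ _).trans (min_le_left _ _)
  have hC1 : B₁ ≤ C := (le_max_left _ _).trans (le_max_left _ _)
  have hC2 : B₂ ≤ C := (le_max_right _ _).trans (le_max_left _ _)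
  have hC3 : B₃ ≤ C := (le_max_left _ _).trans (le_max_right _ _)
  have hC4 : B₄ ≤ C := (le_max_right _ _).trans (le_max_right _ _)
  have hmemx : ∀ x ∈ X, ∀ x' ∈ X, ∀ y ∈ Y, ∀ ξ ∈ Set.uIcc x x', (ξ, y) ∈ X ×ˢ Y :=
    fun x hx x' hx' y hy ξ hξ => ⟨hXo.uIcc_subset hx hx' hξ, hy⟩
  have lipx : ∀ {g : ℝ × ℝ → ℝ} {B : ℝ}, ContDiff ℝ ∞ g → (∀ p ∈ X ×ˢ Y, |partialX g p| ≤ B) →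
      B ≤ C → ∀ x ∈ X, ∀ x' ∈ X, ∀ y ∈ Y, |g (x, y) - g (x', y)| ≤ C * |x - x'| := by
    intro g B hg hb hBC x hx x' hx' y hy
    obtain ⟨ξ, hξ, e⟩ := exists_mean_value (fun t => hasDerivAt_partialX hg t y) x' x
    rw [e, abs_mul]
    exact mul_le_mul_of_nonneg_right
      ((hb _ (hmemx x' hx' x hx y hy ξ hξ)).trans hBC) (abs_nonneg _)
  have sepx : ∀ x ∈ X, ∀ x' ∈ X, ∀ y ∈ Y,
      c₁ * |x - x'| ≤ |mixed φ (x, y) - mixed φ (x', y)| := by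
    intro x hx x' hx' y hy
    obtain ⟨ξ, hξ, e⟩ := exists_mean_value (fun t => hasDerivAt_partialX su t y) x' x
    rw [e, abs_mul]
    exact mul_le_mul_of_nonneg_right (hlow₁ _ (hmemx x' hx' x hx y hy ξ hξ)) (abs_nonneg _)
  have phase : ∀ x ∈ X, ∀ x' ∈ X, ∀ y ∈ Y, x < x' → 0 < mixed φ (x, y) * mixed φ (x', y) →
      c * (|mixed φ (x, y)| + |mixed φ (x', y)|) * |x - x'| ≤
        |partialY φ (x, y) - partialY φ (x', y)| := by
    intro x hx x' hx' y hy hxx hpos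
    have dP : ∀ t, HasDerivAt (fun t => partialY φ (t, y)) (mixed φ (t, y)) t := fun t => by
      have := hasDerivAt_partialX sP t y
      rwa [partialX_partialY_comm hφ] at this
    have du : ∀ t, HasDerivAt (fun t => mixed φ (t, y)) (partialX (mixed φ) (t, y)) t := fun t =>
      hasDerivAt_partialX su t y
    -- Cauchy's mean value theorem for the pair φ_y and u². The common factor u(ξ) must then be
    -- cancelled.
    obtain ⟨ξ, hξ, e⟩ := exists_ratio_hasDerivAt_eq_ratio_slope (fun t => partialY φ (t, y))
      (fun t => mixed φ (t, y)) hxx (fun t _ => (dP t).continuousAt.continuousWithinAt)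
      (fun t _ => dP t) (fun t => mixed φ (t, y) ^ 2) _
      (fun t _ => ((du t).pow 2).continuousAt.continuousWithinAt) (fun t _ => (du t).pow 2)
    have hξ' : ξ ∈ Set.uIcc x x' := by
      rw [Set.uIcc_of_le hxx.le]; exact Set.Ioo_subset_Icc_self hξ
    have hξX : ξ ∈ X := hXo.uIcc_subset hx hx' hξ'
    -- A zero of u between endpoints where u has one sign would make u_x take both signs, hence
    -- vanish by the intermediate value theorem, against its lower bound.
    have hne : mixed φ (ξ, y) ≠ 0 := by
      intro h0
      obtain ⟨η₁, hη₁, e₁⟩ := exists_mean_value du x ξ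
      obtain ⟨η₂, hη₂, e₂⟩ := exists_mean_value du ξ x'
      rw [h0] at e₁ e₂
      have hneg : partialX (mixed φ) (η₁, y) * partialX (mixed φ) (η₂, y) < 0 := by
        have h1 : 0 < ξ - x := by linarith [hξ.1]
        have h2 : 0 < x' - ξ := by linarith [hξ.2]
        have h3 : mixed φ (x, y) * mixed φ (x', y) = -(partialX (mixed φ) (η₁, y) *
            partialX (mixed φ) (η₂, y)) * ((ξ - x) * (x' - ξ)) := by
          have : mixed φ (x, y) = -(partialX (mixed φ) (η₁, y) * (ξ - x)) := by linarith
          have h5 : mixed φ (x', y) = partialX (mixed φ) (η₂, y) * (x' - ξ) := by linarith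
          rw [this, h5]; ring
        rw [h3] at hpos
        have := pos_of_mul_pos_left hpos (by positivity)
        linarith
      have hη₁X := hXo.uIcc_subset hx hξX hη₁
      have hη₂X := hXo.uIcc_subset hξX hx' hη₂
      have hcont : ContinuousOn (fun t => partialX (mixed φ) (t, y)) (Set.uIcc η₁ η₂) := by
        have := (contDiff_partialX su).continuous
        exact Continuous.continuousOn (by fun_prop)
      have hmem : (0 : ℝ) ∈ Set.uIcc (partialX (mixed φ) (η₁, y)) (partialX (mixed φ) (η₂, y)) := by
        rw [Set.mem_uIcc]
        rcases mul_neg_iff.1 hneg with h | h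
        · right; constructor <;> linarith [h.1, h.2]
        · left; constructor <;> linarith [h.1, h.2]
      obtain ⟨ζ, hζ, hζ0⟩ := intermediate_value_uIcc hcont hmem
      have := hlow₁ (ζ, y) ⟨hXo.uIcc_subset hη₁X hη₂X hζ, hy⟩
      simp only at hζ0
      rw [hζ0, abs_zero] at this
      linarith
    have e2 : (mixed φ (x', y) - mixed φ (x, y)) * (mixed φ (x, y) + mixed φ (x', y)) =
        (partialY φ (x', y) - partialY φ (x, y)) * (2 * partialX (mixed φ) (ξ, y)) := by
      apply mul_right_cancel₀ hne
      simp only [Nat.cast_ofNat, Nat.add_one_sub_one, pow_one] at e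
      linear_combination e
    have e3 := congrArg abs e2
    rw [abs_mul, abs_mul, abs_mul, abs_of_pos (by norm_num : (0 : ℝ) < 2)] at e3
    have e4 : |mixed φ (x, y) + mixed φ (x', y)| = |mixed φ (x, y)| + |mixed φ (x', y)| := by
      rw [abs_add_eq_add_abs_iff]
      rcases mul_pos_iff.1 hpos with h | h
      · left; exact ⟨h.1.le, h.2.le⟩
      · right; exact ⟨h.1.le, h.2.le⟩
    rw [e4, abs_sub_comm (mixed φ (x', y)), abs_sub_comm (partialY φ (x', y))] at e3
    have e5 := sepx x hx x' hx' y hy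
    have e6 := hup₂ (ξ, y) ⟨hξX, hy⟩
    set W := |mixed φ (x, y)| + |mixed φ (x', y)|
    set D := |partialY φ (x, y) - partialY φ (x', y)|
    have hW : 0 ≤ W := by positivity
    have hD : 0 ≤ D := abs_nonneg _
    calc c * W * |x - x'| ≤ c₁ / (2 * B₂) * W * |x - x'| := by gcongr
      _ = (c₁ * |x - x'|) * W / (2 * B₂) := by ring
      _ ≤ |mixed φ (x, y) - mixed φ (x', y)| * W / (2 * B₂) := by gcongr
      _ = D * (2 * |partialX (mixed φ) (ξ, y)|) / (2 * B₂) := by rw [e3]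
      _ ≤ D * (2 * B₂) / (2 * B₂) := by gcongr
      _ = D := by field_simp
  refine ⟨c, C, hφ, hX, hY, hc0, (min_le_right _ _).trans (min_le_right _ _), hB₁.trans hC1, ?_,
    lipx su hup₂ hC2, ?_, ?_, lipx sPy hup₃ hC3, lipx sPyy hup₄ hC4, ?_⟩
  · intro x hx x' hx' y hy
    exact (mul_le_mul_of_nonneg_right hcC (abs_nonneg _)).trans (sepx x hx x' hx' y hy)
  · intro x hx y hy y' hy'
    obtain ⟨ξ, hξ, e⟩ := exists_mean_value (fun t => hasDerivAt_partialY su x t) y' y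
    rw [e, abs_mul]
    exact mul_le_mul_of_nonneg_right
      (hcB.trans (hlow₂ _ ⟨hx, hYo.uIcc_subset hy' hy hξ⟩)) (abs_nonneg _)
  · intro x hx x' hx' y hy hpos
    rcases lt_trichotomy x x' with h | h | h
    · exact phase x hx x' hx' y hy h hpos
    · subst h; simp
    · have := phase x' hx' x hx y hy h (by rwa [mul_comm])
      rwa [abs_sub_comm x', abs_sub_comm (partialY φ (x', y)), add_comm] at this
  · intro x hx y hy
    exact (hup₁ (x, y) ⟨hx, hy⟩).trans hC1

/-- A smooth cutoff equal to `0` on `(-∞, 1]` and to `1` on `[2, ∞)`. -/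
noncomputable def cutoff (t : ℝ) : ℝ := Real.smoothTransition (t - 1)

theorem cutoff_of_le_one {t : ℝ} (h : t ≤ 1) : cutoff t = 0 :=
  Real.smoothTransition.zero_of_nonpos (by linarith)

theorem cutoff_of_two_le {t : ℝ} (h : 2 ≤ t) : cutoff t = 1 :=
  Real.smoothTransition.one_of_one_le (by linarith)

theorem cutoff_mem (t : ℝ) : 0 ≤ cutoff t ∧ cutoff t ≤ 1 :=
  ⟨Real.smoothTransition.nonneg _, Real.smoothTransition.le_one _⟩

theorem contDiff_cutoff : ContDiff ℝ ∞ cutoff :=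
  Real.smoothTransition.contDiff.comp (contDiff_id.sub contDiff_const)

/-- The dyadic bump supported in `[1, 4]`. -/
noncomputable def dyadicBump (t : ℝ) : ℝ := cutoff t - cutoff (t / 2)

theorem contDiff_dyadicBump : ContDiff ℝ ∞ dyadicBump :=
  contDiff_cutoff.sub (contDiff_cutoff.comp (contDiff_id.div_const 2))

theorem dyadicBump_support {t : ℝ} (h : dyadicBump t ≠ 0) : 1 ≤ t ∧ t ≤ 4 := by
  constructor
  · by_contra h1
    apply h
    rw [dyadicBump, cutoff_of_le_one (by linarith), cutoff_of_le_one (by linarith), sub_zero]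
  · by_contra h1
    apply h
    rw [dyadicBump, cutoff_of_two_le (by linarith), cutoff_of_two_le (by linarith), sub_self]

theorem hasCompactSupport_dyadicBump : HasCompactSupport dyadicBump :=
  HasCompactSupport.of_support_subset_isCompact (isCompact_Icc (a := 1) (b := 4))
    fun _ ht => dyadicBump_support ht

theorem exists_dyadicBump_bound : ∃ B : ℝ, 1 ≤ B ∧ ∀ t, |dyadicBump t| ≤ B ∧
    |deriv dyadicBump t| ≤ B ∧ |deriv (deriv dyadicBump) t| ≤ B := by
  have h1 : ContDiff ℝ ∞ (deriv dyadicBump) := (contDiff_infty_iff_deriv.1 contDiff_dyadicBump).2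
  have h2 : ContDiff ℝ ∞ (deriv (deriv dyadicBump)) := (contDiff_infty_iff_deriv.1 h1).2
  obtain ⟨B0, hB0⟩ := hasCompactSupport_dyadicBump.exists_bound_of_continuous
    contDiff_dyadicBump.continuous
  obtain ⟨B1, hB1⟩ := hasCompactSupport_dyadicBump.deriv.exists_bound_of_continuous h1.continuous
  obtain ⟨B2, hB2⟩ := hasCompactSupport_dyadicBump.deriv.deriv.exists_bound_of_continuous
    h2.continuous
  refine ⟨max 1 (max B0 (max B1 B2)), le_max_left _ _, fun t => ⟨?_, ?_, ?_⟩⟩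
  · exact (hB0 t).trans (by simp)
  · exact (hB1 t).trans (by simp)
  · exact (hB2 t).trans (by simp)

theorem sum_dyadicBump (σ t : ℝ) (n : ℕ) :
    ∑ k ∈ Finset.range n, dyadicBump (t / scale σ k) = cutoff (t / σ) - cutoff (t / scale σ n) := by
  induction n with
  | zero => simp [scale]
  | succ n ih =>
    rw [Finset.sum_range_succ, ih, dyadicBump]
    have : t / scale σ n / 2 = t / scale σ (n + 1) := by
      unfold scale; rw [pow_succ, div_div, mul_assoc]
    rw [this]; ring

theorem HasCompactSupport.partialY {f : ℝ × ℝ → ℝ} (hf : ContDiff ℝ ∞ f)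
    (hc : HasCompactSupport f) : HasCompactSupport (partialY f) := by
  rw [partialY_smooth_eq hf]
  exact (hc.fderiv (𝕜 := ℝ)).comp_left (g := fun L : ℝ × ℝ →L[ℝ] ℝ => L (0, 1)) rfl

theorem HasCompactSupport.partialX {f : ℝ × ℝ → ℝ} (hf : ContDiff ℝ ∞ f)
    (hc : HasCompactSupport f) : HasCompactSupport (partialX f) := by
  rw [partialX_smooth_eq hf]
  exact (hc.fderiv (𝕜 := ℝ)).comp_left (g := fun L : ℝ × ℝ →L[ℝ] ℝ => L (1, 0)) rfl

/-- The `y`-derivative of a complex amplitude. -/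
noncomputable def ampY (χ : ℝ × ℝ → ℂ) (p : ℝ × ℝ) : ℂ := fderiv ℝ χ p (0, 1)

theorem contDiff_ampY {χ : ℝ × ℝ → ℂ} (hχ : ContDiff ℝ ∞ χ) : ContDiff ℝ ∞ (ampY χ) :=
  (hχ.fderiv_right (m := ∞) (by simp)).clm_apply contDiff_const

theorem hasDerivAt_ampY {χ : ℝ × ℝ → ℂ} (hχ : ContDiff ℝ ∞ χ) (x y : ℝ) :
    HasDerivAt (fun y => χ (x, y)) (ampY χ (x, y)) y := by
  have h1 : HasFDerivAt χ (fderiv ℝ χ (x, y)) (x, y) :=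
    (hχ.differentiable (by simp) _).hasFDerivAt
  have h2 : HasDerivAt (fun y : ℝ => (x, y)) ((0 : ℝ), (1 : ℝ)) y :=
    (hasDerivAt_const _ _).prodMk (hasDerivAt_id y)
  exact h1.comp_hasDerivAt y h2

theorem HasCompactSupport.ampY {χ : ℝ × ℝ → ℂ} (hc : HasCompactSupport χ) :
    HasCompactSupport (ampY χ) :=
  (hc.fderiv (𝕜 := ℝ)).comp_left (g := fun L : ℝ × ℝ →L[ℝ] ℂ => L (0, 1)) rfl

theorem HasCompactSupport.exists_norm_bound {E : Type*} [NormedAddCommGroup E] {f : ℝ × ℝ → E}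
    (hc : HasCompactSupport f) (hf : Continuous f) : ∃ B : ℝ, 1 ≤ B ∧ ∀ p, ‖f p‖ ≤ B := by
  obtain ⟨B, hB⟩ := hc.exists_bound_of_continuous hf
  exact ⟨max B 1, le_max_right _ _, fun p => (hB p).trans (le_max_left _ _)⟩

/-- The dyadic piece of the amplitude `χ` where `ε φ_{xy} ~ s`. -/
noncomputable def dyadicAmp (φ : ℝ × ℝ → ℝ) (χ : ℝ × ℝ → ℂ) (ε s : ℝ) (p : ℝ × ℝ) : ℂ :=
  χ p * (dyadicBump (ε * mixed φ p / s) : ℂ)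

/-- Each y-derivative falling on the bump costs 1/s; one falling on χ or on φ_{xy} costs a constant.
Compact support of φ makes the derivatives of φ_{xy} globally bounded, so one A serves every scale
and both signs. -/
theorem exists_scaleAmplitude {φ : ℝ × ℝ → ℝ} {X Y : Set ℝ} {c C : ℝ} (hφ : FoldPhase φ X Y c C)
    (hφc : HasCompactSupport φ) {χ : ℝ × ℝ → ℂ} (hχ : ContDiff ℝ ∞ χ)
    (hχs : tsupport χ ⊆ X ×ˢ Y) : ∃ A : ℝ, 0 < A ∧ ∀ ε s : ℝ, (ε = 1 ∨ ε = -1) → 0 < s →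
      ScaleAmplitude φ X Y A s ε (dyadicAmp φ χ ε s) := by
  have hχc : HasCompactSupport χ :=
    (hφ.compactX.prod hφ.compactY).of_isClosed_subset (isClosed_tsupport χ) hχs
  have sx := contDiff_partialX hφ.smooth
  have su : ContDiff ℝ ∞ (mixed φ) := contDiff_partialY sx
  have suy := contDiff_partialY su
  have suyy := contDiff_partialY suy
  have cu : HasCompactSupport (mixed φ) := HasCompactSupport.partialY sx (hφc.partialX hφ.smooth)
  have cuy := HasCompactSupport.partialY su cu
  have cuyy := HasCompactSupport.partialY suy cuy
  have sχ1 := contDiff_ampY hχ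
  have sχ2 := contDiff_ampY sχ1
  obtain ⟨B₀, hB₀, hβ⟩ := exists_dyadicBump_bound
  obtain ⟨B₁, hB₁, h₁⟩ := hχc.exists_norm_bound hχ.continuous
  obtain ⟨B₂, hB₂, h₂⟩ := hχc.ampY.exists_norm_bound sχ1.continuous
  obtain ⟨B₃, hB₃, h₃⟩ := hχc.ampY.ampY.exists_norm_bound sχ2.continuous
  obtain ⟨B₄, hB₄, h₄⟩ := cuy.exists_norm_bound suy.continuous
  obtain ⟨B₅, hB₅, h₅⟩ := cuyy.exists_norm_bound suyy.continuous
  set B : ℝ := B₀ * B₁ * B₂ * B₃ * B₄ * B₅ * C with hB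
  have hC := hφ.one_le_C
  have hx : B₀ ≤ B ∧ B₁ ≤ B ∧ B₂ ≤ B ∧ B₃ ≤ B ∧ B₄ ≤ B ∧ B₅ ≤ B ∧ C ≤ B ∧ 1 ≤ B := by
    have m : ∀ {p q : ℝ}, 1 ≤ p → 1 ≤ q → 1 ≤ p * q ∧ p ≤ p * q ∧ q ≤ p * q := fun hp hq =>
      ⟨by nlinarith, by nlinarith, by nlinarith⟩
    obtain ⟨a1, a2, a3⟩ := m hB₀ hB₁
    obtain ⟨b1, b2, b3⟩ := m a1 hB₂
    obtain ⟨c1, c2, c3⟩ := m b1 hB₃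
    obtain ⟨d1, d2, d3⟩ := m c1 hB₄
    obtain ⟨e1, e2, e3⟩ := m d1 hB₅
    obtain ⟨f1, f2, f3⟩ := m e1 hC
    refine ⟨?_, ?_, ?_, ?_, ?_, ?_, ?_, f1⟩ <;> linarith
  obtain ⟨l0, l1, l2, l3, l4, l5, l6, l7⟩ := hx
  have hB0 : 0 < B := by linarith
  refine ⟨6 * B ^ 4, by positivity, ?_⟩
  intro ε s hε hs
  have hε1 : |ε| = 1 := by rcases hε with rfl | rfl <;> simp
  have hsupp : ∀ x y, dyadicAmp φ χ ε s (x, y) ≠ 0 → x ∈ X ∧ y ∈ Y ∧ s ≤ ε * mixed φ (x, y) ∧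
      ε * mixed φ (x, y) ≤ 4 * s := by
    intro x y h
    have h1 : χ (x, y) ≠ 0 := left_ne_zero_of_mul h
    have h2 : dyadicBump (ε * mixed φ (x, y) / s) ≠ 0 := by
      have := right_ne_zero_of_mul h
      exact_mod_cast this
    obtain ⟨h3, h4⟩ := dyadicBump_support h2
    obtain ⟨hxX, hyY⟩ := hχs (subset_tsupport _ h1)
    exact ⟨hxX, hyY, by rwa [le_div_iff₀ hs, one_mul] at h3, by rwa [div_le_iff₀ hs] at h4⟩
  have hsm : ContDiff ℝ ∞ (dyadicAmp φ χ ε s) := by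
    unfold dyadicAmp
    refine hχ.mul (Complex.ofRealCLM.contDiff.comp ?_)
    exact contDiff_dyadicBump.comp ((contDiff_const.mul su).div_const s)
  have sβ1 : ContDiff ℝ ∞ (deriv dyadicBump) := (contDiff_infty_iff_deriv.1 contDiff_dyadicBump).2
  have dβ : ∀ t, HasDerivAt dyadicBump (deriv dyadicBump t) t := fun t =>
    (contDiff_dyadicBump.differentiable (by simp) t).hasDerivAt
  have dβ1 : ∀ t, HasDerivAt (deriv dyadicBump) (deriv (deriv dyadicBump) t) t := fun t =>
    (sβ1.differentiable (by simp) t).hasDerivAt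
  have dv : ∀ x y, HasDerivAt (fun y => ε * mixed φ (x, y) / s)
      (ε * partialY (mixed φ) (x, y) / s) y := fun x y =>
    ((hasDerivAt_partialY su x y).const_mul ε).div_const s
  have d1 : ∀ x y, HasDerivAt (fun y => dyadicAmp φ χ ε s (x, y))
      (ampY χ (x, y) * (dyadicBump (ε * mixed φ (x, y) / s) : ℂ) +
        χ (x, y) * ((deriv dyadicBump (ε * mixed φ (x, y) / s) *
          (ε * partialY (mixed φ) (x, y) / s) : ℝ) : ℂ)) y := fun x y =>
    (hasDerivAt_ampY hχ x y).mul (HasDerivAt.ofReal_comp ((dβ _).comp y (dv x y)))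
  have e1 : ∀ x, deriv (fun y => dyadicAmp φ χ ε s (x, y)) = fun y =>
      ampY χ (x, y) * (dyadicBump (ε * mixed φ (x, y) / s) : ℂ) +
        χ (x, y) * ((deriv dyadicBump (ε * mixed φ (x, y) / s) *
          (ε * partialY (mixed φ) (x, y) / s) : ℝ) : ℂ) := fun x =>
    funext fun y => (d1 x y).deriv
  have d2 : ∀ x y, HasDerivAt (deriv (fun y => dyadicAmp φ χ ε s (x, y)))
      ((ampY (ampY χ) (x, y) * (dyadicBump (ε * mixed φ (x, y) / s) : ℂ) +
        ampY χ (x, y) * ((deriv dyadicBump (ε * mixed φ (x, y) / s) *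
          (ε * partialY (mixed φ) (x, y) / s) : ℝ) : ℂ)) +
       (ampY χ (x, y) * ((deriv dyadicBump (ε * mixed φ (x, y) / s) *
          (ε * partialY (mixed φ) (x, y) / s) : ℝ) : ℂ) +
        χ (x, y) * ((deriv (deriv dyadicBump) (ε * mixed φ (x, y) / s) *
          (ε * partialY (mixed φ) (x, y) / s) * (ε * partialY (mixed φ) (x, y) / s) +
          deriv dyadicBump (ε * mixed φ (x, y) / s) *
          (ε * partialY (partialY (mixed φ)) (x, y) / s) : ℝ) : ℂ))) y := fun x y => by
    rw [e1]
    exact ((hasDerivAt_ampY sχ1 x y).mul (HasDerivAt.ofReal_comp ((dβ _).comp y (dv x y)))).add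
      ((hasDerivAt_ampY hχ x y).mul (HasDerivAt.ofReal_comp
        (((dβ1 _).comp y (dv x y)).mul (((hasDerivAt_partialY suy x y).const_mul ε).div_const s))))
  -- Above scale C the piece is empty, so s ≤ C ≤ B may be assumed when constants are absorbed into
  -- powers of 1/s.
  have hvanish : C < s → ∀ p, dyadicAmp φ χ ε s p = 0 := by
    intro hCs p
    by_contra h
    obtain ⟨hxX, hyY, h1, -⟩ := hsupp p.1 p.2 h
    have h2 := hφ.bdd p.1 hxX p.2 hyY
    rw [abs_mixed_of_sign hε (hs.le.trans h1)] at h2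
    linarith
  have bβ0 : ∀ t, ‖(dyadicBump t : ℂ)‖ ≤ B := fun t => by
    rw [Complex.norm_real]; exact (hβ t).1.trans l0
  have bβ1 : ∀ t, |deriv dyadicBump t| ≤ B := fun t => (hβ t).2.1.trans l0
  have bβ2 : ∀ t, |deriv (deriv dyadicBump) t| ≤ B := fun t => (hβ t).2.2.trans l0
  have buy : ∀ p, |ε * partialY (mixed φ) p / s| ≤ B / s := fun p => by
    rw [abs_div, abs_mul, hε1, one_mul, abs_of_pos hs]
    gcongr
    exact (h₄ p).trans l4
  have buyy : ∀ p, |ε * partialY (partialY (mixed φ)) p / s| ≤ B / s := fun p => by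
    rw [abs_div, abs_mul, hε1, one_mul, abs_of_pos hs]
    gcongr
    exact (h₅ p).trans l5
  have mulb : ∀ {z w : ℂ} {p q : ℝ}, ‖z‖ ≤ p → ‖w‖ ≤ q → ‖z * w‖ ≤ p * q := by
    intro z w p q h1 h2
    rw [norm_mul]
    exact mul_le_mul h1 h2 (norm_nonneg _) ((norm_nonneg _).trans h1)
  have mulr : ∀ {z w : ℝ} {p q : ℝ}, |z| ≤ p → |w| ≤ q → |z * w| ≤ p * q := by
    intro z w p q h1 h2
    rw [abs_mul]
    exact mul_le_mul h1 h2 (abs_nonneg _) ((abs_nonneg _).trans h1)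
  have bmix : ∀ p, ‖((deriv dyadicBump (ε * mixed φ p / s) *
      (ε * partialY (mixed φ) p / s) : ℝ) : ℂ)‖ ≤ B * (B / s) := fun p => by
    rw [Complex.norm_real]; exact mulr (bβ1 _) (buy p)
  refine ⟨hsm.continuous, fun x => ?_, hsupp, fun x y => ?_, fun x y => ?_, fun x y => ?_⟩
  · have : ContDiff ℝ ∞ fun y => dyadicAmp φ χ ε s (x, y) :=
      hsm.comp (contDiff_const.prodMk contDiff_id)
    exact this.of_le (WithTop.coe_le_coe.2 (le_top : (2 : ℕ∞) ≤ ⊤))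
  · refine (mulb ((h₁ _).trans l1) (bβ0 _)).trans ?_
    have : 1 ≤ B ^ 2 := one_le_pow₀ l7
    nlinarith [sq_nonneg B]
  · rcases lt_or_ge C s with hCs | hCs
    · have : (fun y => dyadicAmp φ χ ε s (x, y)) = fun _ => 0 := funext fun y => hvanish hCs _
      rw [this]; simp; positivity
    · rw [(d1 x y).deriv]
      refine (norm_add_le _ _).trans ((add_le_add (mulb ((h₂ _).trans l2) (bβ0 _))
        (mulb ((h₁ _).trans l1) (bmix _))).trans ?_)
      rw [le_div_iff₀ hs]
      have hsB : s ≤ B := hCs.trans l6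
      calc (B * B + B * (B * (B / s))) * s = B * B * s + B ^ 3 := by field_simp
        _ ≤ B * B * B + B ^ 3 := by gcongr
        _ = 2 * B ^ 3 * 1 := by ring
        _ ≤ 2 * B ^ 3 * B := by gcongr
        _ ≤ _ := by nlinarith [pow_pos hB0 4]
  · rcases lt_or_ge C s with hCs | hCs
    · have : (fun y => dyadicAmp φ χ ε s (x, y)) = fun _ => 0 := funext fun y => hvanish hCs _
      rw [this]; simp; positivity
    · rw [(d2 x y).deriv]
      have b4 : ‖((deriv (deriv dyadicBump) (ε * mixed φ (x, y) / s) *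
          (ε * partialY (mixed φ) (x, y) / s) * (ε * partialY (mixed φ) (x, y) / s) +
          deriv dyadicBump (ε * mixed φ (x, y) / s) *
          (ε * partialY (partialY (mixed φ)) (x, y) / s) : ℝ) : ℂ)‖ ≤
          B * (B / s) * (B / s) + B * (B / s) := by
        rw [Complex.norm_real]
        exact (abs_add_le _ _).trans (add_le_add (mulr (mulr (bβ2 _) (buy _)) (buy _))
          (mulr (bβ1 _) (buyy _)))
      refine (norm_add_le _ _).trans ((add_le_add ((norm_add_le _ _).trans
        (add_le_add (mulb ((h₃ _).trans l3) (bβ0 _)) (mulb ((h₂ _).trans l2) (bmix _))))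
        ((norm_add_le _ _).trans (add_le_add (mulb ((h₂ _).trans l2) (bmix _))
        (mulb ((h₁ _).trans l1) b4)))).trans ?_)
      rw [le_div_iff₀ (by positivity)]
      have hsB : s ≤ B := hCs.trans l6
      calc (B * B + B * (B * (B / s)) + (B * (B * (B / s)) +
            B * (B * (B / s) * (B / s) + B * (B / s)))) * s ^ 2
          = B ^ 2 * s ^ 2 + 3 * (B ^ 3 * s) + B ^ 4 := by field_simp; ring
        _ ≤ B ^ 2 * B ^ 2 + 3 * (B ^ 3 * B) + B ^ 4 := by gcongr
        _ ≤ _ := by nlinarith [pow_pos hB0 4]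

end Cutoffs

/-! ### Reassembly: far pieces, core, and the fold bounds. -/

section Fold

variable {φ : ℝ × ℝ → ℝ} {X Y : Set ℝ} {c C : ℝ} {χ : ℝ × ℝ → ℂ}

/-- The part of the amplitude `χ` where `ε φ_{xy} ≳ σ`. -/
noncomputable def farAmp (φ : ℝ × ℝ → ℝ) (χ : ℝ × ℝ → ℂ) (ε σ : ℝ) (p : ℝ × ℝ) : ℂ :=
  χ p * (cutoff (ε * mixed φ p / σ) : ℂ)

theorem contDiff_farAmp (hφ : ContDiff ℝ ∞ φ) (hχ : ContDiff ℝ ∞ χ) (ε σ : ℝ) :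
    ContDiff ℝ ∞ (farAmp φ χ ε σ) := by
  unfold farAmp
  refine hχ.mul (Complex.ofRealCLM.contDiff.comp ?_)
  have su : ContDiff ℝ ∞ (mixed φ) := contDiff_partialY (contDiff_partialX hφ)
  exact contDiff_cutoff.comp ((contDiff_const.mul su).div_const σ)

theorem exists_oscOp_farAmp_eq_sum (hφ : FoldPhase φ X Y c C) (hφc : HasCompactSupport φ)
    (hχ : ContDiff ℝ ∞ χ) (hχs : tsupport χ ⊆ X ×ˢ Y) {ε σ : ℝ} (hε : ε = 1 ∨ ε = -1)
    (hσ : 0 < σ) : ∃ n : ℕ, ∀ (lam : ℝ) (f : ℝ → ℂ), MemLp f 2 volume → ∀ x,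
      oscOp φ (farAmp φ χ ε σ) lam f x =
        ∑ k ∈ Finset.range n, oscOp φ (dyadicAmp φ χ ε (scale σ k)) lam f x := by
  -- Beyond this n, σ2^n exceeds the maximum C of |φ_{xy}|, so the last cutoff in the telescoping
  -- sum vanishes on the support of χ.
  obtain ⟨n, hn⟩ := pow_unbounded_of_one_lt (C / σ) (by norm_num : (1 : ℝ) < 2)
  obtain ⟨A, hA, hamp⟩ := exists_scaleAmplitude hφ hφc hχ hχs
  refine ⟨n, fun lam f hf x => ?_⟩
  simp only [oscOp_eq]
  rw [← integral_finsetSum]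
  · congr 1
    ext y
    rw [← Finset.sum_mul]
    congr 1
    simp only [oscKernel]
    rw [← Finset.mul_sum]
    congr 1
    simp only [dyadicAmp, farAmp]
    rw [← Finset.mul_sum, ← Complex.ofReal_sum, sum_dyadicBump]
    by_cases h : χ (x, y) = 0
    · simp [h]
    · have hs : 0 < scale σ n := scale_pos hσ n
      have h0 : cutoff (ε * mixed φ (x, y) / scale σ n) = 0 := by
        apply cutoff_of_le_one
        rw [div_le_one hs]
        obtain ⟨hxX, hyY⟩ := hχs (subset_tsupport _ h)
        have h1 := hφ.bdd x hxX y hyY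
        have h2 : ε * mixed φ (x, y) ≤ |mixed φ (x, y)| := by
          rcases hε with rfl | rfl
          · rw [one_mul]; exact le_abs_self _
          · rw [neg_one_mul]; exact neg_le_abs _
        rw [div_lt_iff₀ hσ] at hn
        unfold scale
        linarith
      rw [h0, sub_zero]
  · intro k _
    have hb := hamp ε (scale σ k) hε (scale_pos hσ k)
    exact integrable_oscKernel_mul hφ.smooth hb.cont (hb.hasCompactSupport hφ) hf lam x

theorem eLpNorm_two_le_of_lintegral {g f : ℝ → ℂ} {K : ℝ} (hK : 0 ≤ K)
    (h : ∫⁻ x, ‖g x‖ₑ ^ 2 ≤ ENNReal.ofReal (K ^ 2) * ∫⁻ y, ‖f y‖ₑ ^ 2) :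
    eLpNorm g 2 volume ≤ ENNReal.ofReal K * eLpNorm f 2 volume := by
  rw [← eLpNorm_two_sq, ← eLpNorm_two_sq, ENNReal.ofReal_pow hK, ← mul_pow] at h
  exact (ENNReal.pow_le_pow_left_iff two_ne_zero).1 h

theorem eLpNorm_three_le_of_lintegral {g f : ℝ → ℂ} {K : ℝ} (hK : 0 ≤ K)
    (h : ∫⁻ x, ‖g x‖ₑ ^ 3 ≤ ENNReal.ofReal (K ^ 3) * ∫⁻ y, ‖f y‖ₑ ^ 3) :
    eLpNorm g 3 volume ≤ ENNReal.ofReal K * eLpNorm f 3 volume := by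
  rw [← eLpNorm_three_cube, ← eLpNorm_three_cube, ENNReal.ofReal_pow hK, ← mul_pow] at h
  exact (ENNReal.pow_le_pow_left_iff three_ne_zero).1 h

theorem exists_farAmp_L2_le (hφ : FoldPhase φ X Y c C) (hφc : HasCompactSupport φ)
    (hχ : ContDiff ℝ ∞ χ) (hχs : tsupport χ ⊆ X ×ˢ Y) : ∃ K : ℝ, 0 < K ∧
    ∀ (ε σ lam : ℝ) (f : ℝ → ℂ), (ε = 1 ∨ ε = -1) → 0 < σ → 0 < lam → 1 ≤ lam * σ ^ 3 →
      MemLp f 2 volume → eLpNorm (oscOp φ (farAmp φ χ ε σ) lam f) 2 volume ≤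
        ENNReal.ofReal (K / √(lam * σ)) * eLpNorm f 2 volume := by
  obtain ⟨A, hA, hamp⟩ := exists_scaleAmplitude hφ hφc hχ hχs
  obtain ⟨K, hK, hmain⟩ := exists_dyadic_sum_L2_le hφ hA
  refine ⟨√K, Real.sqrt_pos.2 hK, fun ε σ lam f hε hσ hlam h1 hf => ?_⟩
  obtain ⟨n, hn⟩ := exists_oscOp_farAmp_eq_sum hφ hφc hχ hχs hε hσ
  apply eLpNorm_two_le_of_lintegral (by positivity)
  rw [div_pow, Real.sq_sqrt hK.le, Real.sq_sqrt (by positivity)]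
  simp only [hn lam f hf]
  exact hmain ε σ lam n _ f hε hσ hlam h1 (fun k => hamp ε _ hε (scale_pos hσ k)) hf

theorem exists_farAmp_L3_le (hφ : FoldPhase φ X Y c C) (hφc : HasCompactSupport φ)
    (hχ : ContDiff ℝ ∞ χ) (hχs : tsupport χ ⊆ X ×ˢ Y) : ∃ K : ℝ, 0 < K ∧
    ∀ (ε σ lam : ℝ) (f : ℝ → ℂ), (ε = 1 ∨ ε = -1) → 0 < σ → 0 < lam → lam * σ ^ 3 = 1 →
      Measurable f → MemLp f 2 volume → eLpNorm (oscOp φ (farAmp φ χ ε σ) lam f) 3 volume ≤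
        ENNReal.ofReal (K * σ) * eLpNorm f 3 volume := by
  obtain ⟨A, hA, hamp⟩ := exists_scaleAmplitude hφ hφc hχ hχs
  obtain ⟨K, hK, hmain⟩ := exists_dyadic_sum_L3_le hφ hA
  -- K ≤ (K + 1)³ replaces a cube root of K.
  refine ⟨K + 1, by positivity, fun ε σ lam f hε hσ hlam h1 hfm hf => ?_⟩
  obtain ⟨n, hn⟩ := exists_oscOp_farAmp_eq_sum hφ hφc hχ hχs hε hσ
  apply eLpNorm_three_le_of_lintegral (by positivity)
  simp only [hn lam f hf]
  refine (hmain ε σ lam n _ f hε hσ hlam h1.ge (fun k => hamp ε _ hε (scale_pos hσ k)) hfm hf).trans ?_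
  gcongr
  have h2 : σ ^ 3 = 1 / lam := by field_simp; linarith
  rw [mul_pow, h2, mul_one_div]
  gcongr
  nlinarith [sq_nonneg K, pow_pos hK 3]

theorem lintegral_pow_le (n : ℕ) (hn : n ≠ 0) {f : ℝ → ℂ} (hf : Measurable f) (J : Set ℝ) :
    (∫⁻ y in J, ‖f y‖ₑ) ^ n ≤ volume J ^ (n - 1) * ∫⁻ y in J, ‖f y‖ₑ ^ n := by
  have hn1 : (1 : ℝ≥0∞) ≤ (n : ℝ≥0∞) := by
    exact_mod_cast Nat.one_le_iff_ne_zero.2 hn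
  have h := eLpNorm_le_eLpNorm_mul_rpow_measure_univ (μ := volume.restrict J) hn1
    hf.aestronglyMeasurable
  rw [eLpNorm_one_eq_lintegral_enorm] at h
  have h2 : eLpNorm f (n : ℝ≥0∞) (volume.restrict J) ^ n = ∫⁻ y in J, ‖f y‖ₑ ^ n := by
    have := eLpNorm_nnreal_pow_eq_lintegral (f := f) (μ := volume.restrict J) (p := (n : NNReal))
      (by exact_mod_cast hn)
    simpa using this
  have hn0 : (0 : ℝ) < n := by exact_mod_cast Nat.pos_of_ne_zero hn
  calc (∫⁻ y in J, ‖f y‖ₑ) ^ n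
      ≤ (eLpNorm f n (volume.restrict J) * volume.restrict J Set.univ ^
        (1 / (1 : ℝ≥0∞).toReal - 1 / (n : ℝ≥0∞).toReal)) ^ n := by gcongr
    _ = volume J ^ (n - 1) * ∫⁻ y in J, ‖f y‖ₑ ^ n := by
        rw [mul_pow, h2, mul_comm]
        congr 1
        rw [Measure.restrict_apply_univ, ← ENNReal.rpow_natCast, ← ENNReal.rpow_mul,
          ← ENNReal.rpow_natCast]
        congr 1
        rw [Nat.cast_sub (Nat.one_le_iff_ne_zero.2 hn)]
        simp only [ENNReal.toReal_one, ENNReal.toReal_natCast]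
        field_simp
        push_cast; ring

/-- Schur's test for a bounded amplitude supported in a set with small slices. -/
theorem lintegral_oscOp_pow_le (n : ℕ) (hn : n ≠ 0) (φ : ℝ × ℝ → ℝ) {b : ℝ × ℝ → ℂ} {A ℓ : ℝ}
    (hA : 0 ≤ A) (hℓ : 0 ≤ ℓ) {E : Set (ℝ × ℝ)} (hE : MeasurableSet E) (hb : ∀ p, ‖b p‖ ≤ A)
    (hbE : ∀ p, b p ≠ 0 → p ∈ E) (h1 : ∀ x, volume {y | (x, y) ∈ E} ≤ ENNReal.ofReal ℓ)
    (h2 : ∀ y, volume {x | (x, y) ∈ E} ≤ ENNReal.ofReal ℓ) (lam : ℝ) {f : ℝ → ℂ}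
    (hf : Measurable f) :
    ∫⁻ x, ‖oscOp φ b lam f x‖ₑ ^ n ≤ ENNReal.ofReal ((A * ℓ) ^ n) * ∫⁻ y, ‖f y‖ₑ ^ n := by
  have hsl : ∀ x, MeasurableSet {y | (x, y) ∈ E} := fun x => measurable_prodMk_left hE
  have hpt : ∀ x, ‖oscOp φ b lam f x‖ₑ ^ n ≤ ENNReal.ofReal (A ^ n * ℓ ^ (n - 1)) *
      ∫⁻ y, E.indicator (fun p => ‖f p.2‖ₑ ^ n) (x, y) := by
    intro x
    have e1 : ‖oscOp φ b lam f x‖ₑ ≤ ENNReal.ofReal A * ∫⁻ y in {y | (x, y) ∈ E}, ‖f y‖ₑ := by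
      refine (enorm_oscOp_le_lintegral _ _ _ _ _).trans ?_
      rw [← lintegral_const_mul' _ _ ENNReal.ofReal_ne_top, ← lintegral_indicator (hsl x)]
      refine lintegral_mono fun y => ?_
      by_cases h : b (x, y) = 0
      · simp [h]
      · rw [Set.indicator_of_mem (show y ∈ {y | (x, y) ∈ E} from hbE _ h)]
        gcongr
        rw [← ofReal_norm]
        exact ENNReal.ofReal_le_ofReal (hb _)
    calc ‖oscOp φ b lam f x‖ₑ ^ n
        ≤ (ENNReal.ofReal A * ∫⁻ y in {y | (x, y) ∈ E}, ‖f y‖ₑ) ^ n := by gcongr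
      _ ≤ ENNReal.ofReal A ^ n * (ENNReal.ofReal ℓ ^ (n - 1) *
          ∫⁻ y in {y | (x, y) ∈ E}, ‖f y‖ₑ ^ n) := by
          rw [mul_pow]
          gcongr
          refine (lintegral_pow_le n hn hf _).trans ?_
          gcongr
          exact h1 x
      _ = _ := by
          rw [← lintegral_indicator (hsl x), ENNReal.ofReal_mul (by positivity),
            ENNReal.ofReal_pow hA, ENNReal.ofReal_pow hℓ, mul_assoc]
          rfl
  have hm : Measurable (E.indicator fun p : ℝ × ℝ => ‖f p.2‖ₑ ^ n) :=
    Measurable.indicator (by fun_prop) hE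
  calc _ ≤ ∫⁻ x, ENNReal.ofReal (A ^ n * ℓ ^ (n - 1)) *
        ∫⁻ y, E.indicator (fun p => ‖f p.2‖ₑ ^ n) (x, y) := lintegral_mono hpt
    _ = ENNReal.ofReal (A ^ n * ℓ ^ (n - 1)) *
        ∫⁻ y, ∫⁻ x, E.indicator (fun p => ‖f p.2‖ₑ ^ n) (x, y) := by
        rw [lintegral_const_mul' _ _ ENNReal.ofReal_ne_top,
          lintegral_lintegral_swap (f := fun x y => E.indicator (fun p => ‖f p.2‖ₑ ^ n) (x, y))
            hm.aemeasurable]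
    _ ≤ ENNReal.ofReal (A ^ n * ℓ ^ (n - 1)) * ∫⁻ y, ENNReal.ofReal ℓ * ‖f y‖ₑ ^ n := by
        gcongr with y
        have hmy : MeasurableSet {x | (x, y) ∈ E} := measurable_prodMk_right hE
        calc ∫⁻ x, E.indicator (fun p => ‖f p.2‖ₑ ^ n) (x, y)
            = ∫⁻ x, Set.indicator {x | (x, y) ∈ E} (fun _ => ‖f y‖ₑ ^ n) x := rfl
          _ = ‖f y‖ₑ ^ n * volume {x | (x, y) ∈ E} := by
              rw [lintegral_indicator hmy, setLIntegral_const]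
          _ ≤ _ := by rw [mul_comm]; gcongr; exact h2 y
    _ = _ := by
        rw [lintegral_const_mul' _ _ ENNReal.ofReal_ne_top, ← mul_assoc,
          ← ENNReal.ofReal_mul (by positivity)]
        congr 2
        rw [mul_pow, mul_assoc, ← pow_succ, Nat.sub_add_cancel (Nat.one_le_iff_ne_zero.2 hn)]

/-- The part of the amplitude near the fold. -/
noncomputable def coreAmp (φ : ℝ × ℝ → ℝ) (χ : ℝ × ℝ → ℂ) (σ : ℝ) (p : ℝ × ℝ) : ℂ :=
  χ p - farAmp φ χ 1 σ p - farAmp φ χ (-1) σ p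

theorem volume_le_of_pairwise {S : Set ℝ} {ℓ : ℝ} (h : ∀ y ∈ S, ∀ z ∈ S, |y - z| ≤ ℓ) :
    volume S ≤ ENNReal.ofReal (2 * ℓ) := by
  rcases S.eq_empty_or_nonempty with rfl | ⟨y0, hy0⟩
  · simp
  · have hsub : S ⊆ Set.Icc (y0 - ℓ) (y0 + ℓ) := fun y hy => by
      have := abs_le.1 (h y hy y0 hy0)
      constructor <;> linarith
    refine (measure_mono hsub).trans (le_of_eq ?_)
    rw [Real.volume_Icc]; congr 1; ring

/-- The core amplitude lives where |φ_{xy}| ≤ 2σ, so its slices in either variable have diameter at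
most 4σ/c. Schur's test uses nothing else, which is why λ does not appear in the bound. -/
theorem exists_coreAmp_le (hφ : FoldPhase φ X Y c C)
    (hχ : ContDiff ℝ ∞ χ) (hχs : tsupport χ ⊆ X ×ˢ Y) : ∃ K : ℝ, 0 < K ∧
    ∀ (n : ℕ) (σ lam : ℝ) (f : ℝ → ℂ), n ≠ 0 → 0 < σ → Measurable f →
      ∫⁻ x, ‖oscOp φ (coreAmp φ χ σ) lam f x‖ₑ ^ n ≤
        ENNReal.ofReal ((K * σ) ^ n) * ∫⁻ y, ‖f y‖ₑ ^ n := by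
  have hχc : HasCompactSupport χ :=
    (hφ.compactX.prod hφ.compactY).of_isClosed_subset (isClosed_tsupport χ) hχs
  obtain ⟨B, hB, hb⟩ := hχc.exists_norm_bound hχ.continuous
  have hc := hφ.c_pos
  refine ⟨3 * B * (8 / c), by positivity, ?_⟩
  intro n σ lam f hn hσ hf
  set E : Set (ℝ × ℝ) := {p | p ∈ X ×ˢ Y ∧ |mixed φ p| ≤ 2 * σ} with hE
  have hEm : MeasurableSet E := by
    refine (hφ.compactX.prod hφ.compactY).measurableSet.inter ?_
    exact (isClosed_le (continuous_mixed hφ).abs continuous_const).measurableSet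
  have h := lintegral_oscOp_pow_le n hn φ (b := coreAmp φ χ σ) (A := 3 * B) (ℓ := 2 * (4 * σ / c))
    (by positivity) (by positivity) hEm ?_ ?_ ?_ ?_ lam hf
  · refine h.trans (le_of_eq ?_)
    congr 3; ring
  · intro p
    have h3 : ∀ ε, ‖farAmp φ χ ε σ p‖ ≤ B := fun ε => by
      rw [farAmp, norm_mul, Complex.norm_real, Real.norm_eq_abs, abs_of_nonneg (cutoff_mem _).1]
      calc _ ≤ B * 1 := mul_le_mul (hb p) (cutoff_mem _).2 (cutoff_mem _).1 (by positivity)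
        _ = B := mul_one B
    refine (norm_sub_le _ _).trans ?_
    have := norm_sub_le (χ p) (farAmp φ χ 1 σ p)
    linarith [hb p, h3 1, h3 (-1)]
  · intro p hp
    have hχp : χ p ≠ 0 := by
      intro h0; apply hp; simp [coreAmp, farAmp, h0]
    refine ⟨hχs (subset_tsupport _ hχp), ?_⟩
    by_contra hlt
    push Not at hlt
    apply hp
    simp only [coreAmp, farAmp, one_mul, neg_one_mul]
    rcases le_total 0 (mixed φ p) with h0 | h0
    · rw [abs_of_nonneg h0] at hlt
      rw [cutoff_of_two_le (t := mixed φ p / σ) (by rw [le_div_iff₀ hσ]; exact hlt.le),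
        cutoff_of_le_one (by rw [div_le_one hσ]; linarith)]
      simp
    · rw [abs_of_nonpos h0] at hlt
      rw [cutoff_of_two_le (t := -mixed φ p / σ) (by rw [le_div_iff₀ hσ]; exact hlt.le),
        cutoff_of_le_one (by rw [div_le_one hσ]; linarith)]
      simp
  · intro x
    refine volume_le_of_pairwise fun y hy z hz => ?_
    have h1 := hφ.sep_y x hy.1.1 y hy.1.2 z hz.1.2
    have h2 := abs_sub (mixed φ (x, y)) (mixed φ (x, z))
    rw [le_div_iff₀ hc]
    linarith [hy.2, hz.2]
  · intro y
    refine volume_le_of_pairwise fun x hx z hz => ?_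
    have h1 := hφ.sep_x x hx.1.1 z hz.1.1 y hx.1.2
    have h2 := abs_sub (mixed φ (x, y)) (mixed φ (z, y))
    rw [le_div_iff₀ hc]
    linarith [hx.2, hz.2]

theorem hasCompactSupport_slice (hY : IsCompact Y) {b : ℝ × ℝ → ℂ}
    (hb : ∀ x y, b (x, y) ≠ 0 → y ∈ Y) (x : ℝ) : HasCompactSupport fun y => b (x, y) :=
  HasCompactSupport.of_support_subset_isCompact hY fun y hy => hb x y hy

theorem mem_of_ne_zero (hχs : tsupport χ ⊆ X ×ˢ Y) {x y : ℝ} (h : χ (x, y) ≠ 0) :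
    x ∈ X ∧ y ∈ Y := hχs (subset_tsupport _ h)

theorem contDiff_coreAmp (hφ : ContDiff ℝ ∞ φ) (hχ : ContDiff ℝ ∞ χ) (σ : ℝ) :
    ContDiff ℝ ∞ (coreAmp φ χ σ) := by
  have h : coreAmp φ χ σ = fun p => χ p - farAmp φ χ 1 σ p - farAmp φ χ (-1) σ p := by
    ext p; simp only [coreAmp]
  rw [h]
  exact (hχ.sub (contDiff_farAmp hφ hχ 1 σ)).sub (contDiff_farAmp hφ hχ (-1) σ)

theorem integral_oscKernel_add {b₁ b₂ : ℝ × ℝ → ℂ} {f : ℝ → ℂ} {lam x : ℝ}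
    (h₁ : Integrable fun y => oscKernel φ b₁ lam x y * f y)
    (h₂ : Integrable fun y => oscKernel φ b₂ lam x y * f y) :
    oscOp φ (fun p => b₁ p + b₂ p) lam f x = oscOp φ b₁ lam f x + oscOp φ b₂ lam f x := by
  simp only [oscOp_eq]
  rw [← integral_add h₁ h₂]
  refine integral_congr_ae (Filter.Eventually.of_forall fun y => ?_)
  simp only [oscKernel]
  ring

theorem integrable_oscKernel_add {b₁ b₂ : ℝ × ℝ → ℂ} {f : ℝ → ℂ} {lam x : ℝ}
    (h₁ : Integrable fun y => oscKernel φ b₁ lam x y * f y)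
    (h₂ : Integrable fun y => oscKernel φ b₂ lam x y * f y) :
    Integrable fun y => oscKernel φ (fun p => b₁ p + b₂ p) lam x y * f y := by
  refine (h₁.add h₂).congr (Filter.Eventually.of_forall fun y => ?_)
  simp only [oscKernel, Pi.add_apply]
  ring

theorem integrable_oscKernel_farAmp (hφ : FoldPhase φ X Y c C)
    (hχ : ContDiff ℝ ∞ χ) (hχs : tsupport χ ⊆ X ×ˢ Y) (ε σ lam : ℝ) {f : ℝ → ℂ}
    (hf : MemLp f 2 volume) (x : ℝ) :
    Integrable fun y => oscKernel φ (farAmp φ χ ε σ) lam x y * f y :=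
  integrable_oscKernel_mul hφ.smooth (contDiff_farAmp hφ.smooth hχ ε σ).continuous
    (hasCompactSupport_slice hφ.compactY fun _ _ h =>
      (mem_of_ne_zero hχs (left_ne_zero_of_mul h)).2) hf lam x

theorem oscOp_eq_far_add_core (hφ : FoldPhase φ X Y c C)
    (hχ : ContDiff ℝ ∞ χ) (hχs : tsupport χ ⊆ X ×ˢ Y) (σ lam : ℝ) {f : ℝ → ℂ}
    (hf : MemLp f 2 volume) : oscOp φ χ lam f = oscOp φ (farAmp φ χ 1 σ) lam f +
      oscOp φ (farAmp φ χ (-1) σ) lam f + oscOp φ (coreAmp φ χ σ) lam f := by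
  ext x
  have hcore : Integrable fun y => oscKernel φ (coreAmp φ χ σ) lam x y * f y := by
    refine integrable_oscKernel_mul hφ.smooth (contDiff_coreAmp hφ.smooth hχ σ).continuous
      (hasCompactSupport_slice hφ.compactY fun x y h => ?_) hf lam x
    refine (mem_of_ne_zero (x := x) hχs fun h0 => h ?_).2
    simp [coreAmp, farAmp, h0]
  have hfar := fun ε => integrable_oscKernel_farAmp hφ hχ hχs ε σ lam hf x
  have hsum : χ = fun p => (farAmp φ χ 1 σ p + farAmp φ χ (-1) σ p) + coreAmp φ χ σ p := by
    ext p
    simp only [coreAmp]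
    ring
  rw [Pi.add_apply, Pi.add_apply, ← integral_oscKernel_add (hfar 1) (hfar (-1)),
    ← integral_oscKernel_add (integrable_oscKernel_add (hfar 1) (hfar (-1))) hcore, ← hsum]

/-- The sharp `L²` and `L³` bounds for an operator with a two-sided fold. -/
theorem exists_oscOp_fold_le (hφ : FoldPhase φ X Y c C) (hφc : HasCompactSupport φ)
    (hχ : ContDiff ℝ ∞ χ) (hχs : tsupport χ ⊆ X ×ˢ Y) : ∃ K : ℝ, 0 < K ∧
    ∀ (σ lam : ℝ) (f : ℝ → ℂ), 0 < σ → 0 < lam → lam * σ ^ 3 = 1 →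
      Measurable f → MemLp f 2 volume →
      eLpNorm (oscOp φ χ lam f) 2 volume ≤ ENNReal.ofReal (K * σ) * eLpNorm f 2 volume ∧
      eLpNorm (oscOp φ χ lam f) 3 volume ≤ ENNReal.ofReal (K * σ) * eLpNorm f 3 volume := by
  obtain ⟨K₁, hK₁, h2⟩ := exists_farAmp_L2_le hφ hφc hχ hχs
  obtain ⟨K₂, hK₂, h3⟩ := exists_farAmp_L3_le hφ hφc hχ hχs
  obtain ⟨K₃, hK₃, hc⟩ := exists_coreAmp_le hφ hχ hχs
  refine ⟨2 * K₁ + 2 * K₂ + K₃, by positivity, ?_⟩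
  intro σ lam f hσ hlam h1 hfm hf
  have hm : ∀ ε, AEStronglyMeasurable (oscOp φ (farAmp φ χ ε σ) lam f) volume := fun ε =>
    (measurable_oscOp hφ.smooth.continuous (contDiff_farAmp hφ.smooth hχ ε σ).continuous hf.1
      lam).aestronglyMeasurable
  have hmc : AEStronglyMeasurable (oscOp φ (coreAmp φ χ σ) lam f) volume :=
    (measurable_oscOp hφ.smooth.continuous ((hχ.sub (contDiff_farAmp hφ.smooth hχ 1 σ)).sub
      (contDiff_farAmp hφ.smooth hχ (-1) σ)).continuous hf.1 lam).aestronglyMeasurable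
  have tri : ∀ (p : ℝ≥0∞) (L : ℝ), 1 ≤ p → 0 ≤ L → L ≤ K₁ + K₂ →
      (∀ ε : ℝ, (ε = 1 ∨ ε = -1) → eLpNorm (oscOp φ (farAmp φ χ ε σ) lam f) p volume ≤
        ENNReal.ofReal (L * σ) * eLpNorm f p volume) →
      eLpNorm (oscOp φ (coreAmp φ χ σ) lam f) p volume ≤
        ENNReal.ofReal (K₃ * σ) * eLpNorm f p volume →
      eLpNorm (oscOp φ χ lam f) p volume ≤
        ENNReal.ofReal ((2 * K₁ + 2 * K₂ + K₃) * σ) * eLpNorm f p volume := by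
    intro p L hp hL0 hL hfar hcore
    rw [oscOp_eq_far_add_core hφ hχ hχs σ lam hf]
    refine (eLpNorm_add_le ((hm 1).add (hm (-1))) hmc hp).trans ?_
    refine (add_le_add ((eLpNorm_add_le (hm 1) (hm (-1)) hp).trans
      (add_le_add (hfar 1 (Or.inl rfl)) (hfar (-1) (Or.inr rfl)))) hcore).trans ?_
    rw [← add_mul, ← add_mul, ← ENNReal.ofReal_add (by positivity) (by positivity),
      ← ENNReal.ofReal_add (by positivity) (by positivity)]
    gcongr
    nlinarith
  constructor
  · refine tri 2 K₁ one_le_two hK₁.le (by linarith) (fun ε hε => ?_) ?_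
    · refine (h2 ε σ lam f hε hσ hlam h1.ge hf).trans (le_of_eq ?_)
      congr 2
      have : √(lam * σ) = 1 / σ := by
        rw [Real.sqrt_eq_iff_mul_self_eq (by positivity) (by positivity)]
        field_simp; linarith
      rw [this]; field_simp
    · exact eLpNorm_two_le_of_lintegral (by positivity) (hc 2 σ lam f two_ne_zero hσ hfm)
  · refine tri 3 K₂ (by norm_num) hK₂.le (by linarith)
      (fun ε hε => h3 ε σ lam f hε hσ hlam h1 hfm hf) ?_
    exact eLpNorm_three_le_of_lintegral (by positivity) (hc 3 σ lam f three_ne_zero hσ hfm)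

end Fold

/-! ### The bilinear estimate for separated supports. -/

section Bilinear

variable {φ : ℝ × ℝ → ℝ} {X Y : Set ℝ} {c C : ℝ} {χ : ℝ × ℝ → ℂ}

theorem oscOp_congr_ae (φ : ℝ × ℝ → ℝ) (χ : ℝ × ℝ → ℂ) (lam : ℝ) {f g : ℝ → ℂ}
    (h : f =ᵐ[volume] g) : oscOp φ χ lam f = oscOp φ χ lam g := by
  ext x
  simp only [oscOp_eq]
  refine integral_congr_ae ?_
  filter_upwards [h] with y hy
  rw [hy]

/-- Takes σ = λ^{-1/3} and passes to a measurable representative of f, which the truncation argument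
needs. -/
theorem exists_oscOp_fold_rpow_le (hφ : FoldPhase φ X Y c C) (hφc : HasCompactSupport φ)
    (hχ : ContDiff ℝ ∞ χ) (hχs : tsupport χ ⊆ X ×ˢ Y) : ∃ K : ℝ, 0 < K ∧
    ∀ (lam : ℝ) (f : ℝ → ℂ), 0 < lam → MemLp f 2 volume →
      eLpNorm (oscOp φ χ lam f) 2 volume ≤
        ENNReal.ofReal (K * lam ^ (-(1 / 3) : ℝ)) * eLpNorm f 2 volume ∧
      eLpNorm (oscOp φ χ lam f) 3 volume ≤
        ENNReal.ofReal (K * lam ^ (-(1 / 3) : ℝ)) * eLpNorm f 3 volume := by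
  obtain ⟨K, hK, h⟩ := exists_oscOp_fold_le hφ hφc hχ hχs
  refine ⟨K, hK, fun lam f hlam hf => ?_⟩
  have h1 : lam * (lam ^ (-(1 / 3) : ℝ)) ^ 3 = 1 := by
    rw [← Real.rpow_natCast, ← Real.rpow_mul hlam.le]
    norm_num
    rw [Real.rpow_neg_one, mul_inv_cancel₀ hlam.ne']
  have h2 := h _ lam (hf.1.mk f) (Real.rpow_pos_of_pos hlam _) hlam h1
    hf.1.stronglyMeasurable_mk.measurable ((memLp_congr_ae hf.1.ae_eq_mk).1 hf)
  rwa [← oscOp_congr_ae φ χ lam hf.1.ae_eq_mk, ← eLpNorm_congr_ae hf.1.ae_eq_mk,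
    ← eLpNorm_congr_ae hf.1.ae_eq_mk] at h2

/-- Away from the fold `φ_{xy} = 0`, the operator satisfies the nondegenerate `L²` bound. -/
theorem exists_amp_eq_of_two_mul_le (hφ : FoldPhase φ X Y c C) (hφc : HasCompactSupport φ)
    (hχ : ContDiff ℝ ∞ χ) (hχs : tsupport χ ⊆ X ×ˢ Y) {τ : ℝ} (hτ : 0 < τ) :
    ∃ K : ℝ, 0 < K ∧ ∀ lam : ℝ, 0 < lam → ∃ a : ℝ × ℝ → ℂ, Continuous a ∧
      (∀ p, χ p = 0 → a p = 0) ∧ (∀ p, 2 * τ ≤ |mixed φ p| → a p = χ p) ∧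
      ∀ f : ℝ → ℂ, MemLp f 2 volume → eLpNorm (oscOp φ a lam f) 2 volume ≤
        ENNReal.ofReal (K * lam ^ (-(1 / 2) : ℝ)) * eLpNorm f 2 volume := by
  obtain ⟨K₁, hK₁, h₁⟩ := exists_farAmp_L2_le hφ hφc hχ hχs
  obtain ⟨K₂, hK₂, h₂⟩ := exists_oscOp_fold_rpow_le hφ hφc hχ hχs
  have hτ' : 0 < τ ^ (-(1 / 2) : ℝ) := Real.rpow_pos_of_pos hτ _
  refine ⟨(2 * K₁ + K₂) * τ ^ (-(1 / 2) : ℝ), by positivity, fun lam hlam => ?_⟩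
  have hl' : 0 < lam ^ (-(1 / 2) : ℝ) := Real.rpow_pos_of_pos hlam _
  -- For λτ³ ≥ 1 the two far parts at scale τ give the bound. Otherwise nothing need be removed: λ <
  -- τ^{-3} gives λ^{-1/3} ≤ τ^{-1/2}λ^{-1/2}, so the fold bound suffices. Hence the amplitude may
  -- depend on λ, and every λ > 0 is covered.
  rcases le_or_gt 1 (lam * τ ^ 3) with hbig | hsmall
  · refine ⟨fun p => farAmp φ χ 1 τ p + farAmp φ χ (-1) τ p,
      (contDiff_farAmp hφ.smooth hχ 1 τ).continuous.add
        (contDiff_farAmp hφ.smooth hχ (-1) τ).continuous, fun p hp => by simp [farAmp, hp],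
      fun p hp => ?_, fun f hf => ?_⟩
    · simp only [farAmp, one_mul, neg_one_mul]
      rcases le_total 0 (mixed φ p) with h0 | h0
      · rw [abs_of_nonneg h0] at hp
        rw [cutoff_of_two_le (t := mixed φ p / τ) (by rwa [le_div_iff₀ hτ]),
          cutoff_of_le_one (by rw [div_le_one hτ]; linarith)]
        simp
      · rw [abs_of_nonpos h0] at hp
        rw [cutoff_of_two_le (t := -mixed φ p / τ) (by rwa [le_div_iff₀ hτ]),
          cutoff_of_le_one (by rw [div_le_one hτ]; linarith)]
        simp
    · have hm : ∀ ε, AEStronglyMeasurable (oscOp φ (farAmp φ χ ε τ) lam f) volume := fun ε =>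
        (measurable_oscOp hφ.smooth.continuous (contDiff_farAmp hφ.smooth hχ ε τ).continuous
          hf.1 lam).aestronglyMeasurable
      have hsum : oscOp φ (fun p => farAmp φ χ 1 τ p + farAmp φ χ (-1) τ p) lam f =
          oscOp φ (farAmp φ χ 1 τ) lam f + oscOp φ (farAmp φ χ (-1) τ) lam f := by
        ext x
        exact integral_oscKernel_add (integrable_oscKernel_farAmp hφ hχ hχs 1 τ lam hf x)
          (integrable_oscKernel_farAmp hφ hχ hχs (-1) τ lam hf x)
      rw [hsum]
      refine (eLpNorm_add_le (hm 1) (hm (-1)) one_le_two).trans ?_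
      refine (add_le_add (h₁ 1 τ lam f (Or.inl rfl) hτ hlam hbig hf)
        (h₁ (-1) τ lam f (Or.inr rfl) hτ hlam hbig hf)).trans ?_
      rw [← add_mul, ← ENNReal.ofReal_add (by positivity) (by positivity)]
      have hs : K₁ / √(lam * τ) = K₁ * τ ^ (-(1 / 2) : ℝ) * lam ^ (-(1 / 2) : ℝ) := by
        rw [Real.sqrt_eq_rpow, Real.mul_rpow hlam.le hτ.le, Real.rpow_neg hlam.le,
          Real.rpow_neg hτ.le]
        field_simp
      rw [hs]
      gcongr
      nlinarith [mul_pos (mul_pos hK₂ hτ') hl']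
  · refine ⟨χ, hχ.continuous, fun p hp => hp, fun p _ => rfl, fun f hf => ?_⟩
    refine (h₂ lam f hlam hf).1.trans ?_
    gcongr ENNReal.ofReal ?_ * _
    have h6 : 1 ≤ τ ^ (-(1 / 2) : ℝ) * lam ^ (-(1 / 6) : ℝ) := by
      have e : τ ^ (-(1 / 2) : ℝ) * lam ^ (-(1 / 6) : ℝ) = (lam * τ ^ 3) ^ (-(1 / 6) : ℝ) := by
        rw [Real.mul_rpow hlam.le (by positivity), ← Real.rpow_natCast τ 3,
          ← Real.rpow_mul hτ.le, mul_comm]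
        norm_num
      rw [e]
      exact Real.one_le_rpow_of_pos_of_le_one_of_nonpos (by positivity) hsmall.le (by norm_num)
    have e2 : lam ^ (-(1 / 2) : ℝ) = lam ^ (-(1 / 6) : ℝ) * lam ^ (-(1 / 3) : ℝ) := by
      rw [← Real.rpow_add hlam]; norm_num
    have h3 : 0 < lam ^ (-(1 / 3) : ℝ) := Real.rpow_pos_of_pos hlam _
    calc K₂ * lam ^ (-(1 / 3) : ℝ)
        ≤ (2 * K₁ + K₂) * lam ^ (-(1 / 3) : ℝ) * 1 := by nlinarith [mul_pos hK₁ h3]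
      _ ≤ (2 * K₁ + K₂) * lam ^ (-(1 / 3) : ℝ) *
          (τ ^ (-(1 / 2) : ℝ) * lam ^ (-(1 / 6) : ℝ)) := by gcongr
      _ = _ := by rw [e2]; ring

theorem oscOp_eq_of_forall_mem_tsupport {a : ℝ × ℝ → ℂ} {f : ℝ → ℂ} {x : ℝ}
    (h : ∀ y ∈ tsupport f, a (x, y) = χ (x, y)) (lam : ℝ) :
    oscOp φ a lam f x = oscOp φ χ lam f x := by
  refine integral_congr_ae (Filter.Eventually.of_forall fun y => ?_)
  by_cases hy : f y = 0
  · simp [hy]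
  · simp only [h y (subset_tsupport f hy)]

/-- At each x the product FG equals F'G or FG', so its modulus is at most the sum of both moduli; no
measurable partition of the line is needed. -/
theorem eLpNorm_mul_le_add {p q r : ℝ≥0∞} (hr : 1 ≤ r) (hpq : p.HolderTriple q r)
    (hqp : q.HolderTriple p r) {F G F' G' : ℝ → ℂ}
    (hF : AEStronglyMeasurable F volume) (hG : AEStronglyMeasurable G volume)
    (hF' : AEStronglyMeasurable F' volume) (hG' : AEStronglyMeasurable G' volume)
    (h : ∀ x, F' x = F x ∨ G' x = G x) :
    eLpNorm (fun x => F x * G x) r volume ≤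
      eLpNorm F' p volume * eLpNorm G q volume + eLpNorm F q volume * eLpNorm G' p volume := by
  calc eLpNorm (fun x => F x * G x) r volume
      ≤ eLpNorm ((fun x => ‖F' x * G x‖) + fun x => ‖F x * G' x‖) r volume := by
        refine eLpNorm_mono_real fun x => ?_
        simp only [Pi.add_apply]
        rcases h x with h | h
        · rw [h]; exact le_add_of_nonneg_right (norm_nonneg _)
        · rw [h]; exact le_add_of_nonneg_left (norm_nonneg _)
    _ ≤ eLpNorm (fun x => ‖F' x * G x‖) r volume + eLpNorm (fun x => ‖F x * G' x‖) r volume :=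
        eLpNorm_add_le (hF'.mul hG).norm (hF.mul hG').norm hr
    _ ≤ _ := by
        rw [eLpNorm_norm, eLpNorm_norm]
        have h1 : eLpNorm (F' • G) r volume ≤ eLpNorm F' p volume * eLpNorm G q volume :=
          eLpNorm_smul_le_mul_eLpNorm hG hF'
        have h2 : eLpNorm (F • G') r volume ≤ eLpNorm F q volume * eLpNorm G' p volume :=
          eLpNorm_smul_le_mul_eLpNorm hG' hF
        exact add_le_add h1 h2

theorem holderTriple_two_three : ENNReal.HolderTriple 2 3 (6 / 5) := by
  constructor
  rw [ENNReal.inv_div (by norm_num) (by norm_num)]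
  rw [← ENNReal.toReal_eq_toReal_iff' (by simp) (by finiteness)]
  rw [ENNReal.toReal_add (by simp) (by simp)]
  simp
  norm_num

theorem holderTriple_three_two : ENNReal.HolderTriple 3 2 (6 / 5) := by
  have := holderTriple_two_three
  exact ENNReal.HolderTriple.symm

theorem exists_bilinear_le (hφ : FoldPhase φ X Y c C) (hφc : HasCompactSupport φ)
    (hχ : ContDiff ℝ ∞ χ) (hχs : tsupport χ ⊆ X ×ˢ Y) {δ : ℝ} (hδ : 0 < δ) :
    ∃ K : ℝ, 0 < K ∧ ∀ lam : ℝ, 0 < lam →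
      ∀ f g : ℝ → ℂ, MemLp f 2 volume → MemLp g 2 volume →
        (∀ y ∈ tsupport f, ∀ z ∈ tsupport g, δ ≤ dist y z) →
        eLpNorm (fun x => oscOp φ χ lam f x * oscOp φ χ lam g x) 1 volume
            ≤ ENNReal.ofReal (K * lam ^ (-(5 / 6) : ℝ)) *
              (eLpNorm f 2 volume * eLpNorm g 2 volume) ∧
        eLpNorm (fun x => oscOp φ χ lam f x * oscOp φ χ lam g x) (6 / 5) volume
            ≤ ENNReal.ofReal (K * lam ^ (-(5 / 6) : ℝ)) *
              (eLpNorm f 2 volume * eLpNorm g 3 volume +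
                eLpNorm f 3 volume * eLpNorm g 2 volume) := by
  have hc := hφ.c_pos
  obtain ⟨K₁, hK₁, h₁⟩ := exists_oscOp_fold_rpow_le hφ hφc hχ hχs
  -- With τ = cδ/5, two points of one slice with |φ_{xy}| < 2τ have values differing by less than
  -- 4cδ/5, hence lie at distance less than δ.
  obtain ⟨K₂, hK₂, h₂⟩ := exists_amp_eq_of_two_mul_le hφ hφc hχ hχs
    (τ := c * δ / 5) (by positivity)
  refine ⟨2 * (K₁ * K₂), by positivity, fun lam hlam f g hf hg hfg => ?_⟩
  obtain ⟨a, hac, ha0, ha, hS⟩ := h₂ lam hlam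
  have hT : ∀ {h : ℝ → ℂ}, MemLp h 2 volume →
      AEStronglyMeasurable (oscOp φ χ lam h) volume := fun hh =>
    (measurable_oscOp hφ.smooth.continuous hχ.continuous hh.1 lam).aestronglyMeasurable
  have hS' : ∀ {h : ℝ → ℂ}, MemLp h 2 volume →
      AEStronglyMeasurable (oscOp φ a lam h) volume := fun hh =>
    (measurable_oscOp hφ.smooth.continuous hac hh.1 lam).aestronglyMeasurable
  -- If both values changed at x, each support would contain a point near the fold on the slice over
  -- x, contradicting the separation by δ.
  have hdich : ∀ x, oscOp φ a lam f x = oscOp φ χ lam f x ∨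
      oscOp φ a lam g x = oscOp φ χ lam g x := by
    intro x
    by_contra! hne
    have key : ∀ h : ℝ → ℂ, oscOp φ a lam h x ≠ oscOp φ χ lam h x →
        ∃ y ∈ tsupport h, χ (x, y) ≠ 0 ∧ |mixed φ (x, y)| < 2 * (c * δ / 5) := by
      intro h hh
      by_contra! hcon
      refine hh (oscOp_eq_of_forall_mem_tsupport (fun y hy => ?_) lam)
      by_cases h0 : χ (x, y) = 0
      · rw [h0, ha0 _ h0]
      · exact ha _ (hcon y hy h0)
    obtain ⟨y, hy, hy0, hyu⟩ := key f hne.1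
    obtain ⟨z, hz, hz0, hzu⟩ := key g hne.2
    have h3 := hφ.sep_y x (mem_of_ne_zero hχs hy0).1 y (mem_of_ne_zero hχs hy0).2 z
      (mem_of_ne_zero hχs hz0).2
    have h4 := abs_sub (mixed φ (x, y)) (mixed φ (x, z))
    have h5 : c * δ ≤ c * |y - z| := mul_le_mul_of_nonneg_left (hfg y hy z hz) hc.le
    nlinarith [mul_pos hc hδ]
  set A := ENNReal.ofReal (K₁ * lam ^ (-(1 / 3) : ℝ)) with hA
  set B := ENNReal.ofReal (K₂ * lam ^ (-(1 / 2) : ℝ)) with hB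
  have hl3 : 0 < lam ^ (-(1 / 3) : ℝ) := Real.rpow_pos_of_pos hlam _
  have hl2 : 0 < lam ^ (-(1 / 2) : ℝ) := Real.rpow_pos_of_pos hlam _
  have hAB : ENNReal.ofReal (2 * (K₁ * K₂) * lam ^ (-(5 / 6) : ℝ)) = 2 * (A * B) := by
    rw [hA, hB, ← ENNReal.ofReal_mul (by positivity),
      show (2 : ℝ≥0∞) = ENNReal.ofReal 2 by simp, ← ENNReal.ofReal_mul (by norm_num)]
    congr 1
    rw [show (-(5 / 6) : ℝ) = -(1 / 3) + -(1 / 2) by norm_num, Real.rpow_add hlam]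
    ring
  rw [hAB]
  constructor
  · refine (eLpNorm_mul_le_add (p := 2) (q := 2) le_rfl inferInstance inferInstance
      (hT hf) (hT hg) (hS' hf) (hS' hg) hdich).trans ?_
    calc _ ≤ B * eLpNorm f 2 volume * (A * eLpNorm g 2 volume) +
          A * eLpNorm f 2 volume * (B * eLpNorm g 2 volume) := by
          gcongr
          exacts [hS f hf, (h₁ lam g hlam hg).1, (h₁ lam f hlam hf).1, hS g hg]
      _ = _ := by ring
  · refine (eLpNorm_mul_le_add (p := 2) (q := 3) (r := 6 / 5) ?_ holderTriple_two_three
      holderTriple_three_two (hT hf) (hT hg) (hS' hf) (hS' hg) hdich).trans ?_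
    · rw [ENNReal.le_div_iff_mul_le (by simp) (by simp)]; norm_num
    calc _ ≤ B * eLpNorm f 2 volume * (A * eLpNorm g 3 volume) +
          A * eLpNorm f 3 volume * (B * eLpNorm g 2 volume) := by
          gcongr
          exacts [hS f hf, (h₁ lam g hlam hg).2, (h₁ lam f hlam hf).2, hS g hg]
      _ = A * B * (eLpNorm f 2 volume * eLpNorm g 3 volume +
          eLpNorm f 3 volume * eLpNorm g 2 volume) := by ring
      _ ≤ 2 * (A * B) * (eLpNorm f 2 volume * eLpNorm g 3 volume +
          eLpNorm f 3 volume * eLpNorm g 2 volume) := by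
          rw [two_mul (A * B), add_mul]
          exact le_self_add

end Bilinear

/-! ### Localization of the phase and of the amplitude. -/

section Localization

open scoped Topology

theorem partialX_congr {φ ψ : ℝ × ℝ → ℝ} {p : ℝ × ℝ} (h : φ =ᶠ[𝓝 p] ψ) :
    partialX φ =ᶠ[𝓝 p] partialX ψ := by
  filter_upwards [h.eventually_nhds] with q hq
  refine Filter.EventuallyEq.deriv_eq ?_
  have hc : Continuous fun x : ℝ => (x, q.2) := by fun_prop
  exact (hc.continuousAt (x := q.1)).eventually hq

theorem partialY_congr {φ ψ : ℝ × ℝ → ℝ} {p : ℝ × ℝ} (h : φ =ᶠ[𝓝 p] ψ) :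
    partialY φ =ᶠ[𝓝 p] partialY ψ := by
  filter_upwards [h.eventually_nhds] with q hq
  refine Filter.EventuallyEq.deriv_eq ?_
  have hc : Continuous fun y : ℝ => (q.1, y) := by fun_prop
  exact (hc.continuousAt (x := q.2)).eventually hq

/-- A function smooth near a compact set agrees near it with a smooth compactly supported one. -/
theorem exists_contDiff_hasCompactSupport_eventuallyEq {φ : ℝ × ℝ → ℝ} {K U : Set (ℝ × ℝ)}
    (hU : IsOpen U) (hφ : ContDiffOn ℝ ∞ φ U) (hK : IsCompact K) (hKU : K ⊆ U) :
    ∃ ψ : ℝ × ℝ → ℝ, ContDiff ℝ ∞ ψ ∧ HasCompactSupport ψ ∧ ∀ p ∈ K, ψ =ᶠ[𝓝 p] φ := by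
  obtain ⟨K', hK', hKK', hK'U⟩ := exists_compact_between hK hU hKU
  obtain ⟨ρ, hρ1, hρ0, -⟩ := exists_contMDiffMap_one_nhds_of_subset_interior (n := ⊤)
    (modelWithCornersSelf ℝ (ℝ × ℝ)) hK.isClosed hKK'
  have hρ : ContDiff ℝ ∞ ρ := ρ.contMDiff.contDiff
  have hsupp : Function.support (fun p => ρ p * φ p) ⊆ K' := fun p hp => by
    by_contra h
    exact hp (by simp [hρ0 p h])
  have hts : tsupport (fun p => ρ p * φ p) ⊆ K' := closure_minimal hsupp hK'.isClosed
  refine ⟨fun p => ρ p * φ p, ?_, hK'.of_isClosed_subset (isClosed_tsupport _) hts, ?_⟩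
  · refine contDiff_iff_contDiffAt.2 fun p => ?_
    by_cases hp : p ∈ tsupport fun p => ρ p * φ p
    · exact hρ.contDiffAt.mul (hφ.contDiffAt (hU.mem_nhds (hK'U (hts hp))))
    · exact contDiffAt_const.congr_of_eventuallyEq (notMem_tsupport_iff_eventuallyEq.1 hp)
  · intro p hp
    filter_upwards [Filter.Eventually.filter_mono (nhds_le_nhdsSet hp) hρ1] with q hq
    rw [hq, one_mul]

theorem tsupport_subset_Icc_prod {χ : ℝ × ℝ → ℂ} {K : Set (ℝ × ℝ)} (hK : IsCompact K)
    (hχK : tsupport χ ⊆ K) {δ : ℝ} (hd : Metric.diam (tsupport χ) ≤ δ) {p : ℝ × ℝ}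
    (hp : p ∈ tsupport χ) :
    tsupport χ ⊆ Set.Icc (p.1 - δ) (p.1 + δ) ×ˢ Set.Icc (p.2 - δ) (p.2 + δ) := by
  intro q hq
  rw [← Real.closedBall_eq_Icc, ← Real.closedBall_eq_Icc, closedBall_prod_same,
    Metric.mem_closedBall]
  exact (Metric.dist_le_diam_of_mem (hK.isBounded.subset hχK) hq hp).trans hd

end Localization

/-! ### Assembly of the theorem. -/

theorem proposition10p1
    (ΩL ΩR : Set ℝ) (hΩL : IsOpen ΩL) (hΩR : IsOpen ΩR)
    (φ : ℝ × ℝ → ℝ) (hφ : ContDiffOn ℝ ∞ φ (ΩL ×ˢ ΩR))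
    (K : Set (ℝ × ℝ)) (hK : IsCompact K) (hKΩ : K ⊆ ΩL ×ˢ ΩR)
    (hxyy : ∀ p ∈ K, phiXYY φ p ≠ 0) (hxxy : ∀ p ∈ K, phiXXY φ p ≠ 0) :
    ∃ δ₀ : ℝ, 0 < δ₀ ∧
      ∀ χ : ℝ × ℝ → ℂ, ContDiff ℝ ∞ χ → tsupport χ ⊆ K → Metric.diam (tsupport χ) ≤ δ₀ →
        ∃ lam₀ : ℝ, 0 < lam₀ ∧
          ∀ δ : ℝ, 0 < δ → δ < δ₀ →
            ∃ C : ℝ, 0 < C ∧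
              ∀ lam : ℝ, lam₀ ≤ lam →
                ∀ f g : ℝ → ℂ, MemLp f 2 volume → MemLp g 2 volume →
                  (∀ y ∈ tsupport f, ∀ z ∈ tsupport g, δ ≤ dist y z) →
                  eLpNorm (fun x => oscOp φ χ lam f x * oscOp φ χ lam g x) 1 volume
                      ≤ ENNReal.ofReal (C * lam ^ (-(5 / 6) : ℝ)) *
                        (eLpNorm f 2 volume * eLpNorm g 2 volume) ∧
                  eLpNorm (fun x => oscOp φ χ lam f x * oscOp φ χ lam g x) (6 / 5) volume
                      ≤ ENNReal.ofReal (C * lam ^ (-(5 / 6) : ℝ)) *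
                        (eLpNorm f 2 volume * eLpNorm g 3 volume +
                          eLpNorm f 3 volume * eLpNorm g 2 volume) := by
  obtain ⟨ψ, hψ, hψc, hψφ⟩ :=
    exists_contDiff_hasCompactSupport_eventuallyEq (hΩL.prod hΩR) hφ hK hKΩ
  have sm : ContDiff ℝ ∞ (mixed ψ) := contDiff_partialY (contDiff_partialX hψ)
  have hy : ∀ p ∈ K, partialY (mixed ψ) p ≠ 0 := fun p hp => by
    rw [show partialY (mixed ψ) p = phiXYY φ p from
      (partialY_congr (partialY_congr (partialX_congr (hψφ p hp)))).self_of_nhds]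
    exact hxyy p hp
  have hx : ∀ p ∈ K, partialX (mixed ψ) p ≠ 0 := fun p hp => by
    rw [mixed, partialX_partialY_comm (contDiff_partialX hψ),
      show partialY (partialX (partialX ψ)) p = phiXXY φ p from
        (partialY_congr (partialX_congr (partialX_congr (hψφ p hp)))).self_of_nhds]
    exact hxxy p hp
  have hU : IsOpen {p | partialX (mixed ψ) p ≠ 0 ∧ partialY (mixed ψ) p ≠ 0} :=
    (isOpen_ne_fun (contDiff_partialX sm).continuous continuous_const).inter
      (isOpen_ne_fun (contDiff_partialY sm).continuous continuous_const)
  -- The whole box around a support point must satisfy both non-degeneracy conditions, not only its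
  -- intersection with K; δ₀ is a thickening radius that guarantees this.
  obtain ⟨δ₀, hδ₀, hthick⟩ :=
    hK.exists_cthickening_subset_open hU fun p hp => ⟨hx p hp, hy p hp⟩
  refine ⟨δ₀, hδ₀, fun χ hχ hχK hdiam => ?_⟩
  have hosc : ∀ lam f, oscOp φ χ lam f = oscOp ψ χ lam f := fun lam f => by
    ext x
    refine integral_congr_ae (Filter.Eventually.of_forall fun y => ?_)
    by_cases h : χ (x, y) = 0
    · simp [h]
    · simp only [(hψφ _ (hχK (subset_tsupport _ h))).self_of_nhds]
  simp only [hosc]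
  obtain ⟨X, Y, hX, hY, hXo, hYo, hχs, hXY⟩ : ∃ X Y : Set ℝ, IsCompact X ∧ IsCompact Y ∧
      X.OrdConnected ∧ Y.OrdConnected ∧ tsupport χ ⊆ X ×ˢ Y ∧
      X ×ˢ Y ⊆ {p | partialX (mixed ψ) p ≠ 0 ∧ partialY (mixed ψ) p ≠ 0} := by
    rcases (tsupport χ).eq_empty_or_nonempty with he | ⟨p, hp⟩
    · exact ⟨∅, ∅, isCompact_empty, isCompact_empty, Set.ordConnected_empty,
        Set.ordConnected_empty, he.subset.trans (Set.empty_subset _), by simp⟩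
    · refine ⟨_, _, isCompact_Icc, isCompact_Icc, Set.ordConnected_Icc, Set.ordConnected_Icc,
        tsupport_subset_Icc_prod hK hχK hdiam hp, subset_trans ?_ hthick⟩
      -- The metric on ℝ × ℝ is the maximum metric, so the product of intervals is a closed ball.
      rw [← Real.closedBall_eq_Icc, ← Real.closedBall_eq_Icc, closedBall_prod_same]
      exact Metric.closedBall_subset_cthickening (hχK hp) δ₀
  obtain ⟨c, C, hfold⟩ := exists_foldPhase hψ hX hY hXo hYo (fun p hp => (hXY hp).1)
    fun p hp => (hXY hp).2
  -- The estimate holds for every λ > 0, so any positive threshold would do.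
  refine ⟨1, one_pos, fun δ hδ _ => ?_⟩
  obtain ⟨K', hK', h⟩ := exists_bilinear_le hfold hψc hχ hχs hδ
  exact ⟨K', hK', fun lam hlam => h lam (one_pos.trans_le hlam)⟩
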